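/- Let $\gamma_a\ge\gamma_b>0$ and consider the traffic flow model with linear look-ahead and look-behind interaction potentials $$\partial_t u+\partial_x\big(u(1-u)e^{-\bar u+\tilde u}\big)=0,\quad t>0,\ x\in\mathbb R,\qquad u(0,x)=u_0(x),$$ $$\bar u(t,x)=\frac{2}{\gamma_a}\int_x^{x+\gamma_a}\Big(1+\frac{x-y}{\gamma_a}\Big)u(t,y)\,dy,\qquad \tilde u(t,x)=\frac{2}{\gamma_b}\int_{x-\gamma_b}^{x}\Big(1-\frac{x-y}{\gamma_b}\Big)u(t,y)\,dy .$$ Suppose that $u_0\in H^2(\mathbb R)$ (identified with its continuous, hence $C^1$, representative), that $0\le u_0(x)\le 1$ for all $x\in\mathbb R$, and that there is a point $x\in\mathbb R$ with $$u_0'(x)>\frac{\gamma_a+\gamma_b}{\gamma_a\gamma_b}\left(1+\sqrt{\frac32+\Big(\frac{\gamma_a}{2(\gamma_a+\gamma_b)}\Big)^2}\,\right).$$ Then $u_x$ blows up at a finite time. That is, there are a finite $T>0$ and a solution $u\in C([0,T);H^2(\mathbb R))$, satisfying the equation pointwise on $[0,T)\times\mathbb R$ (with the one-sided time derivative at $t=0$),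 such that every solution of this class on a time interval $[0,S)$ satisfies $S\le T$ and coincides with $u$ on $[0,S)$, and $$\lim_{t\uparrow T}\ \sup_{x\in\mathbb R}u_x(t,x)=+\infty .$$ -/

import Mathlib

open MeasureTheory Set Filter Topology
open scoped ContDiff

/-- `g` is the weak (distributional) derivative of `f` on the real line. -/
def HasWeakDeriv (f g : ℝ → ℝ) : Prop :=
  LocallyIntegrable f volume ∧ LocallyIntegrable g volume ∧
    ∀ φ : ℝ → ℝ, ContDiff ℝ ∞ φ → HasCompactSupport φ →
      ∫ x, f x * deriv φ x = -∫ x, g x * φ x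

/-- `f` belongs to the Sobolev space `H²(ℝ)`: `f` and its first two weak derivatives are
square integrable. -/
def MemH2 (f : ℝ → ℝ) : Prop :=
  ∃ f₁ f₂ : ℝ → ℝ, MemLp f 2 volume ∧ MemLp f₁ 2 volume ∧ MemLp f₂ 2 volume ∧
    HasWeakDeriv f f₁ ∧ HasWeakDeriv f₁ f₂

/-- `u ∈ C(I; H²(ℝ))`: for `t ∈ I` the function `u t` is in `H²(ℝ)`, and `u t` and its first two
weak derivatives depend continuously on `t ∈ I` in the norm of `L²(ℝ)`. -/
def ContinuousInH2 (I : Set ℝ) (u : ℝ → ℝ → ℝ) : Prop :=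
  ∃ U U₁ U₂ : ℝ → Lp ℝ 2 (volume : Measure ℝ),
    ContinuousOn U I ∧ ContinuousOn U₁ I ∧ ContinuousOn U₂ I ∧
    ∀ t ∈ I, u t =ᵐ[volume] U t ∧ HasWeakDeriv (U t) (U₁ t) ∧ HasWeakDeriv (U₁ t) (U₂ t)

/-- The look-ahead average with linear (triangular) kernel,
`ū(x) = (2/γ) ∫_x^{x+γ} (1 + (x-y)/γ) w(y) dy`. -/
noncomputable def lookAhead (γ : ℝ) (w : ℝ → ℝ) (x : ℝ) : ℝ :=
  2 / γ * ∫ y in x..(x + γ), (1 + (x - y) / γ) * w y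

/-- The look-behind average with linear (triangular) kernel,
`ũ(x) = (2/γ) ∫_{x-γ}^x (1 - (x-y)/γ) w(y) dy`. -/
noncomputable def lookBehind (γ : ℝ) (w : ℝ → ℝ) (x : ℝ) : ℝ :=
  2 / γ * ∫ y in (x - γ)..x, (1 - (x - y) / γ) * w y

/-- The flux `w (1 - w) exp(-ū + ũ)` of the traffic flow model. -/
noncomputable def trafficFlux (γa γb : ℝ) (w : ℝ → ℝ) (x : ℝ) : ℝ :=
  w x * (1 - w x) * Real.exp (-lookAhead γa w x + lookBehind γb w x)

/-- `u` is an `H²` solution on `[0, T) × ℝ` of the Cauchy problem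
`∂ₜu + ∂ₓ(u (1 - u) exp(-ū + ũ)) = 0`, `u(0, ·) = u₀`: it belongs to `C([0,T); H²(ℝ))`, each
`u t` is the continuous representative of its class (which is then continuously differentiable),
and the equation holds at every point, with the one-sided time derivative at `t = 0`. -/
structure IsTrafficSolution (γa γb : ℝ) (u₀ : ℝ → ℝ) (T : ℝ) (u : ℝ → ℝ → ℝ) : Prop where
  initial : u 0 = u₀
  continuous : ∀ t ∈ Ico 0 T, Continuous (u t)
  memH2 : ContinuousInH2 (Ico 0 T) u
  equation : ∀ t ∈ Ico 0 T, ∀ x : ℝ, ∃ q : ℝ,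
    HasDerivAt (trafficFlux γa γb (u t)) q x ∧
      HasDerivWithinAt (fun s => u s x) (-q) (Ici 0) t

/-- Absolute continuity on every bounded interval. -/
def IsLocAC (f : ℝ → ℝ) : Prop := ∀ a b, AbsolutelyContinuousOnInterval f a b

namespace IsLocAC

variable {f g : ℝ → ℝ}

theorem continuous (hf : IsLocAC f) : Continuous f := by
  refine continuous_iff_continuousAt.2 fun x => ?_
  have h := (hf (x - 1) (x + 1)).continuousOn
  rw [uIcc_of_le (by linarith)] at h
  exact h.continuousAt (Icc_mem_nhds (by linarith) (by linarith))

theorem ae_differentiableAt (hf : IsLocAC f) : ∀ᵐ x, DifferentiableAt ℝ f x := by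
  have h : ∀ n : ℕ, ∀ᵐ x : ℝ, x ∈ uIcc (-(n : ℝ)) n → DifferentiableAt ℝ f x :=
    fun n => (hf _ _).ae_differentiableAt
  filter_upwards [ae_all_iff.2 h] with x hx
  obtain ⟨n, hn⟩ := exists_nat_ge |x|
  refine hx n ?_
  rw [uIcc_of_le (by linarith [abs_nonneg x])]
  exact abs_le.1 hn

theorem integral_deriv (hf : IsLocAC f) (a b : ℝ) : ∫ x in a..b, deriv f x = f b - f a :=
  (hf a b).integral_deriv_eq_sub

theorem locallyIntegrable_deriv (hf : IsLocAC f) : LocallyIntegrable (deriv f) volume := by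
  intro x
  refine ⟨Icc (x - 1) (x + 1), Icc_mem_nhds (by linarith) (by linarith), ?_⟩
  have h := (hf (x - 1) (x + 1)).intervalIntegrable_deriv
  rwa [intervalIntegrable_iff_integrableOn_Icc_of_le (by linarith)] at h

theorem sub (hf : IsLocAC f) (hg : IsLocAC g) : IsLocAC (fun x => f x - g x) :=
  fun a b => (hf a b).fun_sub (hg a b)

theorem of_abs_sub_le {C : ℝ} (hg : IsLocAC g)
    (h : ∀ x y, |f y - f x| ≤ C * (|y - x| + |g y - g x|)) : IsLocAC f := by
  intro a b
  have hid : AbsolutelyContinuousOnInterval (fun x : ℝ => x) a b :=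
    (LipschitzWith.id.lipschitzOnWith (s := uIcc a b)).absolutelyContinuousOnInterval
  have hlim := (hid.add (hg a b)).const_mul C
  have h1 : Tendsto (fun E : ℕ × (ℕ → ℝ × ℝ) => C *
      (∑ i ∈ Finset.range E.1, dist (E.2 i).1 (E.2 i).2 +
        ∑ i ∈ Finset.range E.1, dist (g (E.2 i).1) (g (E.2 i).2)))
      (AbsolutelyContinuousOnInterval.totalLengthFilter ⊓
        𝓟 (AbsolutelyContinuousOnInterval.disjWithin a b)) (𝓝 0) := by
    simpa using (Tendsto.add hid (hg a b)).const_mul C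
  refine squeeze_zero (fun E => Finset.sum_nonneg fun _ _ => dist_nonneg) (fun E => ?_) h1
  rw [← Finset.sum_add_distrib, Finset.mul_sum]
  refine Finset.sum_le_sum fun i _ => ?_
  simpa [Real.dist_eq] using h (E.2 i).2 (E.2 i).1

theorem comp_monotone_lipschitz {Y : ℝ → ℝ} {C : ℝ} (hf : IsLocAC f) (hY : Monotone Y)
    (hC : ∀ x y, |Y y - Y x| ≤ C * |y - x|) : IsLocAC (fun x => f (Y x)) := by
  intro a b
  rw [absolutelyContinuousOnInterval_iff]
  intro ε hε
  obtain ⟨δ, hδ, H⟩ := (absolutelyContinuousOnInterval_iff f (Y a) (Y b)).1 (hf _ _) ε hε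
  have hC0 : 0 ≤ C := by simpa using (abs_nonneg _).trans (hC 0 1)
  refine ⟨δ / (C + 1), by positivity, fun E hE hlen => ?_⟩
  refine H (E.1, fun i => (Y (E.2 i).1, Y (E.2 i).2)) ⟨fun i hi => ?_, ?_⟩ ?_
  · have := hE.1 i hi
    exact ⟨hY.mapsTo_uIcc this.1, hY.mapsTo_uIcc this.2⟩
  · intro i hi j hj hij
    have h1 := hE.2 hi hj hij
    simp only [Function.onFun, Set.disjoint_left, mem_uIoc] at h1 ⊢
    have key : ∀ p q : ℝ × ℝ, ∀ z, ((Y p.1 < z ∧ z ≤ Y p.2) ∨ (Y p.2 < z ∧ z ≤ Y p.1)) →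
        ((Y q.1 < z ∧ z ≤ Y q.2) ∨ (Y q.2 < z ∧ z ≤ Y q.1)) →
        ∃ t, ((p.1 < t ∧ t ≤ p.2) ∨ (p.2 < t ∧ t ≤ p.1)) ∧
          ((q.1 < t ∧ t ≤ q.2) ∨ (q.2 < t ∧ t ≤ q.1)) := by
      rintro ⟨p1, p2⟩ ⟨q1, q2⟩ z hp hq
      have hlt : ∀ {s t}, Y s < Y t → s < t := fun h => hY.reflect_lt h
      refine ⟨min (max p1 p2) (max q1 q2), ?_, ?_⟩ <;>
      rcases hp with hp | hp <;> rcases hq with hq | hq <;>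
      (have a1 := hlt (hp.1.trans_le hp.2); have a2 := hlt (hq.1.trans_le hq.2)
       have a3 := hlt (hp.1.trans_le hq.2); have a4 := hlt (hq.1.trans_le hp.2)
       simp only at *
       grind)
    intro z hz1 hz2
    obtain ⟨t, ht1, ht2⟩ := key (E.2 i) (E.2 j) z hz1 hz2
    exact h1 ht1 ht2
  · have : ∑ i ∈ Finset.range E.1, dist (Y (E.2 i).1) (Y (E.2 i).2) ≤
        C * ∑ i ∈ Finset.range E.1, dist (E.2 i).1 (E.2 i).2 := by
      rw [Finset.mul_sum]
      exact Finset.sum_le_sum fun i _ => hC _ _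
    refine this.trans_lt ?_
    have h0 : 0 ≤ ∑ i ∈ Finset.range E.1, dist (E.2 i).1 (E.2 i).2 :=
      Finset.sum_nonneg fun _ _ => dist_nonneg
    rw [lt_div_iff₀ (by positivity)] at hlen
    nlinarith

theorem hasWeakDeriv (hf : IsLocAC f) : HasWeakDeriv f (deriv f) := by
  refine ⟨hf.continuous.locallyIntegrable, hf.locallyIntegrable_deriv, fun φ hφ hc => ?_⟩
  obtain ⟨R, hR⟩ := hc.isCompact.isBounded.subset_closedBall 0
  have hout : ∀ x, x ∉ Icc (-|R|) |R| → φ x = 0 ∧ deriv φ x = 0 := by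
    intro x hx
    have hx' : x ∉ tsupport φ := by
      intro h
      have := hR h
      rw [Metric.mem_closedBall, Real.dist_eq, sub_zero] at this
      exact hx (abs_le.1 (this.trans (le_abs_self R)))
    exact ⟨image_eq_zero_of_notMem_tsupport hx',
      image_eq_zero_of_notMem_tsupport fun h => hx' (tsupport_deriv_subset h)⟩
  have hRR : -(|R| + 1) ≤ |R| + 1 := by linarith [abs_nonneg R]
  have hconv : ∀ F : ℝ → ℝ, (∀ x, x ∉ Icc (-|R|) |R| → F x = 0) →
      ∫ x, F x = ∫ x in (-(|R| + 1))..(|R| + 1), F x := by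
    intro F hF
    rw [intervalIntegral.integral_eq_integral_of_support_subset]
    intro x hx
    have : x ∈ Icc (-|R|) |R| := by
      by_contra h
      exact hx (hF x h)
    exact ⟨by linarith [this.1], by linarith [this.2]⟩
  have hφac : AbsolutelyContinuousOnInterval φ (-(|R| + 1)) (|R| + 1) :=
    (hφ.of_le (by simp)).contDiffOn.absolutelyContinuousOnInterval
  rw [hconv _ fun x hx => by simp [(hout x hx).2], hconv _ fun x hx => by simp [(hout x hx).1],
    (hf _ _).integral_mul_deriv_eq_deriv_mul hφac]
  rw [(hout (|R| + 1) (by simp)).1, (hout (-(|R| + 1)) (by simp)).1]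
  simp

end IsLocAC

theorem intervalIntegrable_of_locallyIntegrable {g : ℝ → ℝ} (hg : LocallyIntegrable g volume)
    (a b : ℝ) : IntervalIntegrable g volume a b :=
  intervalIntegrable_iff.mpr <|
    (hg.integrableOn_isCompact isCompact_uIcc).mono_set uIoc_subset_uIcc

theorem isLocAC_integral {g : ℝ → ℝ} (hg : LocallyIntegrable g volume) (c : ℝ) :
    IsLocAC (fun x => c + ∫ t in (0 : ℝ)..x, g t) := by
  intro a b
  have h1 : AbsolutelyContinuousOnInterval (fun x => ∫ t in (0 : ℝ)..x, g t)
      (min a 0) (max b (max a 0)) :=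
    (intervalIntegrable_of_locallyIntegrable hg _ _).absolutelyContinuousOnInterval_intervalIntegral
      (by rw [uIcc_of_le (by simp)]; simp)
  have h2 : AbsolutelyContinuousOnInterval (fun x => ∫ t in (0 : ℝ)..x, g t)
      (min (min a b) 0) (max (max a b) 0) :=
    (intervalIntegrable_of_locallyIntegrable hg _ _).absolutelyContinuousOnInterval_intervalIntegral
      (by rw [uIcc_of_le (by simp)]; simp)
  have h3 := h2.mono (c := a) (d := b) (by
    rw [uIcc_of_le (a := min (min a b) 0) (by simp)]
    exact uIcc_subset_Icc (by simp) (by simp))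
  have h4 : AbsolutelyContinuousOnInterval (fun _ : ℝ => c) a b :=
    ((LipschitzWith.const c).lipschitzOnWith (s := uIcc a b) (K := 0)
      ).absolutelyContinuousOnInterval
  exact h4.fun_add h3

theorem deriv_integral_ae_eq {g : ℝ → ℝ} (hg : LocallyIntegrable g volume) (c : ℝ) :
    deriv (fun x => c + ∫ t in (0 : ℝ)..x, g t) =ᵐ[volume] g := by
  filter_upwards [LocallyIntegrable.ae_hasDerivAt_integral hg] with x hx
  exact ((hx 0).const_add c).deriv

/-- A locally integrable function with vanishing weak derivative is constant. -/
theorem ae_eq_const_of_weakDeriv_zero {h : ℝ → ℝ} (hh : LocallyIntegrable h volume)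
    (H : ∀ φ : ℝ → ℝ, ContDiff ℝ ∞ φ → HasCompactSupport φ → ∫ x, h x * deriv φ x = 0) :
    ∃ c : ℝ, h =ᵐ[volume] fun _ => c := by
  let b : ContDiffBump (0 : ℝ) := ⟨1, 2, by norm_num, by norm_num⟩
  let ψ : ℝ → ℝ := b.normed volume
  have hψ : ContDiff ℝ ∞ ψ := b.contDiff_normed
  have hψc : HasCompactSupport ψ := b.hasCompactSupport_normed
  have hψi : ∫ x, ψ x = 1 := b.integral_normed
  refine ⟨∫ x, h x * ψ x, ?_⟩
  set c := ∫ x, h x * ψ x with hc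
  have hint : ∀ φ : ℝ → ℝ, ContDiff ℝ ∞ φ → HasCompactSupport φ →
      Integrable (fun x => h x * φ x) := fun φ hφ hφc => by
    simpa [smul_eq_mul, mul_comm] using
      hh.integrable_smul_left_of_hasCompactSupport hφ.continuous hφc
  have key := ae_eq_zero_of_integral_contDiff_smul_eq_zero (μ := volume) (f := fun x => h x - c)
    (hh.sub (locallyIntegrable_const c)) (fun φ hφ hφc => by
      let χ : ℝ → ℝ := fun x => φ x - (∫ y, φ y) * ψ x
      have hχ : ContDiff ℝ ∞ χ := hφ.sub (contDiff_const.mul hψ)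
      have hχc : HasCompactSupport χ := hφc.sub (hψc.mul_left)
      have hφi : Integrable φ := hφ.continuous.integrable_of_hasCompactSupport hφc
      have hψint : Integrable ψ := hψ.continuous.integrable_of_hasCompactSupport hψc
      have hχi : Integrable χ := hχ.continuous.integrable_of_hasCompactSupport hχc
      have hχ0 : ∫ x, χ x = 0 := by
        simp only [χ]
        rw [integral_sub hφi (hψint.const_mul _), integral_const_mul, hψi]
        ring
      obtain ⟨R, hR⟩ := hχc.isCompact.isBounded.subset_closedBall 0
      have hout : ∀ x, |R| < |x| → χ x = 0 := fun x hx => by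
        refine image_eq_zero_of_notMem_tsupport fun hmem => ?_
        have := hR hmem
        rw [Metric.mem_closedBall, Real.dist_eq, sub_zero] at this
        linarith [le_abs_self R]
      let Φ : ℝ → ℝ := fun x => ∫ t in (-(|R| + 1))..x, χ t
      have hΦd : ∀ x, HasDerivAt Φ (χ x) x := fun x =>
        intervalIntegral.integral_hasDerivAt_right (hχ.continuous.intervalIntegrable _ _)
          (hχ.continuous.stronglyMeasurableAtFilter _ _) hχ.continuous.continuousAt
      have hΦderiv : deriv Φ = χ := funext fun x => (hΦd x).deriv
      have hΦ : ContDiff ℝ ∞ Φ := by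
        rw [contDiff_infty_iff_deriv, hΦderiv]
        exact ⟨fun x => (hΦd x).differentiableAt, hχ⟩
      have hΦc : HasCompactSupport Φ := by
        refine HasCompactSupport.of_support_subset_isCompact
          (isCompact_Icc (a := -(|R| + 1)) (b := |R| + 1)) fun x hx => ?_
        by_contra hxm
        apply hx
        rcases lt_or_ge x (-(|R| + 1)) with hlt | hge
        · refine (intervalIntegral.integral_congr (g := fun _ => 0) fun t ht => ?_).trans (by simp)
          rw [uIcc_of_ge hlt.le] at ht
          exact hout t (by linarith [ht.2, neg_le_abs t])
        · have hgt : |R| + 1 < x := by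
            by_contra hle
            exact hxm ⟨hge, not_lt.1 hle⟩
          have h1 : ∫ x, χ x = ∫ t in (-(|R| + 1))..x, χ t := by
            rw [intervalIntegral.integral_eq_integral_of_support_subset]
            intro t ht
            have : |t| ≤ |R| := by
              by_contra hlt
              exact ht (hout t (not_le.1 hlt))
            have := abs_le.1 this
            exact ⟨by linarith, by linarith⟩
          exact h1.symm.trans hχ0
      have h0 := H Φ hΦ hΦc
      rw [hΦderiv] at h0
      have h1 : ∫ x, h x * χ x = (∫ x, h x * φ x) - (∫ y, φ y) * c := by
        rw [hc, ← integral_const_mul, ← integral_sub (hint φ hφ hφc) ((hint ψ hψ hψc).const_mul _)]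
        refine integral_congr_ae (ae_of_all _ fun x => ?_)
        simp only [χ]
        ring
      have h2 : ∫ x, φ x • (h x - c) = (∫ x, h x * φ x) - (∫ y, φ y) * c := by
        rw [← integral_mul_const, ← integral_sub (hint φ hφ hφc) (hφi.mul_const _)]
        refine integral_congr_ae (ae_of_all _ fun x => ?_)
        simp only [smul_eq_mul]
        ring
      rw [h2, ← h1, h0])
  filter_upwards [key] with x hx
  linarith

/-- A function with a weak derivative agrees almost everywhere with a primitive of it. -/
theorem HasWeakDeriv.exists_ae_eq {f g : ℝ → ℝ} (h : HasWeakDeriv f g) :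
    ∃ c : ℝ, f =ᵐ[volume] fun x => c + ∫ t in (0 : ℝ)..x, g t := by
  have hac := isLocAC_integral h.2.1 0
  have hw := hac.hasWeakDeriv
  have hl : LocallyIntegrable (fun x => f x - (0 + ∫ t in (0 : ℝ)..x, g t)) volume :=
    h.1.sub hac.continuous.locallyIntegrable
  obtain ⟨c, hc⟩ := ae_eq_const_of_weakDeriv_zero hl (fun φ hφ hφc => by
    have hd : ContDiff ℝ ∞ (deriv φ) := (contDiff_infty_iff_deriv.1 hφ).2
    have hdc : HasCompactSupport (deriv φ) := hφc.deriv
    have i1 : Integrable (fun x => f x * deriv φ x) := by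
      simpa [smul_eq_mul, mul_comm] using
        h.1.integrable_smul_left_of_hasCompactSupport hd.continuous hdc
    have i2 : Integrable (fun x => (0 + ∫ t in (0 : ℝ)..x, g t) * deriv φ x) := by
      simpa [smul_eq_mul, mul_comm] using
        hac.continuous.locallyIntegrable.integrable_smul_left_of_hasCompactSupport
          hd.continuous hdc
    have e1 := h.2.2 φ hφ hφc
    have e2 := hw.2.2 φ hφ hφc
    have e3 : ∫ x, deriv (fun x => 0 + ∫ t in (0 : ℝ)..x, g t) x * φ x = ∫ x, g x * φ x := by
      refine integral_congr_ae ?_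
      filter_upwards [deriv_integral_ae_eq h.2.1 0] with x hx
      rw [hx]
    calc ∫ x, (f x - (0 + ∫ t in (0 : ℝ)..x, g t)) * deriv φ x
        = ∫ x, (f x * deriv φ x - (0 + ∫ t in (0 : ℝ)..x, g t) * deriv φ x) := by
          simp only [sub_mul]
      _ = 0 := by rw [integral_sub i1 i2, e1, e2, e3, sub_self])
  refine ⟨c, ?_⟩
  filter_upwards [hc] with x hx
  linarith

/-- Pointwise description of the continuous representative of an element of `H²(ℝ)`. -/
structure IsH2 (f : ℝ → ℝ) : Prop where
  differentiable : Differentiable ℝ f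
  deriv_ac : IsLocAC (deriv f)
  memLp : MemLp f 2 volume
  memLp_deriv : MemLp (deriv f) 2 volume
  memLp_deriv2 : MemLp (deriv (deriv f)) 2 volume

open Classical in
/-- The class in `L²(ℝ)` of a square integrable function, and `0` for other functions. -/
noncomputable def l2Class (f : ℝ → ℝ) : Lp ℝ 2 (volume : Measure ℝ) :=
  if h : MemLp f 2 volume then h.toLp f else 0

theorem coeFn_l2Class {f : ℝ → ℝ} (h : MemLp f 2 volume) : l2Class f =ᵐ[volume] f := by
  rw [l2Class, dif_pos h]
  exact h.coeFn_toLp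

theorem l2Class_eq {f : ℝ → ℝ} {U : Lp ℝ 2 (volume : Measure ℝ)} (h : f =ᵐ[volume] U) :
    l2Class f = U := by
  have hf : MemLp f 2 volume := (memLp_congr_ae h).2 (Lp.memLp U)
  exact Lp.ext ((coeFn_l2Class hf).trans h)

theorem isLocAC_of_continuous_deriv {f : ℝ → ℝ} (hf : Differentiable ℝ f)
    (hc : Continuous (deriv f)) : IsLocAC f := by
  have h := isLocAC_integral hc.locallyIntegrable (f 0)
  convert h using 2 with x
  rw [intervalIntegral.integral_deriv_eq_sub (fun x _ => hf x) (hc.intervalIntegrable _ _)]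
  ring

theorem IsH2.isLocAC {f : ℝ → ℝ} (hf : IsH2 f) : IsLocAC f :=
  isLocAC_of_continuous_deriv hf.differentiable hf.deriv_ac.continuous

theorem HasWeakDeriv.congr_ae {f g f' g' : ℝ → ℝ} (h : HasWeakDeriv f g) (hf : f =ᵐ[volume] f')
    (hg : g =ᵐ[volume] g') : HasWeakDeriv f' g' := by
  refine ⟨h.1.congr hf, h.2.1.congr hg, fun φ hφ hc => ?_⟩
  have e1 : ∫ x, f' x * deriv φ x = ∫ x, f x * deriv φ x :=
    integral_congr_ae (hf.mono fun x hx => by simp only [hx])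
  have e2 : ∫ x, g' x * φ x = ∫ x, g x * φ x :=
    integral_congr_ae (hg.mono fun x hx => by simp only [hx])
  rw [e1, e2, h.2.2 φ hφ hc]

theorem isH2_of_hasWeakDeriv {f U U₁ U₂ : ℝ → ℝ} (hc : Continuous f) (hU : f =ᵐ[volume] U)
    (h₀ : MemLp U 2 volume) (h₁ : MemLp U₁ 2 volume) (h₂ : MemLp U₂ 2 volume)
    (w₁ : HasWeakDeriv U U₁) (w₂ : HasWeakDeriv U₁ U₂) :
    IsH2 f ∧ deriv f =ᵐ[volume] U₁ ∧ deriv (deriv f) =ᵐ[volume] U₂ := by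
  obtain ⟨c₁, hc₁⟩ := w₂.exists_ae_eq
  obtain ⟨c₀, hc₀⟩ := w₁.exists_ae_eq
  set F₁ : ℝ → ℝ := fun x => c₁ + ∫ t in (0 : ℝ)..x, U₂ t with hF₁
  have ac₁ : IsLocAC F₁ := isLocAC_integral w₂.2.1 c₁
  have hint : ∀ x, ∫ t in (0 : ℝ)..x, U₁ t = ∫ t in (0 : ℝ)..x, F₁ t := fun x =>
    intervalIntegral.integral_congr_ae (hc₁.mono fun t ht _ => ht)
  have hd : ∀ x, HasDerivAt (fun x => c₀ + ∫ t in (0 : ℝ)..x, F₁ t) (F₁ x) x := fun x =>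
    (intervalIntegral.integral_hasDerivAt_right (ac₁.continuous.intervalIntegrable _ _)
      (ac₁.continuous.stronglyMeasurableAtFilter _ _) ac₁.continuous.continuousAt).const_add c₀
  have heq : f = fun x => c₀ + ∫ t in (0 : ℝ)..x, F₁ t := by
    refine (Continuous.ae_eq_iff_eq volume hc
      (continuous_iff_continuousAt.2 fun x => (hd x).continuousAt)).1 ?_
    filter_upwards [hU, hc₀] with x h1 h2
    rw [h1, h2, hint]
  have hderiv : deriv f = F₁ := by
    rw [heq]
    exact funext fun x => (hd x).deriv
  have hd2 : deriv (deriv f) =ᵐ[volume] U₂ := by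
    rw [hderiv]
    exact deriv_integral_ae_eq w₂.2.1 c₁
  have hd1 : deriv f =ᵐ[volume] U₁ := by
    rw [hderiv]
    exact hc₁.symm
  refine ⟨⟨?_, ?_, (memLp_congr_ae hU).2 h₀, (memLp_congr_ae hd1).2 h₁,
    (memLp_congr_ae hd2).2 h₂⟩, hd1, hd2⟩
  · rw [heq]
    exact fun x => (hd x).differentiableAt
  · rw [hderiv]
    exact ac₁

theorem MemH2.isH2 {f : ℝ → ℝ} (h : MemH2 f) (hc : Continuous f) : IsH2 f := by
  obtain ⟨f₁, f₂, h0, h1, h2, w1, w2⟩ := h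
  exact (isH2_of_hasWeakDeriv hc (ae_eq_refl f) h0 h1 h2 w1 w2).1

theorem continuousInH2_iff {I : Set ℝ} {u : ℝ → ℝ → ℝ} (hc : ∀ t ∈ I, Continuous (u t)) :
    ContinuousInH2 I u ↔ (∀ t ∈ I, IsH2 (u t)) ∧ ContinuousOn (fun t => l2Class (u t)) I ∧
      ContinuousOn (fun t => l2Class (deriv (u t))) I ∧
      ContinuousOn (fun t => l2Class (deriv (deriv (u t)))) I := by
  constructor
  · rintro ⟨U, U₁, U₂, hU, hU₁, hU₂, h⟩
    have key := fun t ht => isH2_of_hasWeakDeriv (hc t ht) (h t ht).1 (Lp.memLp (U t))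
      (Lp.memLp (U₁ t)) (Lp.memLp (U₂ t)) (h t ht).2.1 (h t ht).2.2
    exact ⟨fun t ht => (key t ht).1, hU.congr fun t ht => l2Class_eq (h t ht).1,
      hU₁.congr fun t ht => l2Class_eq (key t ht).2.1,
      hU₂.congr fun t ht => l2Class_eq (key t ht).2.2⟩
  · rintro ⟨h, h0, h1, h2⟩
    refine ⟨_, _, _, h0, h1, h2, fun t ht => ⟨(coeFn_l2Class (h t ht).memLp).symm, ?_, ?_⟩⟩
    · exact (h t ht).isLocAC.hasWeakDeriv.congr_ae (coeFn_l2Class (h t ht).memLp).symm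
        (coeFn_l2Class (h t ht).memLp_deriv).symm
    · exact (h t ht).deriv_ac.hasWeakDeriv.congr_ae (coeFn_l2Class (h t ht).memLp_deriv).symm
        (coeFn_l2Class (h t ht).memLp_deriv2).symm

theorem integral_abs_unit_interval_le {f : ℝ → ℝ} (hf : MemLp f 2 volume) (x : ℝ) :
    ∫ t in x..(x + 1), |f t| ≤ (eLpNorm f 2 volume).toReal := by
  rw [intervalIntegral.integral_of_le (by linarith)]
  have : IsProbabilityMeasure (volume.restrict (Ioc x (x + 1))) := ⟨by simp⟩
  have h2 : MemLp f 2 (volume.restrict (Ioc x (x + 1))) := hf.restrict _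
  have h1 : Integrable f (volume.restrict (Ioc x (x + 1))) :=
    memLp_one_iff_integrable.1 (h2.mono_exponent (by norm_num))
  have h3 : ∫ t in Ioc x (x + 1), |f t| =
      (eLpNorm f 1 (volume.restrict (Ioc x (x + 1)))).toReal := by
    rw [eLpNorm_one_eq_lintegral_enorm, ← integral_norm_eq_lintegral_enorm h1.1]
    rfl
  rw [h3]
  refine ENNReal.toReal_mono hf.eLpNorm_ne_top ?_
  exact (eLpNorm_le_eLpNorm_of_exponent_le (by norm_num) h2.1).trans
    (eLpNorm_mono_measure _ Measure.restrict_le_self)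

/-- The Sobolev embedding of `H¹(ℝ)` into the bounded functions. -/
theorem IsLocAC.abs_le {f g : ℝ → ℝ} (hf : IsLocAC f) (hg : deriv f =ᵐ[volume] g)
    (h0 : MemLp f 2 volume) (h1 : MemLp g 2 volume) (x : ℝ) :
    |f x| ≤ (eLpNorm f 2 volume).toReal + (eLpNorm g 2 volume).toReal := by
  have hgl : LocallyIntegrable g volume := hf.locallyIntegrable_deriv.congr hg
  have hgi : ∀ a b, IntervalIntegrable g volume a b := intervalIntegrable_of_locallyIntegrable hgl
  have key : ∀ y ∈ Icc x (x + 1), |f x| ≤ |f y| + ∫ t in x..(x + 1), |g t| := by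
    intro y hy
    have e : ∫ t in x..y, g t = f y - f x := by
      rw [← hf.integral_deriv x y]
      exact intervalIntegral.integral_congr_ae (hg.mono fun t ht _ => ht.symm)
    have h3 : |∫ t in x..y, g t| ≤ ∫ t in x..y, |g t| :=
      intervalIntegral.abs_integral_le_integral_abs hy.1
    have h4 : ∫ t in x..y, |g t| ≤ ∫ t in x..(x + 1), |g t| :=
      intervalIntegral.integral_mono_interval le_rfl hy.1 hy.2
        (ae_of_all _ fun t => abs_nonneg _) (hgi _ _).abs
    have h5 : |f x| ≤ |f y| + |f y - f x| := by
      have := abs_sub_abs_le_abs_sub (f x) (f y)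
      rw [abs_sub_comm] at this
      linarith
    rw [e] at h3
    linarith
  have hint : ∫ _ in x..(x + 1), |f x| ≤
      ∫ y in x..(x + 1), (|f y| + ∫ t in x..(x + 1), |g t|) :=
    intervalIntegral.integral_mono_on (by linarith) (by simp)
      ((hf.continuous.abs.add continuous_const).intervalIntegrable _ _) key
  rw [intervalIntegral.integral_add (hf.continuous.abs.intervalIntegrable _ _) (by simp)] at hint
  simp only [intervalIntegral.integral_const, add_sub_cancel_left, smul_eq_mul, one_mul] at hint
  have a1 := integral_abs_unit_interval_le h0 x
  have a2 := integral_abs_unit_interval_le h1 x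
  linarith

theorem IsLocAC.abs_sub_le_dist {f g : ℝ → ℝ} (hf : IsLocAC f) (hg : IsLocAC g)
    (hf0 : MemLp f 2 volume) (hf1 : MemLp (deriv f) 2 volume)
    (hg0 : MemLp g 2 volume) (hg1 : MemLp (deriv g) 2 volume) (x : ℝ) :
    |f x - g x| ≤ dist (l2Class f) (l2Class g) + dist (l2Class (deriv f)) (l2Class (deriv g)) := by
  have hd : deriv (fun x => f x - g x) =ᵐ[volume] fun x => deriv f x - deriv g x := by
    filter_upwards [hf.ae_differentiableAt, hg.ae_differentiableAt] with x h1 h2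
    exact (h1.hasDerivAt.sub h2.hasDerivAt).deriv
  refine ((hf.sub hg).abs_le hd (hf0.sub hg0) (hf1.sub hg1) x).trans (le_of_eq ?_)
  rw [Lp.dist_def, Lp.dist_def]
  congr 2 <;> refine eLpNorm_congr_ae ?_
  · filter_upwards [coeFn_l2Class hf0, coeFn_l2Class hg0] with y h1 h2
    simp [h1, h2]
  · filter_upwards [coeFn_l2Class hf1, coeFn_l2Class hg1] with y h1 h2
    simp [h1, h2]

theorem IsH2.exists_abs_le {f : ℝ → ℝ} (h : IsH2 f) :
    ∃ C, ∀ x, |f x| ≤ C ∧ |deriv f x| ≤ C :=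
  ⟨max _ _, fun x =>
    ⟨(h.isLocAC.abs_le (ae_eq_refl _) h.memLp h.memLp_deriv x).trans (le_max_left _ _),
      (h.deriv_ac.abs_le (ae_eq_refl _) h.memLp_deriv h.memLp_deriv2 x).trans (le_max_right _ _)⟩⟩

theorem IsH2.tendsto_cocompact {f : ℝ → ℝ} (h : IsH2 f) : Tendsto f (cocompact ℝ) (𝓝 0) := by
  have hd : ∀ x, HasDerivAt (fun x => f x * f x) (deriv f x * f x + f x * deriv f x) x := fun x =>
    (h.differentiable x).hasDerivAt.mul (h.differentiable x).hasDerivAt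
  have i1 : Integrable (fun x => f x * f x) := h.memLp.integrable_mul h.memLp
  have i2 : Integrable (fun x => deriv f x * f x + f x * deriv f x) :=
    (h.memLp_deriv.integrable_mul h.memLp).add (h.memLp.integrable_mul h.memLp_deriv)
  have t1 := tendsto_zero_of_hasDerivAt_of_integrableOn_Ioi (a := 0) (fun x _ => hd x)
    i2.integrableOn i1.integrableOn
  have t2 := tendsto_zero_of_hasDerivAt_of_integrableOn_Iic (a := 0) (fun x _ => hd x)
    i2.integrableOn i1.integrableOn
  have t3 : Tendsto (fun x => f x * f x) (cocompact ℝ) (𝓝 0) := by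
    rw [cocompact_eq_atBot_atTop]
    exact t2.sup t1
  have t4 : Tendsto (fun x => Real.sqrt (f x * f x)) (cocompact ℝ) (𝓝 0) := by
    simpa using t3.sqrt
  simp only [Real.sqrt_mul_self_eq_abs] at t4
  exact (tendsto_zero_iff_abs_tendsto_zero f).2 t4

theorem ContinuousInH2.eventually_abs_sub_le {I : Set ℝ} {u : ℝ → ℝ → ℝ}
    (hu : ContinuousInH2 I u) (hc : ∀ t ∈ I, Continuous (u t)) {t₀ : ℝ} (ht₀ : t₀ ∈ I)
    {ε : ℝ} (hε : 0 < ε) :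
    ∀ᶠ t in 𝓝[I] t₀, ∀ x, |u t x - u t₀ x| ≤ ε ∧ |deriv (u t) x - deriv (u t₀) x| ≤ ε := by
  obtain ⟨h, h0, h1, h2⟩ := (continuousInH2_iff hc).1 hu
  have e : ∀ {F : ℝ → Lp ℝ 2 (volume : Measure ℝ)}, ContinuousOn F I →
      ∀ᶠ t in 𝓝[I] t₀, dist (F t) (F t₀) < ε / 2 := fun hF =>
    Metric.tendsto_nhds.1 (hF t₀ ht₀) _ (half_pos hε)
  filter_upwards [e h0, e h1, e h2, self_mem_nhdsWithin] with t a0 a1 a2 ht x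
  refine ⟨?_, ?_⟩
  · have := (h t ht).isLocAC.abs_sub_le_dist (h t₀ ht₀).isLocAC (h t ht).memLp (h t ht).memLp_deriv
      (h t₀ ht₀).memLp (h t₀ ht₀).memLp_deriv x
    linarith
  · have := (h t ht).deriv_ac.abs_sub_le_dist (h t₀ ht₀).deriv_ac (h t ht).memLp_deriv
      (h t ht).memLp_deriv2 (h t₀ ht₀).memLp_deriv (h t₀ ht₀).memLp_deriv2 x
    linarith

/-- On a compact time interval an `H²` curve is bounded in `C¹`. -/
theorem ContinuousInH2.exists_abs_le {I : Set ℝ} {u : ℝ → ℝ → ℝ}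
    (hu : ContinuousInH2 I u) (hc : ∀ t ∈ I, Continuous (u t)) {K : Set ℝ} (hK : IsCompact K)
    (hKI : K ⊆ I) : ∃ C, 0 ≤ C ∧ ∀ t ∈ K, ∀ x, |u t x| ≤ C ∧ |deriv (u t) x| ≤ C := by
  obtain ⟨h, h0, h1, h2⟩ := (continuousInH2_iff hc).1 hu
  have e : ∀ {F : ℝ → Lp ℝ 2 (volume : Measure ℝ)}, ContinuousOn F I →
      ∃ C, ∀ t ∈ K, ‖F t‖ ≤ C := fun hF => hK.exists_bound_of_continuousOn (hF.mono hKI)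
  have n : ∀ {f : ℝ → ℝ}, MemLp f 2 volume → (eLpNorm f 2 volume).toReal = ‖l2Class f‖ :=
    fun {f} hf => by
      rw [Lp.norm_def]
      exact congrArg _ (eLpNorm_congr_ae (coeFn_l2Class hf).symm)
  obtain ⟨C0, hC0⟩ := e h0
  obtain ⟨C1, hC1⟩ := e h1
  obtain ⟨C2, hC2⟩ := e h2
  refine ⟨max 0 (max (C0 + C1) (C1 + C2)), le_max_left _ _, fun t ht x => ?_⟩
  have H := h t (hKI ht)
  have a := H.isLocAC.abs_le (ae_eq_refl _) H.memLp H.memLp_deriv x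
  have b := H.deriv_ac.abs_le (ae_eq_refl _) H.memLp_deriv H.memLp_deriv2 x
  rw [n H.memLp, n H.memLp_deriv] at a
  rw [n H.memLp_deriv, n H.memLp_deriv2] at b
  have := hC0 t ht
  have := hC1 t ht
  have := hC2 t ht
  exact ⟨by simp only [le_max_iff]; right; left; linarith,
    by simp only [le_max_iff]; right; right; linarith⟩

/-- The interaction potential `-ū + ũ`. -/
noncomputable def potential (γa γb : ℝ) (w : ℝ → ℝ) (x : ℝ) : ℝ :=
  -lookAhead γa w x + lookBehind γb w x

/-- The constant `1/γa + 1/γb`. -/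
noncomputable def kap (γa γb : ℝ) : ℝ := 1 / γa + 1 / γb

/-- The nonlocal part of the derivative of the interaction potential. -/
noncomputable def potentialRem (γa γb : ℝ) (w : ℝ → ℝ) (x : ℝ) : ℝ :=
  -(2 / γa ^ 2) * (∫ y in x..(x + γa), w y) - 2 / γb ^ 2 * ∫ y in (x - γb)..x, w y

/-- The derivative of `potentialRem`. -/
noncomputable def potentialCurv (γa γb : ℝ) (w : ℝ → ℝ) (x : ℝ) : ℝ :=
  -(2 / γa ^ 2) * (w (x + γa) - w x) - 2 / γb ^ 2 * (w x - w (x - γb))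

theorem kap_pos {γa γb : ℝ} (ha : 0 < γa) (hb : 0 < γb) : 0 < kap γa γb := by
  unfold kap; positivity

theorem hasDerivAt_integral_window {w : ℝ → ℝ} (hw : Continuous w) (a b x : ℝ) :
    HasDerivAt (fun x => ∫ y in (x + a)..(x + b), w y) (w (x + b) - w (x + a)) x := by
  have h : ∀ z, HasDerivAt (fun x => ∫ y in (0 : ℝ)..x, w y) (w z) z := fun z =>
    intervalIntegral.integral_hasDerivAt_right (hw.intervalIntegrable _ _)
      (hw.stronglyMeasurableAtFilter _ _) hw.continuousAt
  have e : (fun x => ∫ y in (x + a)..(x + b), w y) =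
      fun x => (∫ y in (0 : ℝ)..(x + b), w y) - ∫ y in (0 : ℝ)..(x + a), w y := by
    funext x
    rw [intervalIntegral.integral_interval_sub_left (hw.intervalIntegrable _ _)
      (hw.intervalIntegrable _ _)]
  rw [e]
  exact ((h (x + b)).comp_add_const x b).sub ((h (x + a)).comp_add_const x a)

theorem lookAhead_eq {γ : ℝ} {w : ℝ → ℝ} (hw : Continuous w) (x : ℝ) :
    lookAhead γ w x = 2 / γ * ((1 + x / γ) * (∫ y in (x + 0)..(x + γ), w y) -
      1 / γ * ∫ y in (x + 0)..(x + γ), y * w y) := by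
  unfold lookAhead
  rw [add_zero, ← intervalIntegral.integral_const_mul (1 + x / γ),
    ← intervalIntegral.integral_const_mul (1 / γ),
    ← intervalIntegral.integral_sub (Continuous.intervalIntegrable (by fun_prop) _ _)
      (Continuous.intervalIntegrable (by fun_prop) _ _)]
  congr 1
  refine intervalIntegral.integral_congr fun y _ => ?_
  ring

theorem lookBehind_eq {γ : ℝ} {w : ℝ → ℝ} (hw : Continuous w) (x : ℝ) :
    lookBehind γ w x = 2 / γ * ((1 - x / γ) * (∫ y in (x + -γ)..(x + 0), w y) +
      1 / γ * ∫ y in (x + -γ)..(x + 0), y * w y) := by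
  unfold lookBehind
  rw [add_zero, ← sub_eq_add_neg, ← intervalIntegral.integral_const_mul (1 - x / γ),
    ← intervalIntegral.integral_const_mul (1 / γ),
    ← intervalIntegral.integral_add (Continuous.intervalIntegrable (by fun_prop) _ _)
      (Continuous.intervalIntegrable (by fun_prop) _ _)]
  congr 1
  refine intervalIntegral.integral_congr fun y _ => ?_
  ring

theorem hasDerivAt_lookAhead {γ : ℝ} (hγ : 0 < γ) {w : ℝ → ℝ} (hw : Continuous w) (x : ℝ) :
    HasDerivAt (lookAhead γ w) (-(2 / γ) * w x + 2 / γ ^ 2 * ∫ y in x..(x + γ), w y) x := by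
  rw [funext (lookAhead_eq (γ := γ) hw)]
  have h1 := hasDerivAt_integral_window hw 0 γ x
  have h2 := hasDerivAt_integral_window (w := fun y => y * w y) (by fun_prop) 0 γ x
  have h3 : HasDerivAt (fun x => 1 + x / γ) (1 / γ) x :=
    ((hasDerivAt_id x).div_const γ).const_add 1
  refine (((h3.fun_mul h1).fun_sub (h2.const_mul (1 / γ))).const_mul (2 / γ)).congr_deriv ?_
  simp only [add_zero]
  field_simp
  ring

theorem hasDerivAt_lookBehind {γ : ℝ} (hγ : 0 < γ) {w : ℝ → ℝ} (hw : Continuous w) (x : ℝ) :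
    HasDerivAt (lookBehind γ w) (2 / γ * w x - 2 / γ ^ 2 * ∫ y in (x - γ)..x, w y) x := by
  rw [funext (lookBehind_eq (γ := γ) hw)]
  have h1 := hasDerivAt_integral_window hw (-γ) 0 x
  have h2 := hasDerivAt_integral_window (w := fun y => y * w y) (by fun_prop) (-γ) 0 x
  have h3 : HasDerivAt (fun x => 1 - x / γ) (-(1 / γ)) x :=
    ((hasDerivAt_id x).div_const γ).const_sub 1
  refine (((h3.fun_mul h1).fun_add (h2.const_mul (1 / γ))).const_mul (2 / γ)).congr_deriv ?_
  simp only [add_zero, ← sub_eq_add_neg]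
  field_simp
  ring

theorem hasDerivAt_potential {γa γb : ℝ} (ha : 0 < γa) (hb : 0 < γb)
    {w : ℝ → ℝ} (hw : Continuous w) (x : ℝ) :
    HasDerivAt (potential γa γb w) (2 * kap γa γb * w x + potentialRem γa γb w x) x := by
  refine ((hasDerivAt_lookAhead ha hw x).fun_neg.fun_add
    (hasDerivAt_lookBehind hb hw x)).congr_deriv ?_
  unfold kap potentialRem
  ring

theorem hasDerivAt_potentialRem {γa γb : ℝ} {w : ℝ → ℝ} (hw : Continuous w) (x : ℝ) :
    HasDerivAt (potentialRem γa γb w) (potentialCurv γa γb w x) x := by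
  have h1 := (hasDerivAt_integral_window hw 0 γa x).const_mul (-(2 / γa ^ 2))
  have h2 := (hasDerivAt_integral_window hw (-γb) 0 x).const_mul (2 / γb ^ 2)
  simp only [add_zero, ← sub_eq_add_neg] at h1 h2
  exact h1.sub h2

theorem hasDerivAt_trafficFlux {γa γb : ℝ} (ha : 0 < γa) (hb : 0 < γb)
    {w : ℝ → ℝ} (hw : Continuous w) {d x : ℝ} (hd : HasDerivAt w d x) :
    HasDerivAt (trafficFlux γa γb w) (Real.exp (potential γa γb w x) *
      ((1 - 2 * w x) * d + w x * (1 - w x) *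
        (2 * kap γa γb * w x + potentialRem γa γb w x))) x := by
  refine ((hd.fun_mul (hd.const_sub 1)).fun_mul
    (hasDerivAt_potential ha hb hw x).exp).congr_deriv ?_
  ring

theorem abs_lookAhead_le {γ : ℝ} (hγ : 0 < γ) {w : ℝ → ℝ} {ε : ℝ} (hε : ∀ x, |w x| ≤ ε) (x : ℝ) :
    |lookAhead γ w x| ≤ 2 * ε := by
  have h : ‖∫ y in x..(x + γ), (1 + (x - y) / γ) * w y‖ ≤ ε * |x + γ - x| := by
    refine intervalIntegral.norm_integral_le_of_norm_le_const fun y hy => ?_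
    rw [uIoc_of_le (by linarith)] at hy
    have h0 : 0 ≤ 1 + (x - y) / γ := by
      rw [← sub_nonneg, sub_zero, show 1 + (x - y) / γ = (γ + x - y) / γ by field_simp; ring]
      exact div_nonneg (by linarith [hy.2]) hγ.le
    have h1 : 1 + (x - y) / γ ≤ 1 := by
      have : (x - y) / γ ≤ 0 := div_nonpos_of_nonpos_of_nonneg (by linarith [hy.1]) hγ.le
      linarith
    rw [Real.norm_eq_abs, abs_mul, abs_of_nonneg h0]
    calc _ ≤ 1 * |w y| := by gcongr
      _ ≤ ε := by rw [one_mul]; exact hε y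
  rw [Real.norm_eq_abs, add_sub_cancel_left, abs_of_pos hγ] at h
  unfold lookAhead
  rw [abs_mul, abs_of_pos (by positivity)]
  calc _ ≤ 2 / γ * (ε * γ) := by gcongr
    _ = 2 * ε := by field_simp

theorem abs_lookBehind_le {γ : ℝ} (hγ : 0 < γ) {w : ℝ → ℝ} {ε : ℝ} (hε : ∀ x, |w x| ≤ ε) (x : ℝ) :
    |lookBehind γ w x| ≤ 2 * ε := by
  have h : ‖∫ y in (x - γ)..x, (1 - (x - y) / γ) * w y‖ ≤ ε * |x - (x - γ)| := by
    refine intervalIntegral.norm_integral_le_of_norm_le_const fun y hy => ?_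
    rw [uIoc_of_le (by linarith)] at hy
    have h0 : 0 ≤ 1 - (x - y) / γ := by
      rw [show 1 - (x - y) / γ = (γ - x + y) / γ by field_simp; ring]
      exact div_nonneg (by linarith [hy.1]) hγ.le
    have h1 : 1 - (x - y) / γ ≤ 1 := by
      have : 0 ≤ (x - y) / γ := div_nonneg (by linarith [hy.2]) hγ.le
      linarith
    rw [Real.norm_eq_abs, abs_mul, abs_of_nonneg h0]
    calc _ ≤ 1 * |w y| := by gcongr
      _ ≤ ε := by rw [one_mul]; exact hε y
  rw [Real.norm_eq_abs, sub_sub_cancel, abs_of_pos hγ] at h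
  unfold lookBehind
  rw [abs_mul, abs_of_pos (by positivity)]
  calc _ ≤ 2 / γ * (ε * γ) := by gcongr
    _ = 2 * ε := by field_simp

theorem abs_integral_window_le {w : ℝ → ℝ} {ε : ℝ} (hε : ∀ x, |w x| ≤ ε) (a b : ℝ) :
    |∫ y in a..b, w y| ≤ ε * |b - a| := by
  rw [← Real.norm_eq_abs]
  exact intervalIntegral.norm_integral_le_of_norm_le_const fun y _ => hε y

theorem abs_potential_le {γa γb : ℝ} (ha : 0 < γa) (hb : 0 < γb)
    {w : ℝ → ℝ} {ε : ℝ} (hε : ∀ x, |w x| ≤ ε) (x : ℝ) :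
    |potential γa γb w x| ≤ 4 * ε := by
  have h1 := abs_le.1 (abs_lookAhead_le ha hε x)
  have h2 := abs_le.1 (abs_lookBehind_le hb hε x)
  unfold potential
  exact abs_le.2 ⟨by linarith, by linarith⟩

theorem abs_potentialRem_le {γa γb : ℝ} (ha : 0 < γa) (hb : 0 < γb)
    {w : ℝ → ℝ} {ε : ℝ} (hε : ∀ x, |w x| ≤ ε) (x : ℝ) :
    |potentialRem γa γb w x| ≤ 2 * kap γa γb * ε := by
  have h1 := abs_integral_window_le hε x (x + γa)
  have h2 := abs_integral_window_le hε (x - γb) x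
  rw [add_sub_cancel_left, abs_of_pos ha] at h1
  rw [sub_sub_cancel, abs_of_pos hb] at h2
  unfold potentialRem
  calc _ ≤ |-(2 / γa ^ 2) * (∫ y in x..(x + γa), w y)| +
        |2 / γb ^ 2 * ∫ y in (x - γb)..x, w y| := abs_sub _ _
    _ ≤ 2 / γa ^ 2 * (ε * γa) + 2 / γb ^ 2 * (ε * γb) := by
      rw [abs_mul, abs_mul, abs_neg, abs_of_pos (by positivity : 0 < 2 / γa ^ 2),
        abs_of_pos (by positivity : 0 < 2 / γb ^ 2)]
      gcongr
    _ = _ := by unfold kap; field_simp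

theorem potential_sub {γa γb : ℝ} {w z : ℝ → ℝ} (hw : Continuous w) (hz : Continuous z) (x : ℝ) :
    potential γa γb w x - potential γa γb z x = potential γa γb (fun y => w y - z y) x := by
  have c1 : Continuous fun y => (1 + (x - y) / γa) := by fun_prop
  have c2 : Continuous fun y => (1 - (x - y) / γb) := by fun_prop
  unfold potential lookAhead lookBehind
  simp only [mul_sub]
  rw [intervalIntegral.integral_sub (Continuous.intervalIntegrable (by fun_prop) _ _)
      (Continuous.intervalIntegrable (by fun_prop) _ _),
    intervalIntegral.integral_sub (Continuous.intervalIntegrable (by fun_prop) _ _)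
      (Continuous.intervalIntegrable (by fun_prop) _ _)]
  ring

theorem potentialRem_sub {γa γb : ℝ} {w z : ℝ → ℝ} (hw : Continuous w) (hz : Continuous z) (x : ℝ) :
    potentialRem γa γb w x - potentialRem γa γb z x =
      potentialRem γa γb (fun y => w y - z y) x := by
  unfold potentialRem
  rw [intervalIntegral.integral_sub (hw.intervalIntegrable _ _) (hz.intervalIntegrable _ _),
    intervalIntegral.integral_sub (hw.intervalIntegrable _ _) (hz.intervalIntegrable _ _)]
  ring

theorem abs_potential_sub_le {γa γb : ℝ} (ha : 0 < γa) (hb : 0 < γb)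
    {w z : ℝ → ℝ} (hw : Continuous w) (hz : Continuous z) {ε : ℝ}
    (hε : ∀ x, |w x - z x| ≤ ε) (x : ℝ) :
    |potential γa γb w x - potential γa γb z x| ≤ 4 * ε := by
  rw [potential_sub hw hz]
  exact abs_potential_le ha hb hε x

theorem abs_potentialRem_sub_le {γa γb : ℝ} (ha : 0 < γa) (hb : 0 < γb)
    {w z : ℝ → ℝ} (hw : Continuous w) (hz : Continuous z) {ε : ℝ}
    (hε : ∀ x, |w x - z x| ≤ ε) (x : ℝ) :
    |potentialRem γa γb w x - potentialRem γa γb z x| ≤ 2 * kap γa γb * ε := by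
  rw [potentialRem_sub hw hz]
  exact abs_potentialRem_le ha hb hε x

theorem potentialRem_nonpos {γa γb : ℝ} (ha : 0 < γa) (hb : 0 < γb)
    {w : ℝ → ℝ} (h : ∀ x, 0 ≤ w x) (x : ℝ) :
    potentialRem γa γb w x ≤ 0 := by
  have h1 : 0 ≤ ∫ y in x..(x + γa), w y :=
    intervalIntegral.integral_nonneg (by linarith) fun y _ => h y
  have h2 : 0 ≤ ∫ y in (x - γb)..x, w y :=
    intervalIntegral.integral_nonneg (by linarith) fun y _ => h y
  unfold potentialRem
  have : 0 ≤ 2 / γa ^ 2 * ∫ y in x..(x + γa), w y := by positivity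
  have : 0 ≤ 2 / γb ^ 2 * ∫ y in (x - γb)..x, w y := by positivity
  linarith

theorem neg_le_potentialRem {γa γb : ℝ} (ha : 0 < γa) (hb : 0 < γb)
    {w : ℝ → ℝ} (h : ∀ x, 0 ≤ w x ∧ w x ≤ 1) (x : ℝ) :
    -(2 * kap γa γb) ≤ potentialRem γa γb w x := by
  have := (abs_le.1 (abs_potentialRem_le ha hb (w := w) (ε := 1)
    (fun x => abs_le.2 ⟨by linarith [(h x).1], (h x).2⟩) x)).1
  linarith

theorem continuous_integral_window {a : ℝ → ℝ → ℝ} (h : Continuous (Function.uncurry a))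
    (b c : ℝ) : Continuous fun p : ℝ × ℝ => ∫ y in (p.2 + b)..(p.2 + c), a p.1 y := by
  have e : (fun p : ℝ × ℝ => ∫ y in (p.2 + b)..(p.2 + c), a p.1 y) = fun p =>
      (∫ y in (0 : ℝ)..(p.2 + c), a p.1 y) - ∫ y in (0 : ℝ)..(p.2 + b), a p.1 y := by
    funext p
    have hp : Continuous (a p.1) := by
      exact h.comp (by fun_prop : Continuous fun y : ℝ => (p.1, y))
    rw [intervalIntegral.integral_interval_sub_left (hp.intervalIntegrable _ _)
      (hp.intervalIntegrable _ _)]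
  rw [e]
  have h' : Continuous (Function.uncurry fun (p : ℝ × ℝ) y => a p.1 y) :=
    h.comp (by fun_prop : Continuous fun q : (ℝ × ℝ) × ℝ => (q.1.1, q.2))
  exact (intervalIntegral.continuous_parametric_intervalIntegral_of_continuous h'
      (by fun_prop)).sub
    (intervalIntegral.continuous_parametric_intervalIntegral_of_continuous h' (by fun_prop))

theorem continuous_potential {γa γb : ℝ} {a : ℝ → ℝ → ℝ} (h : Continuous (Function.uncurry a)) :
    Continuous fun p : ℝ × ℝ => potential γa γb (a p.1) p.2 := by
  have hp : ∀ t, Continuous (a t) := fun t =>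
    h.comp (by fun_prop : Continuous fun y : ℝ => (t, y))
  have h' : Continuous (Function.uncurry fun t y => y * a t y) := by
    exact continuous_snd.mul h
  have e : (fun p : ℝ × ℝ => potential γa γb (a p.1) p.2) = fun p : ℝ × ℝ =>
      -(2 / γa * ((1 + p.2 / γa) * (∫ y in (p.2 + 0)..(p.2 + γa), a p.1 y) -
      1 / γa * ∫ y in (p.2 + 0)..(p.2 + γa), y * a p.1 y)) +
      2 / γb * ((1 - p.2 / γb) * (∫ y in (p.2 + -γb)..(p.2 + 0), a p.1 y) +
      1 / γb * ∫ y in (p.2 + -γb)..(p.2 + 0), y * a p.1 y) := by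
    funext p
    rw [potential, lookAhead_eq (hp _), lookBehind_eq (hp _)]
  rw [e]
  have c1 := continuous_integral_window h 0 γa
  have c2 := continuous_integral_window h' 0 γa
  have c3 := continuous_integral_window h (-γb) 0
  have c4 := continuous_integral_window h' (-γb) 0
  fun_prop

theorem continuous_potentialRem {γa γb : ℝ} {a : ℝ → ℝ → ℝ}
    (h : Continuous (Function.uncurry a)) :
    Continuous fun p : ℝ × ℝ => potentialRem γa γb (a p.1) p.2 := by
  have c1 := continuous_integral_window h 0 γa
  have c3 := continuous_integral_window h (-γb) 0
  simp only [add_zero, ← sub_eq_add_neg] at c1 c3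
  unfold potentialRem
  fun_prop

theorem continuous_potentialCurv {γa γb : ℝ} {a : ℝ → ℝ → ℝ}
    (h : Continuous (Function.uncurry a)) :
    Continuous fun p : ℝ × ℝ => potentialCurv γa γb (a p.1) p.2 := by
  have h' : ∀ c, Continuous fun p : ℝ × ℝ => a p.1 (p.2 + c) := fun c =>
    h.comp (by fun_prop : Continuous fun p : ℝ × ℝ => (p.1, p.2 + c))
  have c1 := h' γa
  have c2 := h' (-γb)
  have c3 := h' 0
  simp only [add_zero, ← sub_eq_add_neg] at c1 c2 c3
  unfold potentialCurv
  fun_prop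

theorem ContDiff.exists_lipschitzOnWith_closedBall {E F : Type*} [NormedAddCommGroup E]
    [NormedSpace ℝ E] [ProperSpace E] [NormedAddCommGroup F] [NormedSpace ℝ F] {f : E → F}
    (hf : ContDiff ℝ 1 f) (R : ℝ) : ∃ K, LipschitzOnWith K f (Metric.closedBall 0 R) :=
  hf.contDiffOn.exists_lipschitzOnWith one_ne_zero (convex_closedBall 0 R)
    (isCompact_closedBall 0 R)

/-- The left derivative is nonnegative at a maximum from the left. -/
theorem HasDerivAt.nonneg_of_forall_le {f : ℝ → ℝ} {d t : ℝ} (hf : HasDerivAt f d t) {a : ℝ}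
    (hat : a < t) (h : ∀ s ∈ Ioo a t, f s ≤ f t) : 0 ≤ d := by
  have h1 : Tendsto (slope f t) (𝓝[<] t) (𝓝 d) :=
    (hasDerivWithinAt_iff_tendsto_slope' (by simp)).1 (hf.hasDerivWithinAt (s := Iio t))
  refine ge_of_tendsto h1 ?_
  filter_upwards [Ioo_mem_nhdsLT hat] with s hs
  rw [slope_def_field]
  exact div_nonneg_of_nonpos (by linarith [h s hs]) (by linarith [hs.2])

theorem exists_forall_abs_le_of_tendsto_zero {f : ℝ → ℝ} (hf : Continuous f)
    (h : Tendsto f (cocompact ℝ) (𝓝 0)) : ∃ x, ∀ y, |f y| ≤ |f x| := by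
  by_cases h0 : ∀ y, f y = 0
  · exact ⟨0, fun y => by simp [h0]⟩
  · push Not at h0
    obtain ⟨x₀, hx₀⟩ := h0
    refine hf.abs.exists_forall_ge' x₀ ?_
    have := (tendsto_zero_iff_abs_tendsto_zero f).1 h
    filter_upwards [this.eventually (gt_mem_nhds (abs_pos.2 hx₀))] with y hy using hy.le

namespace IsTrafficSolution

variable {γa γb : ℝ} {u₀ : ℝ → ℝ} {S : ℝ} {u : ℝ → ℝ → ℝ}

theorem isH2 (h : IsTrafficSolution γa γb u₀ S u) {t : ℝ} (ht : t ∈ Ico 0 S) : IsH2 (u t) :=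
  ((continuousInH2_iff h.continuous).1 h.memH2).1 t ht

theorem hasDerivWithinAt (h : IsTrafficSolution γa γb u₀ S u) (ha : 0 < γa) (hb : 0 < γb)
    {t : ℝ} (ht : t ∈ Ico 0 S) (x : ℝ) :
    HasDerivWithinAt (fun s => u s x) (-(Real.exp (potential γa γb (u t) x) *
      ((1 - 2 * u t x) * deriv (u t) x + u t x * (1 - u t x) *
        (2 * kap γa γb * u t x + potentialRem γa γb (u t) x)))) (Ici 0) t := by
  obtain ⟨q, hq, hqt⟩ := h.equation t ht x
  rwa [hq.unique (hasDerivAt_trafficFlux ha hb (h.continuous t ht)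
    ((h.isH2 ht).differentiable x).hasDerivAt)] at hqt

end IsTrafficSolution

/-- Solutions with the same initial value coincide. -/
theorem IsTrafficSolution.eq {γa γb : ℝ} (ha : 0 < γa) (hb : 0 < γb) {u₀ : ℝ → ℝ} {S S' : ℝ}
    {u v : ℝ → ℝ → ℝ} (hu : IsTrafficSolution γa γb u₀ S u)
    (hv : IsTrafficSolution γa γb u₀ S' v) {t₁ : ℝ} (h0 : 0 ≤ t₁) (h1 : t₁ < S) (h1' : t₁ < S') :
    u t₁ = v t₁ := by
  have hIu : Icc 0 t₁ ⊆ Ico 0 S := fun t ht => ⟨ht.1, ht.2.trans_lt h1⟩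
  have hIv : Icc 0 t₁ ⊆ Ico 0 S' := fun t ht => ⟨ht.1, ht.2.trans_lt h1'⟩
  obtain ⟨C₁, hC₁, hbu⟩ := hu.memH2.exists_abs_le hu.continuous isCompact_Icc hIu
  obtain ⟨C₂, hC₂, hbv⟩ := hv.memH2.exists_abs_le hv.continuous isCompact_Icc hIv
  set C := max C₁ C₂
  have hCC : 0 ≤ C := le_max_of_le_left hC₁
  have hκ := kap_pos ha hb
  set κ := kap γa γb
  have hbu' : ∀ t ∈ Icc 0 t₁, ∀ x, |u t x| ≤ C ∧ |deriv (u t) x| ≤ C := fun t ht x =>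
    ⟨(hbu t ht x).1.trans (le_max_left _ _), (hbu t ht x).2.trans (le_max_left _ _)⟩
  have hbv' : ∀ t ∈ Icc 0 t₁, ∀ x, |v t x| ≤ C := fun t ht x =>
    (hbv t ht x).1.trans (le_max_right _ _)
  let z : ℝ → ℝ → ℝ := fun t x => u t x - v t x
  have hzc : ∀ t ∈ Icc 0 t₁, Continuous (z t) := fun t ht =>
    (hu.continuous t (hIu ht)).sub (hv.continuous t (hIv ht))
  have hmax : ∀ t, ∃ x, t ∈ Icc 0 t₁ → ∀ y, |z t y| ≤ |z t x| := fun t => by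
    by_cases ht : t ∈ Icc 0 t₁
    · obtain ⟨x, hx⟩ := exists_forall_abs_le_of_tendsto_zero (hzc t ht) (by
        simpa using (hu.isH2 (hIu ht)).tendsto_cocompact.sub (hv.isH2 (hIv ht)).tendsto_cocompact)
      exact ⟨x, fun _ => hx⟩
    · exact ⟨0, fun h => absurd h ht⟩
  choose X hX using hmax
  let m : ℝ → ℝ := fun t => |z t (X t)|
  have hm : ContinuousOn m (Icc 0 t₁) := by
    intro t ht
    rw [ContinuousWithinAt, Metric.tendsto_nhds]
    intro ε hε
    have e1 := (hu.memH2.eventually_abs_sub_le hu.continuous (hIu ht)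
      (by positivity : 0 < ε / 3)).filter_mono (nhdsWithin_mono _ hIu)
    have e2 := (hv.memH2.eventually_abs_sub_le hv.continuous (hIv ht)
      (by positivity : 0 < ε / 3)).filter_mono (nhdsWithin_mono _ hIv)
    filter_upwards [e1, e2, self_mem_nhdsWithin] with s h1 h2 hs
    have key : ∀ x, |z s x - z t x| ≤ 2 * (ε / 3) := fun x => by
      have a1 := abs_le.1 (h1 x).1
      have a2 := abs_le.1 (h2 x).1
      simp only [z]
      exact abs_le.2 ⟨by linarith, by linarith⟩
    have b1 := abs_sub_abs_le_abs_sub (z s (X s)) (z t (X s))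
    have b2 := abs_sub_abs_le_abs_sub (z t (X t)) (z s (X t))
    rw [abs_sub_comm (z t (X t)) (z s (X t))] at b2
    have := key (X s)
    have := key (X t)
    have := hX t ht (X s)
    have := hX s hs (X t)
    rw [Real.dist_eq, abs_lt]
    simp only [m]
    constructor <;> linarith
  let F : ℝ × ℝ × ℝ × ℝ → ℝ := fun p =>
    Real.exp p.1 * ((1 - 2 * p.2.1) * p.2.2.1 + p.2.1 * (1 - p.2.1) * p.2.2.2)
  have hF : ContDiff ℝ 1 F := by
    simp only [F]
    fun_prop
  obtain ⟨K, hK⟩ := hF.exists_lipschitzOnWith_closedBall (max (4 * C) (max C (4 * κ * C)))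
  set L : ℝ := K * (4 + 4 * κ) + 1 with hL
  obtain ⟨t, ht, htmax⟩ := isCompact_Icc.exists_isMaxOn (nonempty_Icc.2 h0)
    (f := fun t => Real.exp (-L * t) * m t) (by fun_prop)
  have hzero : m t = 0 := by
    by_contra hne
    have hpos : 0 < m t := lt_of_le_of_ne (abs_nonneg _) (Ne.symm hne)
    have ht0 : 0 < t := by
      rcases ht.1.eq_or_lt with h | h
      · exfalso
        apply hne
        simp only [m, z, ← h, hu.initial, hv.initial, sub_self, abs_zero]
      · exact h
    set x := X t
    obtain ⟨σ, hσ, hσz⟩ : ∃ σ : ℝ, |σ| = 1 ∧ σ * z t x = m t := by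
      rcases abs_choice (z t x) with h | h
      · exact ⟨1, by simp, by simp only [m]; rw [one_mul]; exact h.symm⟩
      · exact ⟨-1, by simp, by simp only [m]; rw [neg_one_mul]; exact h.symm⟩
    have hσle : ∀ w, σ * w ≤ |w| := fun w => by
      calc _ ≤ |σ * w| := le_abs_self _
        _ = |w| := by rw [abs_mul, hσ, one_mul]
    have hdu := ((hu.isH2 (hIu ht)).differentiable x).hasDerivAt
    have hdv := ((hv.isH2 (hIv ht)).differentiable x).hasDerivAt
    have hdeq : deriv (u t) x = deriv (v t) x := by
      have hloc : IsLocalMax (fun y => σ * (u t y - v t y)) x :=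
        Eventually.of_forall fun y => by
          have h3 : σ * (u t x - v t x) = |z t x| := hσz
          change σ * (u t y - v t y) ≤ σ * (u t x - v t x)
          rw [h3]
          exact (hσle _).trans (hX t ht y)
      have h4 := hloc.hasDerivAt_eq_zero ((hdu.sub hdv).const_mul σ)
      have hσ0 : σ ≠ 0 := fun h => by simp [h] at hσ
      have := (mul_eq_zero.1 h4).resolve_left hσ0
      linarith
    have htu := (hu.hasDerivWithinAt ha hb (hIu ht) x).hasDerivAt (Ici_mem_nhds ht0)
    have htv := (hv.hasDerivWithinAt ha hb (hIv ht) x).hasDerivAt (Ici_mem_nhds ht0)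
    have hest : |F (potential γa γb (u t) x, u t x, deriv (u t) x,
          2 * κ * u t x + potentialRem γa γb (u t) x) -
        F (potential γa γb (v t) x, v t x, deriv (u t) x,
          2 * κ * v t x + potentialRem γa γb (v t) x)| ≤ K * ((4 + 4 * κ) * m t) := by
      have cu := hu.continuous t (hIu ht)
      have cv := hv.continuous t (hIv ht)
      have hmem : ∀ w : ℝ → ℝ, (∀ y, |w y| ≤ C) → ((potential γa γb w x, w x, deriv (u t) x,
          2 * κ * w x + potentialRem γa γb w x) : ℝ × ℝ × ℝ × ℝ) ∈
          Metric.closedBall 0 (max (4 * C) (max C (4 * κ * C))) := by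
        intro w hw
        have hr := abs_potentialRem_le ha hb hw x
        have h5 : |2 * κ * w x + potentialRem γa γb w x| ≤ 4 * κ * C := by
          refine (abs_add_le _ _).trans ?_
          rw [abs_mul, abs_of_pos (by positivity : 0 < 2 * κ)]
          have : 2 * κ * |w x| ≤ 2 * κ * C := by gcongr; exact hw x
          linarith
        rw [mem_closedBall_zero_iff]
        simp only [Prod.norm_def, Real.norm_eq_abs]
        refine max_le (le_max_of_le_left (abs_potential_le ha hb hw x)) (le_max_of_le_right ?_)
        exact max_le (le_max_of_le_left (hw x)) (max_le (le_max_of_le_left (hbu' t ht x).2)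
          (le_max_of_le_right h5))
      have h6 := hK.dist_le_mul _ (hmem (u t) fun y => (hbu' t ht y).1) _ (hmem (v t) (hbv' t ht))
      rw [Real.dist_eq] at h6
      refine h6.trans ?_
      have hz : ∀ y, |u t y - v t y| ≤ m t := hX t ht
      have h7 := abs_potential_sub_le ha hb cu cv hz x
      have h8 := abs_potentialRem_sub_le ha hb cu cv hz x
      have hκm : 0 ≤ κ * m t := by positivity
      gcongr
      simp only [Prod.dist_eq, Real.dist_eq, sub_self, abs_zero]
      refine max_le (by linarith) (max_le (by linarith [hz x]) (max_le (by positivity) ?_))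
      have h9 : 2 * κ * u t x + potentialRem γa γb (u t) x -
          (2 * κ * v t x + potentialRem γa γb (v t) x) = 2 * κ * (u t x - v t x) +
          (potentialRem γa γb (u t) x - potentialRem γa γb (v t) x) := by ring
      rw [h9]
      refine (abs_add_le _ _).trans ?_
      rw [abs_mul, abs_of_pos (by positivity : 0 < 2 * κ)]
      have : 2 * κ * |u t x - v t x| ≤ 2 * κ * m t :=
        mul_le_mul_of_nonneg_left (hz x) (by positivity)
      linarith
    have hexp : HasDerivAt (fun s => Real.exp (-L * s)) (Real.exp (-L * t) * -L) t := by
      simpa using ((hasDerivAt_id t).const_mul (-L)).exp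
    have hder := hexp.mul ((htu.sub htv).const_mul σ)
    have hnn := hder.nonneg_of_forall_le ht0 (fun s hs => by
      have hs' : s ∈ Icc 0 t₁ := ⟨hs.1.le, hs.2.le.trans ht.2⟩
      have h10 : Real.exp (-L * s) * m s ≤ Real.exp (-L * t) * m t := htmax hs'
      have h11 : σ * (u s x - v s x) ≤ m s := (hσle _).trans (hX s hs' x)
      have h12 : σ * (u t x - v t x) = m t := hσz
      simp only [Pi.mul_apply, Pi.sub_apply]
      rw [h12]
      refine le_trans ?_ h10
      gcongr)
    have h12 : σ * (u t x - v t x) = m t := hσz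
    rw [← hdeq] at hnn
    simp only [Pi.sub_apply, h12] at hnn
    set A := Real.exp (potential γa γb (u t) x) * _
    set B := Real.exp (potential γa γb (v t) x) * _
    have hAB : |A - B| ≤ K * ((4 + 4 * κ) * m t) := hest
    have h13 : σ * (-A - -B) ≤ K * ((4 + 4 * κ) * m t) := by
      refine (hσle _).trans ?_
      rwa [show -A - -B = -(A - B) by ring, abs_neg]
    have h14 : Real.exp (-L * t) * -L * m t + Real.exp (-L * t) * (σ * (-A - -B)) =
        Real.exp (-L * t) * (σ * (-A - -B) - L * m t) := by ring
    rw [h14] at hnn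
    have h15 : σ * (-A - -B) - L * m t < 0 := by
      rw [hL]
      linarith
    exact absurd hnn (not_le.2 (mul_neg_of_pos_of_neg (Real.exp_pos _) h15))
  have ht₁ : t₁ ∈ Icc 0 t₁ := ⟨h0, le_rfl⟩
  have hfin : Real.exp (-L * t₁) * m t₁ ≤ Real.exp (-L * t) * m t := htmax ht₁
  rw [hzero, mul_zero] at hfin
  have hm1 : m t₁ ≤ 0 := by
    by_contra h
    exact absurd hfin (not_le.2 (mul_pos (Real.exp_pos _) (not_le.1 h)))
  funext y
  have h16 : |u t₁ y - v t₁ y| ≤ m t₁ := hX t₁ ht₁ y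
  have := abs_nonpos_iff.1 (h16.trans hm1)
  linarith

/-- Picard-Lindelöf on `[0, δ]`, together with the ball in which the solution stays. -/
theorem exists_solution_mem_closedBall {E : Type*} [NormedAddCommGroup E] [NormedSpace ℝ E]
    [CompleteSpace E] {f : ℝ → E → E} {y₀ : E} {δ R L : ℝ} {K : NNReal} (hδ : 0 ≤ δ)
    (hR : 0 ≤ R) (hL : 0 ≤ L) (hδR : L * δ ≤ R)
    (hlip : ∀ t ∈ Icc 0 δ, LipschitzOnWith K (f t) (Metric.closedBall y₀ R))
    (hcont : ∀ x ∈ Metric.closedBall y₀ R, ContinuousOn (f · x) (Icc 0 δ))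
    (hnorm : ∀ t ∈ Icc 0 δ, ∀ x ∈ Metric.closedBall y₀ R, ‖f t x‖ ≤ L) :
    ∃ α : ℝ → E, α 0 = y₀ ∧ ∀ t ∈ Icc 0 δ,
      HasDerivWithinAt α (f t (α t)) (Icc 0 δ) t ∧ α t ∈ Metric.closedBall y₀ R := by
  have h0 : (0 : ℝ) ∈ Icc 0 δ := ⟨le_rfl, hδ⟩
  lift R to NNReal using hR
  lift L to NNReal using hL
  have hf : IsPicardLindelof f (⟨0, h0⟩ : Icc 0 δ) y₀ R 0 L K :=
    ⟨hlip, hcont, hnorm, by simpa [hδ] using hδR⟩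
  have hx : y₀ ∈ Metric.closedBall y₀ ((0 : NNReal) : ℝ) := by simp
  obtain ⟨α, hα⟩ := ODE.FunSpace.exists_isFixedPt_next hf hx
  refine ⟨α.compProj, ?_, fun t ht => ⟨?_, α.compProj_mem_closedBall hf.mul_max_le⟩⟩
  · have := ODE.FunSpace.compProj_val (α := α) (t := ⟨0, h0⟩)
    rw [← hα, ODE.FunSpace.next_apply₀] at this
    rw [← hα]
    exact this
  · refine (ODE.hasDerivWithinAt_picard_Icc h0 hf.continuousOn_uncurry
      α.continuous_compProj.continuousOn (fun _ _ => α.compProj_mem_closedBall hf.mul_max_le)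
      y₀ ht).congr_of_mem (fun s hs => ?_) ht
    nth_rw 1 [← hα]
    rw [ODE.FunSpace.compProj_of_mem hs, ODE.FunSpace.next_apply]

theorem gronwallBound_le {c K ε t : ℝ} (hK : 0 ≤ K) (hε : 0 ≤ ε) :
    gronwallBound c K ε t ≤ (c + ε * t) * Real.exp (K * t) := by
  rcases hK.eq_or_lt with h | h
  · rw [← h, gronwallBound_K0]
    simp
  · rw [gronwallBound_of_K_ne_0 h.ne', add_mul]
    refine add_le_add le_rfl ?_
    have h1 := Real.add_one_le_exp (-(K * t))
    have h2 : Real.exp (K * t) - 1 ≤ K * t * Real.exp (K * t) := by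
      have h3 := mul_le_mul_of_nonneg_right h1 (Real.exp_pos (K * t)).le
      rw [← Real.exp_add, neg_add_cancel, Real.exp_zero] at h3
      linarith
    rw [div_mul_eq_mul_div, div_le_iff₀ h]
    calc _ ≤ ε * (K * t * Real.exp (K * t)) := by gcongr
      _ = _ := by ring

/-- Grönwall's inequality on `[0, δ]`. -/
theorem norm_le_of_norm_deriv_le {E : Type*} [NormedAddCommGroup E] [NormedSpace ℝ E]
    {f f' : ℝ → E} {δ K c ε : ℝ} (hK : 0 ≤ K) (hε : 0 ≤ ε)
    (hf : ∀ t ∈ Icc 0 δ, HasDerivWithinAt f (f' t) (Icc 0 δ) t) (h0 : ‖f 0‖ ≤ c)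
    (hb : ∀ t ∈ Icc 0 δ, ‖f' t‖ ≤ K * ‖f t‖ + ε) {t : ℝ} (ht : t ∈ Icc 0 δ) :
    ‖f t‖ ≤ (c + ε * t) * Real.exp (K * t) := by
  have h := norm_le_gronwallBound_of_norm_deriv_right_le (f' := f')
    (fun t ht => (hf t ht).continuousWithinAt)
    (fun s hs => (hf s (Ico_subset_Icc_self hs)).mono_of_mem_nhdsWithin
      (Icc_mem_nhdsGE_of_mem hs)) h0 (fun s hs => hb s (Ico_subset_Icc_self hs)) t ht
  rw [sub_zero] at h
  exact h.trans (gronwallBound_le hK hε)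

theorem exists_linear_solution {E : Type*} [NormedAddCommGroup E] [NormedSpace ℝ E]
    [CompleteSpace E] {A : ℝ → E →L[ℝ] E} {δ K : ℝ} (hδ : 0 ≤ δ) (hK : 0 ≤ K)
    (hδK : 2 * K * δ ≤ 1) (hA : ContinuousOn A (Icc 0 δ)) (hb : ∀ t ∈ Icc 0 δ, ‖A t‖ ≤ K)
    (z₀ : E) : ∃ z : ℝ → E, z 0 = z₀ ∧
      ∀ t ∈ Icc 0 δ, HasDerivWithinAt z (A t (z t)) (Icc 0 δ) t := by
  have hmem : ∀ x ∈ Metric.closedBall z₀ (‖z₀‖ + 1), ‖x‖ ≤ 2 * ‖z₀‖ + 1 := fun x hx => by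
    rw [mem_closedBall_iff_norm] at hx
    have := norm_le_norm_add_norm_sub' x z₀
    linarith
  obtain ⟨z, h0, hz⟩ := exists_solution_mem_closedBall (f := fun t x => A t x) (y₀ := z₀)
    (δ := δ) (R := ‖z₀‖ + 1) (L := K * (2 * ‖z₀‖ + 1)) (K := ⟨K, hK⟩) hδ (by positivity)
    (by positivity) (by nlinarith [norm_nonneg z₀])
    (fun t ht => ((A t).lipschitz.weaken (hb t ht)).lipschitzOnWith)
    (fun x _ => hA.clm_apply continuousOn_const)
    (fun t ht x hx => ((A t).le_opNorm x).trans
      (mul_le_mul (hb t ht) (hmem x hx) (norm_nonneg _) hK))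
  exact ⟨z, h0, fun t ht => (hz t ht).1⟩

/-- Differentiable dependence on a real parameter of the solutions of an ordinary differential
equation: the derivative is the solution of the linearized equation. -/
theorem hasDerivAt_parameter {E : Type*} [NormedAddCommGroup E] [NormedSpace ℝ E]
    {G : ℝ → E → E} {G' : ℝ → E → E →L[ℝ] E} {δ L : ℝ} (hδ : 0 ≤ δ)
    (hG : ∀ t y, HasFDerivAt (G t) (G' t y) y) (hG' : Continuous (Function.uncurry G'))
    {y : ℝ → ℝ → E} {ξ : ℝ} (hL : 0 ≤ L)
    (hy : ∀ η, ∀ t ∈ Icc 0 δ, HasDerivWithinAt (fun s => y s η) (G t (y t η)) (Icc 0 δ) t)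
    (hlip : ∀ t ∈ Icc 0 δ, ∀ η, ‖y t η - y t ξ‖ ≤ L * |η - ξ|)
    {z : ℝ → E} (hz : ∀ t ∈ Icc 0 δ, HasDerivWithinAt z (G' t (y t ξ) (z t)) (Icc 0 δ) t)
    (hz0 : HasDerivAt (y 0) (z 0) ξ) {t : ℝ} (ht : t ∈ Icc 0 δ) :
    HasDerivAt (y t) (z t) ξ := by
  have hpath : ContinuousOn (fun s => (s, y s ξ)) (Icc 0 δ) :=
    continuousOn_id.prodMk fun s hs => (hy ξ s hs).continuousWithinAt
  have hP : IsCompact ((fun s => (s, y s ξ)) '' Icc 0 δ) :=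
    isCompact_Icc.image_of_continuousOn hpath
  obtain ⟨K, hKb⟩ := hP.exists_bound_of_continuousOn hG'.continuousOn
  have hK : 0 ≤ K := (norm_nonneg _).trans (hKb (0, y 0 ξ) ⟨0, ⟨le_rfl, hδ⟩, rfl⟩)
  rw [hasDerivAt_iff_isLittleO, Asymptotics.isLittleO_iff]
  intro c hc
  set D : ℝ := (1 + L * δ) * Real.exp (K * δ)
  have hD : 0 < D := by positivity
  set ε := c / D
  have hε : 0 < ε := by positivity
  obtain ⟨ρ, hρ, hρP⟩ : ∃ ρ > 0, ∀ s ∈ Icc 0 δ, ∀ x, dist x (y s ξ) < ρ →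
      ‖G' s x - G' s (y s ξ)‖ ≤ ε := by
    have h1 := hP.uniformContinuousAt_of_continuousAt (Function.uncurry G')
      (fun a _ => hG'.continuousAt) (Metric.dist_mem_uniformity hε)
    obtain ⟨ρ, hρ, h2⟩ := Metric.mem_uniformity_dist.1 h1
    refine ⟨ρ, hρ, fun s hs x hx => ?_⟩
    have h3 := @h2 (s, y s ξ) (s, x) (by
      rw [Prod.dist_eq]
      simpa [dist_comm, hρ] using hx) ⟨s, hs, rfl⟩
    have h4 : dist (G' s (y s ξ)) (G' s x) < ε := h3
    rw [← dist_eq_norm, dist_comm]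
    exact h4.le
  have hinit := (Asymptotics.isLittleO_iff.1 (hasDerivAt_iff_isLittleO.1 hz0)) hε
  have hnear : ∀ᶠ η in 𝓝 ξ, L * |η - ξ| < ρ := by
    have h5 : Tendsto (fun η : ℝ => L * |η - ξ|) (𝓝 ξ) (𝓝 (L * |ξ - ξ|)) := by
      apply Continuous.tendsto
      fun_prop
    rw [sub_self, abs_zero, mul_zero] at h5
    exact h5.eventually (gt_mem_nhds hρ)
  filter_upwards [hinit, hnear] with η h0 hη
  have key := norm_le_of_norm_deriv_le (f := fun s => y s η - y s ξ - (η - ξ) • z s)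
    (f' := fun s => G s (y s η) - G s (y s ξ) - (η - ξ) • G' s (y s ξ) (z s)) (δ := δ)
    (K := K) (ε := ε * (L * |η - ξ|)) hK (by positivity)
    (fun s hs => ((hy η s hs).sub (hy ξ s hs)).sub ((hz s hs).const_smul _)) h0
    (fun s hs => by
      have e : G s (y s η) - G s (y s ξ) - (η - ξ) • G' s (y s ξ) (z s) =
          (G s (y s η) - G s (y s ξ) - G' s (y s ξ) (y s η - y s ξ)) +
          G' s (y s ξ) (y s η - y s ξ - (η - ξ) • z s) := by
        simp only [map_sub, map_smul]
        abel
      rw [e, add_comm]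
      refine (norm_add_le _ _).trans (add_le_add ?_ ?_)
      · exact (ContinuousLinearMap.le_opNorm _ _).trans
          (mul_le_mul_of_nonneg_right (hKb (s, y s ξ) ⟨s, hs, rfl⟩) (norm_nonneg _))
      · have hball : y s η ∈ Metric.ball (y s ξ) ρ := by
          rw [mem_ball_iff_norm]
          exact (hlip s hs η).trans_lt hη
        refine ((convex_ball (y s ξ) ρ).norm_image_sub_le_of_norm_hasFDerivWithin_le'
          (fun x _ => (hG s x).hasFDerivWithinAt) (fun x hx => hρP s hs x hx)
          (Metric.mem_ball_self hρ) hball).trans ?_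
        exact mul_le_mul_of_nonneg_left (hlip s hs η) hε.le) ht
  refine key.trans ?_
  rw [Real.norm_eq_abs]
  calc (ε * |η - ξ| + ε * (L * |η - ξ|) * t) * Real.exp (K * t)
      ≤ (ε * |η - ξ| + ε * (L * |η - ξ|) * δ) * Real.exp (K * δ) := by
        gcongr
        · exact ht.2
        · exact ht.2
    _ = ε * D * |η - ξ| := by
        simp only [D]
        ring
    _ = c * |η - ξ| := by
        rw [div_mul_cancel₀ _ hD.ne']

/-- The characteristic speed and the rate of change of the density along a characteristic, as a
function of the potential, the nonlocal part of its slope, and the density. -/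
noncomputable def charRate (κ : ℝ) (p : ℝ × ℝ × ℝ) : ℝ × ℝ :=
  ((1 - 2 * p.2.2) * Real.exp p.1,
    -(Real.exp p.1 * (p.2.2 * (1 - p.2.2) * (2 * κ * p.2.2 + p.2.1))))

/-- The characteristic vector field belonging to the density profile `w` in the nonlocal terms. -/
noncomputable def charField (γa γb : ℝ) (w : ℝ → ℝ) (y : ℝ × ℝ) : ℝ × ℝ :=
  charRate (kap γa γb) (potential γa γb w y.1, potentialRem γa γb w y.1, y.2)

theorem contDiff_charRate (κ : ℝ) : ContDiff ℝ 1 (charRate κ) := by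
  unfold charRate
  fun_prop

theorem abs_slope_le {γa γb : ℝ} (ha : 0 < γa) (hb : 0 < γb) {w : ℝ → ℝ}
    (h : ∀ x, 0 ≤ w x ∧ w x ≤ 1) (x : ℝ) :
    |2 * kap γa γb * w x + potentialRem γa γb w x| ≤ 2 * kap γa γb := by
  have h1 := neg_le_potentialRem ha hb h x
  have h2 := potentialRem_nonpos ha hb (fun x => (h x).1) x
  have hκ := kap_pos ha hb
  have h3 : 0 ≤ 2 * kap γa γb * w x := mul_nonneg (by positivity) (h x).1
  have h4 : 2 * kap γa γb * w x ≤ 2 * kap γa γb := mul_le_of_le_one_right (by positivity) (h x).2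
  exact abs_le.2 ⟨by linarith, by linarith⟩

theorem abs_sub_le_of_hasDerivAt {f f' : ℝ → ℝ} {C : ℝ} (hf : ∀ x, HasDerivAt f (f' x) x)
    (hC : ∀ x, |f' x| ≤ C) (x y : ℝ) : |f x - f y| ≤ C * |x - y| :=
  convex_univ.norm_image_sub_le_of_norm_hasDerivWithin_le
    (fun z _ => (hf z).hasDerivWithinAt) (fun z _ => hC z) (mem_univ y) (mem_univ x)

theorem abs_potentialCurv_le {γa γb : ℝ} {w : ℝ → ℝ}
    (h : ∀ x, 0 ≤ w x ∧ w x ≤ 1) (x : ℝ) :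
    |potentialCurv γa γb w x| ≤ 2 / γa ^ 2 + 2 / γb ^ 2 := by
  unfold potentialCurv
  have h1 : |w (x + γa) - w x| ≤ 1 := abs_le.2 ⟨by linarith [(h (x + γa)).1, (h x).2],
    by linarith [(h (x + γa)).2, (h x).1]⟩
  have h2 : |w x - w (x - γb)| ≤ 1 := abs_le.2 ⟨by linarith [(h (x - γb)).2, (h x).1],
    by linarith [(h (x - γb)).1, (h x).2]⟩
  refine (abs_sub _ _).trans ?_
  rw [abs_mul, abs_mul, abs_neg, abs_of_nonneg (by positivity : 0 ≤ 2 / γa ^ 2),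
    abs_of_nonneg (by positivity : 0 ≤ 2 / γb ^ 2)]
  exact add_le_add (mul_le_of_le_one_right (by positivity) h1)
    (mul_le_of_le_one_right (by positivity) h2)

/-- Uniform bounds for the characteristic vector fields. -/
structure CharBounds (γa γb M : ℝ) (K : NNReal) : Prop where
  nonneg : 0 ≤ M
  norm_le : ∀ w : ℝ → ℝ, Continuous w → (∀ x, 0 ≤ w x ∧ w x ≤ 1) →
    ∀ y : ℝ × ℝ, |y.2| ≤ 2 → ‖charField γa γb w y‖ ≤ M
  lipschitz : ∀ w : ℝ → ℝ, Continuous w → (∀ x, 0 ≤ w x ∧ w x ≤ 1) →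
    LipschitzOnWith K (charField γa γb w) {y | |y.2| ≤ 2}
  stable : ∀ w : ℝ → ℝ, Continuous w → (∀ x, 0 ≤ w x ∧ w x ≤ 1) →
    ∀ w' : ℝ → ℝ, Continuous w' → (∀ x, 0 ≤ w' x ∧ w' x ≤ 1) → ∀ ε, (∀ x, |w x - w' x| ≤ ε) →
      ∀ y : ℝ × ℝ, |y.2| ≤ 2 → ‖charField γa γb w y - charField γa γb w' y‖ ≤ K * ε

theorem exists_charBounds {γa γb : ℝ} (ha : 0 < γa) (hb : 0 < γb) :
    ∃ (M : ℝ) (K : NNReal), CharBounds γa γb M K := by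
  have hκ := kap_pos ha hb
  set κ := kap γa γb with hκdef
  set R : ℝ := max 4 (2 * κ) with hR
  have hR4 : 4 ≤ R := le_max_left _ _
  have hRκ : 2 * κ ≤ R := le_max_right _ _
  obtain ⟨K₀, hK₀⟩ := (contDiff_charRate κ).exists_lipschitzOnWith_closedBall R
  obtain ⟨M, hM⟩ := (isCompact_closedBall (0 : ℝ × ℝ × ℝ) R).exists_bound_of_continuousOn
    (contDiff_charRate κ).continuous.continuousOn
  have hmem : ∀ w : ℝ → ℝ, (∀ x, 0 ≤ w x ∧ w x ≤ 1) → ∀ y : ℝ × ℝ, |y.2| ≤ 2 →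
      ((potential γa γb w y.1, potentialRem γa γb w y.1, y.2) : ℝ × ℝ × ℝ) ∈
        Metric.closedBall 0 R := by
    intro w hw y hy
    have h1 : ∀ x, |w x| ≤ 1 := fun x => abs_le.2 ⟨by linarith [(hw x).1], (hw x).2⟩
    have h2 := abs_potential_le ha hb h1 y.1
    have h3 := abs_potentialRem_le ha hb h1 y.1
    rw [mem_closedBall_zero_iff]
    simp only [Prod.norm_def, Real.norm_eq_abs]
    exact max_le (by linarith) (max_le (by linarith) (by linarith))
  set c₁ : ℝ := 2 * κ + (2 / γa ^ 2 + 2 / γb ^ 2) + 1 with hc₁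
  set c₂ : ℝ := 4 + 2 * κ with hc₂
  have hc₁0 : 0 ≤ c₁ := by positivity
  have hc₂0 : 0 ≤ c₂ := by positivity
  refine ⟨max M 0, K₀ * (⟨c₁, hc₁0⟩ + ⟨c₂, hc₂0⟩), le_max_right _ _, fun w hwc hw y hy =>
    (hM _ (hmem w hw y hy)).trans (le_max_left _ _), fun w hwc hw => ?_, ?_⟩
  · refine LipschitzOnWith.of_dist_le_mul fun y hy y' hy' => ?_
    refine (hK₀.dist_le_mul _ (hmem w hw y hy) _ (hmem w hw y' hy')).trans ?_
    rw [NNReal.coe_mul, mul_assoc]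
    refine mul_le_mul_of_nonneg_left ?_ K₀.2
    have e1 : |y.1 - y'.1| ≤ dist y y' := by
      rw [Prod.dist_eq]
      exact le_max_left _ _
    have e2 : dist y.2 y'.2 ≤ dist y y' := by
      rw [Prod.dist_eq]
      exact le_max_right _ _
    have e3 := abs_sub_le_of_hasDerivAt (hasDerivAt_potential ha hb hwc)
      (abs_slope_le ha hb hw) y.1 y'.1
    have e4 := abs_sub_le_of_hasDerivAt (hasDerivAt_potentialRem (γa := γa) (γb := γb) hwc)
      (abs_potentialCurv_le hw) y.1 y'.1
    have hd : 0 ≤ dist y y' := dist_nonneg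
    have hc : 0 ≤ 2 / γa ^ 2 + 2 / γb ^ 2 := by positivity
    have e5 : c₁ * dist y y' ≤ (c₁ + c₂) * dist y y' := by gcongr; linarith
    refine le_trans ?_ e5
    have e6 : 2 * κ * |y.1 - y'.1| ≤ 2 * κ * dist y y' := by gcongr
    have e7 : (2 / γa ^ 2 + 2 / γb ^ 2) * |y.1 - y'.1| ≤
        (2 / γa ^ 2 + 2 / γb ^ 2) * dist y y' := by gcongr
    have e8 : 0 ≤ 2 * κ * dist y y' := by positivity
    have e9 : 0 ≤ (2 / γa ^ 2 + 2 / γb ^ 2) * dist y y' := by positivity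
    have e10 : c₁ * dist y y' = 2 * κ * dist y y' + (2 / γa ^ 2 + 2 / γb ^ 2) * dist y y' +
      dist y y' := by rw [hc₁]; ring
    rw [e10]
    clear e5 e10
    generalize dist y y' = d at *
    simp only [Prod.dist_eq, Real.dist_eq] at e2 ⊢
    exact max_le (by linarith) (max_le (by linarith) (by linarith))
  · intro w hwc hw w' hwc' hw' ε hε y hy
    have hε0 : 0 ≤ ε := (abs_nonneg _).trans (hε 0)
    rw [← dist_eq_norm]
    refine (hK₀.dist_le_mul _ (hmem w hw y hy) _ (hmem w' hw' y hy)).trans ?_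
    rw [NNReal.coe_mul, mul_assoc]
    refine mul_le_mul_of_nonneg_left ?_ K₀.2
    have e3 := abs_potential_sub_le ha hb hwc hwc' hε y.1
    have e4 := abs_potentialRem_sub_le ha hb hwc hwc' hε y.1
    have e5 : c₂ * ε ≤ (c₁ + c₂) * ε := by gcongr; linarith
    refine le_trans ?_ e5
    have e8 : 0 ≤ 2 * κ * ε := by positivity
    have e10 : c₂ * ε = 4 * ε + 2 * κ * ε := by rw [hc₂]; ring
    rw [e10]
    simp only [Prod.dist_eq, Real.dist_eq, sub_self, abs_zero]
    exact max_le (by linarith) (max_le (by linarith) (by linarith))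

theorem nonneg_of_deriv_eq_mul {f c : ℝ → ℝ} {δ K : ℝ}
    (hf : ∀ t ∈ Icc 0 δ, HasDerivWithinAt f (c t * f t) (Icc 0 δ) t)
    (hc : ∀ t ∈ Icc 0 δ, |c t| ≤ K) (h0 : 0 ≤ f 0) {t : ℝ} (ht : t ∈ Icc 0 δ) : 0 ≤ f t := by
  have key : ∀ ε > 0, -f t ≤ ε * Real.exp ((K + 1) * t) := by
    intro ε hε
    have hB : ∀ s, HasDerivAt (fun s => ε * Real.exp ((K + 1) * s))
        (ε * (Real.exp ((K + 1) * s) * (K + 1))) s := fun s => by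
      simpa using (((hasDerivAt_id s).const_mul (K + 1)).exp).const_mul ε
    refine image_le_of_deriv_right_lt_deriv_boundary (f := fun s => -f s)
      (f' := fun s => -(c s * f s)) (a := 0) (b := δ)
      (fun s hs => (hf s hs).continuousWithinAt.neg)
      (fun s hs => ((hf s (Ico_subset_Icc_self hs)).mono_of_mem_nhdsWithin
        (Icc_mem_nhdsGE_of_mem hs)).neg) ?_ hB ?_ ht
    · simpa using by linarith
    · intro s hs hfs
      have hpos : 0 < ε * Real.exp ((K + 1) * s) := by positivity
      have h1 := (abs_le.1 (hc s (Ico_subset_Icc_self hs))).2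
      have h2 : -(c s * f s) = c s * (ε * Real.exp ((K + 1) * s)) := by rw [← hfs]; ring
      rw [h2]
      nlinarith
  have hlim : Tendsto (fun ε : ℝ => ε * Real.exp ((K + 1) * t)) (𝓝[>] 0) (𝓝 0) := by
    have : Tendsto (fun ε : ℝ => ε * Real.exp ((K + 1) * t)) (𝓝 0)
        (𝓝 (0 * Real.exp ((K + 1) * t))) := (continuous_id.mul continuous_const).tendsto 0
    rw [zero_mul] at this
    exact this.mono_left nhdsWithin_le_nhds
  have := ge_of_tendsto hlim (by filter_upwards [self_mem_nhdsWithin] with ε hε using key ε hε)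
  linarith

/-- Admissible density histories in the nonlocal terms. -/
structure IsDensity (a : ℝ → ℝ → ℝ) : Prop where
  continuous : Continuous (Function.uncurry a)
  mem : ∀ t x, 0 ≤ a t x ∧ a t x ≤ 1

theorem IsDensity.continuous_apply {a : ℝ → ℝ → ℝ} (h : IsDensity a) (t : ℝ) :
    Continuous (a t) :=
  h.continuous.comp (by fun_prop : Continuous fun y : ℝ => (t, y))

/-- `y t ξ` is the pair (position, density) at time `t` on the characteristic that starts at `ξ`
with density `u₀ ξ`; the nonlocal terms are those of `a`. -/
structure IsCharFlow (γa γb δ : ℝ) (u₀ : ℝ → ℝ) (a : ℝ → ℝ → ℝ) (y : ℝ → ℝ → ℝ × ℝ) :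
    Prop where
  initial : ∀ ξ, y 0 ξ = (ξ, u₀ ξ)
  deriv : ∀ ξ, ∀ t ∈ Icc 0 δ,
    HasDerivWithinAt (fun s => y s ξ) (charField γa γb (a t) (y t ξ)) (Icc 0 δ) t
  mem : ∀ ξ, ∀ t ∈ Icc 0 δ, 0 ≤ (y t ξ).2 ∧ (y t ξ).2 ≤ 1

theorem HasDerivWithinAt.fst {f : ℝ → ℝ × ℝ} {f' : ℝ × ℝ} {s : Set ℝ} {t : ℝ}
    (h : HasDerivWithinAt f f' s t) : HasDerivWithinAt (fun t => (f t).1) f'.1 s t :=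
  (ContinuousLinearMap.fst ℝ ℝ ℝ).hasFDerivAt.comp_hasDerivWithinAt t h

theorem HasDerivWithinAt.snd {f : ℝ → ℝ × ℝ} {f' : ℝ × ℝ} {s : Set ℝ} {t : ℝ}
    (h : HasDerivWithinAt f f' s t) : HasDerivWithinAt (fun t => (f t).2) f'.2 s t :=
  (ContinuousLinearMap.snd ℝ ℝ ℝ).hasFDerivAt.comp_hasDerivWithinAt t h

theorem continuous_charField {γa γb : ℝ} {a : ℝ → ℝ → ℝ} (h : IsDensity a) :
    Continuous fun p : ℝ × (ℝ × ℝ) => charField γa γb (a p.1) p.2 := by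
  have c1 := (continuous_potential (γa := γa) (γb := γb) h.continuous).comp
    (by fun_prop : Continuous fun p : ℝ × (ℝ × ℝ) => (p.1, p.2.1))
  have c2 := (continuous_potentialRem (γa := γa) (γb := γb) h.continuous).comp
    (by fun_prop : Continuous fun p : ℝ × (ℝ × ℝ) => (p.1, p.2.1))
  simp only [Function.comp_def] at c1 c2
  exact (contDiff_charRate _).continuous.comp (c1.prodMk (c2.prodMk (by fun_prop)))

theorem exists_charFlow {γa γb : ℝ} (ha : 0 < γa) (hb : 0 < γb) {M δ : ℝ} {K : NNReal}
    (B : CharBounds γa γb M K) (hδ : 0 ≤ δ) (hδM : M * δ ≤ 1)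
    {u₀ : ℝ → ℝ} (hu₀ : ∀ x, 0 ≤ u₀ x ∧ u₀ x ≤ 1) {a : ℝ → ℝ → ℝ} (hac : IsDensity a) :
    ∃ y, IsCharFlow γa γb δ u₀ a y := by
  have hslab : ∀ ξ, Metric.closedBall ((ξ, u₀ ξ) : ℝ × ℝ) 1 ⊆ {y | |y.2| ≤ 2} := by
    intro ξ y hy
    have h1 : dist y.2 (u₀ ξ) ≤ 1 := by
      rw [Metric.mem_closedBall, Prod.dist_eq] at hy
      exact (le_max_right _ _).trans hy
    have h2 := abs_le.1 (Real.dist_eq _ _ ▸ h1)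
    change |y.2| ≤ 2
    exact abs_le.2 ⟨by linarith [(hu₀ ξ).1], by linarith [(hu₀ ξ).2]⟩
  have hex : ∀ ξ, ∃ α : ℝ → ℝ × ℝ, α 0 = (ξ, u₀ ξ) ∧ ∀ t ∈ Icc 0 δ,
      HasDerivWithinAt α (charField γa γb (a t) (α t)) (Icc 0 δ) t ∧
      α t ∈ Metric.closedBall (ξ, u₀ ξ) 1 := fun ξ =>
    exists_solution_mem_closedBall (f := fun t y => charField γa γb (a t) y) hδ zero_le_one
      B.nonneg hδM (fun t _ => (B.lipschitz _ (hac.continuous_apply t) (hac.mem t)).mono (hslab ξ))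
      (fun x _ => ((continuous_charField hac).comp
        (by fun_prop : Continuous fun t : ℝ => (t, x))).continuousOn)
      (fun t _ x hx => B.norm_le _ (hac.continuous_apply t) (hac.mem t) x (hslab ξ hx))
  choose α hα0 hα using hex
  refine ⟨fun t ξ => α ξ t, hα0, fun ξ t ht => (hα ξ t ht).1, fun ξ t ht => ?_⟩
  have hκ := kap_pos ha hb
  have hv : ∀ s ∈ Icc 0 δ, |(α ξ s).2| ≤ 2 := fun s hs => hslab ξ (hα ξ s hs).2
  have hE : ∀ s x, |Real.exp (potential γa γb (a s) x)| ≤ Real.exp 4 := fun s x => by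
    rw [abs_of_pos (Real.exp_pos _), Real.exp_le_exp]
    have := (abs_le.1 (abs_potential_le ha hb (w := a s) (ε := 1)
      (fun x => abs_le.2 ⟨by linarith [(hac.mem s x).1], (hac.mem s x).2⟩) x)).2
    linarith
  have hm : ∀ s ∈ Icc 0 δ, |2 * kap γa γb * (α ξ s).2 + potentialRem γa γb (a s) (α ξ s).1| ≤
      6 * kap γa γb := fun s hs => by
    have h1 := neg_le_potentialRem ha hb (hac.mem s) (α ξ s).1
    have h2 := potentialRem_nonpos ha hb (fun x => (hac.mem s x).1) (α ξ s).1
    have h3 := abs_le.1 (hv s hs)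
    exact abs_le.2 ⟨by nlinarith, by nlinarith⟩
  have h1v : ∀ s ∈ Icc 0 δ, |1 - (α ξ s).2| ≤ 3 := fun s hs => by
    have h3 := abs_le.1 (hv s hs)
    exact abs_le.2 ⟨by linarith, by linarith⟩
  have hd : ∀ s ∈ Icc 0 δ, HasDerivWithinAt (fun s => (α ξ s).2)
      (-(Real.exp (potential γa γb (a s) (α ξ s).1) * ((α ξ s).2 * (1 - (α ξ s).2) *
        (2 * kap γa γb * (α ξ s).2 + potentialRem γa γb (a s) (α ξ s).1)))) (Icc 0 δ) s :=
    fun s hs => (hα ξ s hs).1.snd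
  constructor
  · refine nonneg_of_deriv_eq_mul (f := fun s => (α ξ s).2)
      (c := fun s => -(Real.exp (potential γa γb (a s) (α ξ s).1) * ((1 - (α ξ s).2) *
        (2 * kap γa γb * (α ξ s).2 + potentialRem γa γb (a s) (α ξ s).1))))
      (K := Real.exp 4 * (3 * (6 * kap γa γb)))
      (fun s hs => (hd s hs).congr_deriv (by ring)) (fun s hs => ?_)
      (by rw [hα0]; exact (hu₀ ξ).1) ht
    rw [abs_neg, abs_mul, abs_mul]
    exact mul_le_mul (hE _ _) (mul_le_mul (h1v s hs) (hm s hs) (abs_nonneg _) (by norm_num))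
      (by positivity) (by positivity)
  · have := nonneg_of_deriv_eq_mul (f := fun s => 1 - (α ξ s).2)
      (c := fun s => Real.exp (potential γa γb (a s) (α ξ s).1) * ((α ξ s).2 *
        (2 * kap γa γb * (α ξ s).2 + potentialRem γa γb (a s) (α ξ s).1)))
      (K := Real.exp 4 * (2 * (6 * kap γa γb)))
      (fun s hs => ((hd s hs).const_sub 1).congr_deriv (by ring)) (fun s hs => by
        rw [abs_mul, abs_mul]
        exact mul_le_mul (hE _ _) (mul_le_mul (hv s hs) (hm s hs) (abs_nonneg _) (by norm_num))
          (by positivity) (by positivity))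
      (by rw [hα0]; linarith [(hu₀ ξ).2]) ht
    linarith

/-- Maps of the real line whose difference from the identity is `1/2`-Lipschitz. -/
def NearId (X : ℝ → ℝ) : Prop := ∀ ξ η, |X ξ - X η - (ξ - η)| ≤ 1 / 2 * |ξ - η|

namespace NearId

variable {X : ℝ → ℝ}

theorem abs_sub_le (h : NearId X) (ξ η : ℝ) : |X ξ - X η| ≤ 3 / 2 * |ξ - η| := by
  have h1 := h ξ η
  have h2 := abs_sub_abs_le_abs_sub (X ξ - X η) (ξ - η)
  linarith

theorem le_abs_sub (h : NearId X) (ξ η : ℝ) : |ξ - η| ≤ 2 * |X ξ - X η| := by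
  have h1 := h ξ η
  have h2 := abs_sub_abs_le_abs_sub (ξ - η) (X ξ - X η)
  rw [abs_sub_comm] at h1
  linarith

theorem half_le_sub (h : NearId X) {ξ η : ℝ} (hξ : η ≤ ξ) : 1 / 2 * (ξ - η) ≤ X ξ - X η := by
  have h1 := h ξ η
  rw [abs_of_nonneg (sub_nonneg.2 hξ)] at h1
  linarith [(abs_le.1 h1).1]

theorem strictMono (h : NearId X) : StrictMono X := fun η ξ hξ => by
  have := h.half_le_sub hξ.le
  linarith

theorem continuous (h : NearId X) : Continuous X :=
  (LipschitzWith.of_dist_le_mul (K := 3 / 2) fun x y => by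
    simpa [Real.dist_eq] using h.abs_sub_le x y).continuous

theorem surjective (h : NearId X) : Function.Surjective X := by
  refine h.continuous.surjective ?_ ?_
  · refine tendsto_atTop_mono' atTop (f₁ := fun ξ => X 0 + 1 / 2 * ξ) ?_ ?_
    · filter_upwards [eventually_ge_atTop 0] with ξ hξ
      have := h.half_le_sub hξ
      linarith
    · exact tendsto_atTop_add_const_left _ _ (tendsto_id.const_mul_atTop (by norm_num))
  · refine tendsto_atBot_mono' atBot (f₂ := X) (f₁ := fun ξ => X 0 + 1 / 2 * ξ) ?_ ?_
    · filter_upwards [eventually_le_atBot 0] with ξ hξ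
      have := h.half_le_sub hξ
      linarith
    · exact tendsto_atBot_add_const_left _ _ (tendsto_id.const_mul_atBot (by norm_num))

theorem apply_invFun (h : NearId X) (x : ℝ) : X (Function.invFun X x) = x :=
  Function.rightInverse_invFun h.surjective x

theorem invFun_apply (h : NearId X) (ξ : ℝ) : Function.invFun X (X ξ) = ξ :=
  Function.leftInverse_invFun h.strictMono.injective ξ

theorem abs_invFun_sub_le (h : NearId X) (x y : ℝ) :
    |Function.invFun X x - Function.invFun X y| ≤ 2 * |x - y| := by
  have := h.le_abs_sub (Function.invFun X x) (Function.invFun X y)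
  rwa [h.apply_invFun, h.apply_invFun] at this

theorem monotone_invFun (h : NearId X) : Monotone (Function.invFun X) := fun x y hxy => by
  rw [← h.strictMono.le_iff_le, h.apply_invFun, h.apply_invFun]
  exact hxy

theorem hasDerivAt_invFun (h : NearId X) {x p : ℝ} (hp : HasDerivAt X p (Function.invFun X x))
    (hp0 : p ≠ 0) : HasDerivAt (Function.invFun X) p⁻¹ x :=
  hp.of_local_left_inverse
    ((LipschitzWith.of_dist_le_mul (K := 2) fun x y => by
      simpa [Real.dist_eq] using h.abs_invFun_sub_le x y).continuous.continuousAt) hp0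
    (Eventually.of_forall h.apply_invFun)

end NearId

namespace IsCharFlow

variable {γa γb δ M L : ℝ} {K : NNReal} {u₀ : ℝ → ℝ} {a : ℝ → ℝ → ℝ} {y : ℝ → ℝ → ℝ × ℝ}

theorem abs_snd_le (h : IsCharFlow γa γb δ u₀ a y) (ξ : ℝ) {t : ℝ} (ht : t ∈ Icc 0 δ) :
    |(y t ξ).2| ≤ 2 :=
  abs_le.2 ⟨by linarith [(h.mem ξ t ht).1], by linarith [(h.mem ξ t ht).2]⟩

theorem norm_sub_le (h : IsCharFlow γa γb δ u₀ a y) (B : CharBounds γa γb M K)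
    (hac : IsDensity a) (hδ1 : δ ≤ 1) (hL0 : 0 ≤ L) (hL : ∀ x x', |u₀ x - u₀ x'| ≤ L * |x - x'|)
    {t : ℝ} (ht : t ∈ Icc 0 δ) (ξ η : ℝ) :
    ‖y t ξ - y t η‖ ≤ (1 + L) * Real.exp K * |ξ - η| := by
  have key := norm_le_of_norm_deriv_le (f := fun s => y s ξ - y s η)
    (f' := fun s => charField γa γb (a s) (y s ξ) - charField γa γb (a s) (y s η)) (δ := δ)
    (K := K) (c := (1 + L) * |ξ - η|) (ε := 0) K.2 le_rfl
    (fun s hs => (h.deriv ξ s hs).sub (h.deriv η s hs)) (by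
      simp only [h.initial, Prod.norm_def, Prod.fst_sub, Prod.snd_sub, Real.norm_eq_abs]
      have h1 := hL ξ η
      have h2 := abs_nonneg (ξ - η)
      exact max_le (by nlinarith) (by linarith)) (fun s hs => by
      rw [add_zero]
      simpa [dist_eq_norm] using (B.lipschitz _ (hac.continuous_apply s) (hac.mem s)).dist_le_mul _
        (h.abs_snd_le ξ hs) _ (h.abs_snd_le η hs)) ht
  refine key.trans ?_
  have : Real.exp (K * t) ≤ Real.exp K := Real.exp_le_exp.2
    (mul_le_of_le_one_right K.2 (ht.2.trans hδ1))
  calc ((1 + L) * |ξ - η| + 0 * t) * Real.exp (K * t)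
      ≤ ((1 + L) * |ξ - η|) * Real.exp K := by rw [zero_mul, add_zero]; gcongr
    _ = _ := by ring

theorem nearId (h : IsCharFlow γa γb δ u₀ a y) (B : CharBounds γa γb M K)
    (hac : IsDensity a) (hδ1 : δ ≤ 1) (hL0 : 0 ≤ L) (hL : ∀ x x', |u₀ x - u₀ x'| ≤ L * |x - x'|)
    (hsmall : K * ((1 + L) * Real.exp K) * δ ≤ 1 / 2) {t : ℝ} (ht : t ∈ Icc 0 δ) :
    NearId fun ξ => (y t ξ).1 := by
  intro ξ η
  have h0 : (0 : ℝ) ∈ Icc 0 δ := ⟨le_rfl, ht.1.trans ht.2⟩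
  have key := (convex_Icc 0 δ).norm_image_sub_le_of_norm_hasDerivWithin_le
    (f := fun s => y s ξ - y s η)
    (f' := fun s => charField γa γb (a s) (y s ξ) - charField γa γb (a s) (y s η))
    (C := K * ((1 + L) * Real.exp K * |ξ - η|))
    (fun s hs => (h.deriv ξ s hs).sub (h.deriv η s hs)) (fun s hs => by
      have := (B.lipschitz _ (hac.continuous_apply s) (hac.mem s)).dist_le_mul _
        (h.abs_snd_le ξ hs) _ (h.abs_snd_le η hs)
      rw [dist_eq_norm, dist_eq_norm] at this
      exact this.trans (mul_le_mul_of_nonneg_left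
        (h.norm_sub_le B hac hδ1 hL0 hL hs ξ η) K.2)) h0 ht
  have h1 := (norm_fst_le _).trans key
  simp only [h.initial, Prod.fst_sub, Real.norm_eq_abs, sub_zero, abs_of_nonneg ht.1] at h1
  refine h1.trans ?_
  calc (K : ℝ) * ((1 + L) * Real.exp K * |ξ - η|) * t
      ≤ K * ((1 + L) * Real.exp K * |ξ - η|) * δ := by gcongr; exact ht.2
    _ = K * ((1 + L) * Real.exp K) * δ * |ξ - η| := by ring
    _ ≤ _ := by gcongr

theorem norm_sub_le_time (h : IsCharFlow γa γb δ u₀ a y) (B : CharBounds γa γb M K)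
    (hac : IsDensity a) {s t : ℝ} (hs : s ∈ Icc 0 δ) (ht : t ∈ Icc 0 δ) (ξ : ℝ) :
    ‖y t ξ - y s ξ‖ ≤ M * |t - s| :=
  (convex_Icc 0 δ).norm_image_sub_le_of_norm_hasDerivWithin_le (f := fun s => y s ξ)
    (fun r hr => h.deriv ξ r hr) (fun r hr =>
      B.norm_le _ (hac.continuous_apply r) (hac.mem r) _ (h.abs_snd_le ξ hr)) hs ht

theorem norm_sub_le_of_density (h : IsCharFlow γa γb δ u₀ a y) (B : CharBounds γa γb M K)
    (hac : IsDensity a) {a' : ℝ → ℝ → ℝ} {y' : ℝ → ℝ → ℝ × ℝ}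
    (h' : IsCharFlow γa γb δ u₀ a' y') (hac' : IsDensity a') (hδ1 : δ ≤ 1) {ε : ℝ}
    (hε : ∀ t x, |a t x - a' t x| ≤ ε) {t : ℝ} (ht : t ∈ Icc 0 δ) (ξ : ℝ) :
    ‖y t ξ - y' t ξ‖ ≤ K * δ * Real.exp K * ε := by
  have hε0 : 0 ≤ ε := (abs_nonneg _).trans (hε 0 0)
  have key := norm_le_of_norm_deriv_le (f := fun s => y s ξ - y' s ξ)
    (f' := fun s => charField γa γb (a s) (y s ξ) - charField γa γb (a' s) (y' s ξ)) (δ := δ)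
    (K := K) (c := 0) (ε := K * ε) K.2 (mul_nonneg K.2 hε0)
    (fun s hs => (h.deriv ξ s hs).sub (h'.deriv ξ s hs)) (by
      simp only [h.initial, h'.initial, sub_self, norm_zero, le_refl]) (fun s hs => by
      have e1 := (B.lipschitz _ (hac.continuous_apply s) (hac.mem s)).dist_le_mul _
        (h.abs_snd_le ξ hs) _ (h'.abs_snd_le ξ hs)
      have e2 := B.stable _ (hac.continuous_apply s) (hac.mem s) _ (hac'.continuous_apply s)
        (hac'.mem s) ε (hε s) _ (h'.abs_snd_le ξ hs)
      rw [dist_eq_norm, dist_eq_norm] at e1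
      exact (norm_sub_le_norm_sub_add_norm_sub _ (charField γa γb (a s) (y' s ξ)) _).trans
        (add_le_add e1 e2)) ht
  refine key.trans ?_
  have : Real.exp (K * t) ≤ Real.exp K := Real.exp_le_exp.2
    (mul_le_of_le_one_right K.2 (ht.2.trans hδ1))
  calc (0 + K * ε * t) * Real.exp (K * t)
      ≤ (K * ε * δ) * Real.exp K := by
        have hδ : 0 ≤ δ := ht.1.trans ht.2
        have := ht.2
        rw [zero_add]
        gcongr
    _ = _ := by ring

end IsCharFlow

/-- The density carried by a characteristic flow, as a function of the position. -/
noncomputable def carried (y : ℝ → ℝ × ℝ) (x : ℝ) : ℝ :=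
  (y (Function.invFun (fun ξ => (y ξ).1) x)).2

theorem carried_apply {y : ℝ → ℝ × ℝ} (h : NearId fun ξ => (y ξ).1) (ξ : ℝ) :
    carried y (y ξ).1 = (y ξ).2 := by
  rw [carried, h.invFun_apply]

theorem abs_carried_sub_le {y : ℝ → ℝ × ℝ} (h : NearId fun ξ => (y ξ).1) {Λ : ℝ} (hΛ : 0 ≤ Λ)
    (hy : ∀ ξ η, ‖y ξ - y η‖ ≤ Λ * |ξ - η|) (x x' : ℝ) :
    |carried y x - carried y x'| ≤ 2 * Λ * |x - x'| := by
  refine ((norm_snd_le _).trans (hy _ _)).trans ?_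
  have := mul_le_mul_of_nonneg_left (h.abs_invFun_sub_le x x') hΛ
  linarith

theorem abs_carried_sub_carried_le {y z : ℝ → ℝ × ℝ} (h : NearId fun ξ => (y ξ).1)
    (h' : NearId fun ξ => (z ξ).1) {Λ ε : ℝ} (hΛ : 0 ≤ Λ)
    (hz : ∀ ξ η, ‖z ξ - z η‖ ≤ Λ * |ξ - η|) (hε : ∀ ξ, ‖y ξ - z ξ‖ ≤ ε) (x : ℝ) :
    |carried y x - carried z x| ≤ (1 + 2 * Λ) * ε := by
  set η := Function.invFun (fun ξ => (y ξ).1) x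
  have hx : (y η).1 = x := h.apply_invFun x
  have e1 : carried y x = (y η).2 := rfl
  have e2 := abs_carried_sub_le h' hΛ hz (z η).1 x
  rw [carried_apply h', ← hx] at e2
  have e3 : |(y η).1 - (z η).1| ≤ ε := (norm_fst_le (y η - z η)).trans (hε η)
  have e4 : |(y η).2 - (z η).2| ≤ ε := (norm_snd_le (y η - z η)).trans (hε η)
  rw [abs_sub_comm (z η).1] at e2
  rw [e1, ← hx]
  have e5 : 2 * Λ * |(y η).1 - (z η).1| ≤ 2 * Λ * ε := by gcongr
  have := abs_sub_le (y η).2 (z η).2 (carried z (y η).1)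
  linarith

open scoped BoundedContinuousFunction in
/-- Solution of the characteristic system in which the nonlocal terms are those of the density
carried by the flow itself. -/
theorem exists_selfConsistent_charFlow {γa γb : ℝ} (ha : 0 < γa) (hb : 0 < γb) {M δ L : ℝ}
    {K : NNReal} (B : CharBounds γa γb M K) (hδ : 0 ≤ δ) (hδ1 : δ ≤ 1) (hδM : M * δ ≤ 1)
    (hL0 : 0 ≤ L) (hsmall : K * ((1 + L) * Real.exp K) * δ ≤ 1 / 2)
    (hcontr : (1 + 2 * ((1 + L) * Real.exp K)) * (K * δ * Real.exp K) ≤ 1 / 2)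
    {u₀ : ℝ → ℝ} (hu₀ : ∀ x, 0 ≤ u₀ x ∧ u₀ x ≤ 1) (hL : ∀ x x', |u₀ x - u₀ x'| ≤ L * |x - x'|) :
    ∃ a y, IsDensity a ∧ IsCharFlow γa γb δ u₀ a y ∧
      ∀ t ∈ Icc 0 δ, ∀ ξ, a t (y t ξ).1 = (y t ξ).2 := by
  let S : Set (ℝ × ℝ →ᵇ ℝ) := {f | ∀ p, 0 ≤ f p ∧ f p ≤ 1}
  have hS : IsClosed S := by
    have : S = ⋂ p, {f : ℝ × ℝ →ᵇ ℝ | 0 ≤ f p ∧ f p ≤ 1} := by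
      ext f
      simp [S]
    rw [this]
    refine isClosed_iInter fun p => IsClosed.and ?_ ?_
    · exact isClosed_le continuous_const (continuous_eval_const p)
    · exact isClosed_le (continuous_eval_const p) continuous_const
  have : CompleteSpace S := hS.completeSpace_coe
  have : Nonempty S := ⟨⟨0, fun p => by simp⟩⟩
  have hdens : ∀ f : S, IsDensity fun t x => f.1 (t, x) := fun f =>
    ⟨f.1.continuous, fun t x => f.2 (t, x)⟩
  choose Y hY using fun f : S => exists_charFlow ha hb B hδ hδM hu₀ (hdens f)
  set Λ : ℝ := (1 + L) * Real.exp K with hΛdef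
  have hΛ : 0 ≤ Λ := by positivity
  have hlip : ∀ f : S, ∀ t ∈ Icc 0 δ, ∀ ξ η, ‖Y f t ξ - Y f t η‖ ≤ Λ * |ξ - η| := fun f t ht ξ η =>
    (hY f).norm_sub_le B (hdens f) hδ1 hL0 hL ht ξ η
  have hnear : ∀ f : S, ∀ t ∈ Icc 0 δ, NearId fun ξ => (Y f t ξ).1 := fun f t ht =>
    (hY f).nearId B (hdens f) hδ1 hL0 hL hsmall ht
  let c : ℝ → ℝ := fun t => max 0 (min δ t)
  have hc : ∀ t, c t ∈ Icc 0 δ := fun t => ⟨le_max_left _ _, max_le hδ (min_le_left _ _)⟩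
  have hcc : Continuous c := by fun_prop
  have hcid : ∀ t ∈ Icc 0 δ, c t = t := fun t ht => by
    simp only [c]
    rw [min_eq_right ht.2, max_eq_right ht.1]
  have hcont : ∀ f : S, Continuous fun p : ℝ × ℝ => carried (Y f (c p.1)) p.2 := by
    intro f
    refine continuous_iff_continuousAt.2 fun p => ?_
    rw [ContinuousAt, tendsto_iff_dist_tendsto_zero]
    refine squeeze_zero (fun _ => dist_nonneg) (g := fun q : ℝ × ℝ =>
      2 * Λ * |q.2 - p.2| + (1 + 2 * Λ) * (M * |c q.1 - c p.1|)) (fun q => ?_) ?_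
    · rw [Real.dist_eq]
      have e1 := abs_carried_sub_le (hnear f _ (hc q.1)) hΛ (hlip f _ (hc q.1)) q.2 p.2
      have e2 := abs_carried_sub_carried_le (hnear f _ (hc q.1)) (hnear f _ (hc p.1)) hΛ
        (hlip f _ (hc p.1)) (fun ξ => (hY f).norm_sub_le_time B (hdens f) (hc p.1) (hc q.1) ξ) p.2
      exact (abs_sub_le _ (carried (Y f (c q.1)) p.2) _).trans (add_le_add e1 e2)
    · have : Continuous fun q : ℝ × ℝ =>
          2 * Λ * |q.2 - p.2| + (1 + 2 * Λ) * (M * |c q.1 - c p.1|) := by fun_prop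
      simpa using this.tendsto p
  have hmem : ∀ f : S, ∀ p : ℝ × ℝ, 0 ≤ carried (Y f (c p.1)) p.2 ∧
      carried (Y f (c p.1)) p.2 ≤ 1 := fun f p => (hY f).mem _ _ (hc p.1)
  let Φ : S → S := fun f => ⟨BoundedContinuousFunction.ofNormedAddCommGroup _ (hcont f) 1
    (fun p => abs_le.2 ⟨by linarith [(hmem f p).1], (hmem f p).2⟩), hmem f⟩
  have hΦ : ContractingWith (1 / 2) Φ := by
    refine ⟨by rw [← NNReal.coe_lt_coe]; norm_num, LipschitzWith.of_dist_le_mul fun f g => ?_⟩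
    rw [Subtype.dist_eq, BoundedContinuousFunction.dist_le (by positivity)]
    intro p
    have e1 := abs_carried_sub_carried_le (hnear f _ (hc p.1)) (hnear g _ (hc p.1)) hΛ
      (hlip g _ (hc p.1)) (fun ξ => (hY f).norm_sub_le_of_density B (hdens f) (hY g) (hdens g) hδ1
        (ε := dist f g) (fun t x => 
        BoundedContinuousFunction.dist_coe_le_dist (f := f.1) (g := g.1) (t, x)) (hc p.1) ξ) p.2
    refine e1.trans ?_
    rw [← mul_assoc]
    refine mul_le_mul_of_nonneg_right (hcontr.trans (by norm_num)) dist_nonneg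
  obtain ⟨f, hf⟩ : ∃ f, Φ f = f := ⟨_, hΦ.fixedPoint_isFixedPt⟩
  refine ⟨_, Y f, hdens f, hY f, fun t ht ξ => ?_⟩
  have e : f.1 (t, (Y f t ξ).1) = carried (Y f (c t)) (Y f t ξ).1 := by
    exact congrArg (fun g : S => g.1 (t, (Y f t ξ).1)) hf.symm
  change f.1 (t, (Y f t ξ).1) = _
  rw [e, hcid t ht, carried_apply (hnear f t ht)]

/-- A characteristic flow whose nonlocal terms are those of the density it carries, with
quantitative bounds. -/
structure SelfFlow (γa γb δ Λ M : ℝ) (u₀ : ℝ → ℝ) (a : ℝ → ℝ → ℝ) (y : ℝ → ℝ → ℝ × ℝ) :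
    Prop where
  posA : 0 < γa
  posB : 0 < γb
  pos : 0 < δ
  le_one : δ ≤ 1
  lip_nonneg : 0 ≤ Λ
  speed_nonneg : 0 ≤ M
  density : IsDensity a
  flow : IsCharFlow γa γb δ u₀ a y
  consistent : ∀ t ∈ Icc 0 δ, ∀ ξ, a t (y t ξ).1 = (y t ξ).2
  lip : ∀ t ∈ Icc 0 δ, ∀ ξ η, ‖y t ξ - y t η‖ ≤ Λ * |ξ - η|
  near : ∀ t ∈ Icc 0 δ, NearId fun ξ => (y t ξ).1
  speed : ∀ s ∈ Icc 0 δ, ∀ t ∈ Icc 0 δ, ∀ ξ, ‖y t ξ - y s ξ‖ ≤ M * |t - s|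

theorem exists_selfFlow {γa γb : ℝ} (ha : 0 < γa) (hb : 0 < γb) {M : ℝ} {K : NNReal}
    (B : CharBounds γa γb M K) {L : ℝ} (hL0 : 0 ≤ L) :
    ∃ δ Λ : ℝ, 0 < δ ∧ 2 * K * δ ≤ 1 ∧ ∀ u₀ : ℝ → ℝ, (∀ x, 0 ≤ u₀ x ∧ u₀ x ≤ 1) →
      (∀ x x', |u₀ x - u₀ x'| ≤ L * |x - x'|) → ∃ a y, SelfFlow γa γb δ Λ M u₀ a y := by
  set Λ : ℝ := (1 + L) * Real.exp K with hΛ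
  have hM := B.nonneg
  have hK : 0 ≤ (K : ℝ) := K.2
  set c : ℝ := 1 + M + 2 * K + 2 * (K * Λ) + 2 * ((1 + 2 * Λ) * (K * Real.exp K)) with hc
  have hΛ0 : 0 ≤ Λ := by positivity
  have hc0 : 0 < c := by positivity
  have n1 : 0 ≤ K * Λ := by positivity
  have n2 : 0 ≤ (1 + 2 * Λ) * (K * Real.exp K) := by positivity
  have hδ : (0 : ℝ) ≤ 1 / c := by positivity
  have key : ∀ b, b ≤ c → b * (1 / c) ≤ 1 := fun b hb => by
    rw [mul_one_div]
    exact (div_le_one hc0).2 hb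
  have k1 := key 1 (by linarith)
  have k2 := key M (by linarith)
  have k3 := key (2 * K) (by linarith)
  have k4 := key (2 * (K * Λ)) (by linarith)
  have k5 := key (2 * ((1 + 2 * Λ) * (K * Real.exp K))) (by linarith)
  rw [one_mul] at k1
  refine ⟨1 / c, Λ, by positivity, k3, fun u₀ hu hL => ?_⟩
  have s1 : K * Λ * (1 / c) ≤ 1 / 2 := by linarith
  obtain ⟨a, y, had, hy, hcons⟩ := exists_selfConsistent_charFlow ha hb B hδ k1 k2 hL0 s1
    (by linarith) hu hL
  exact ⟨a, y, ha, hb, by positivity, k1, hΛ0, hM, had, hy, hcons,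
    fun t ht ξ η => hy.norm_sub_le B had k1 hL0 hL ht ξ η,
    fun t ht => hy.nearId B had k1 hL0 hL s1 ht,
    fun s hs t ht ξ => hy.norm_sub_le_time B had hs ht ξ⟩

/-- The linear map of the plane with given matrix entries. -/
noncomputable def planeMap (a b c d : ℝ) : ℝ × ℝ →L[ℝ] ℝ × ℝ :=
  a • (ContinuousLinearMap.fst ℝ ℝ ℝ).prod 0 + b • (ContinuousLinearMap.snd ℝ ℝ ℝ).prod 0 +
    c • ContinuousLinearMap.prod 0 (ContinuousLinearMap.fst ℝ ℝ ℝ) +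
    d • ContinuousLinearMap.prod 0 (ContinuousLinearMap.snd ℝ ℝ ℝ)

theorem planeMap_apply (a b c d : ℝ) (h : ℝ × ℝ) :
    planeMap a b c d h = (a * h.1 + b * h.2, c * h.1 + d * h.2) := by
  simp [planeMap]

/-- The derivative of `charField`. -/
noncomputable def charFieldDeriv (γa γb : ℝ) (w : ℝ → ℝ) (y : ℝ × ℝ) : ℝ × ℝ →L[ℝ] ℝ × ℝ :=
  planeMap
    ((1 - 2 * y.2) * (Real.exp (potential γa γb w y.1) *
      (2 * kap γa γb * w y.1 + potentialRem γa γb w y.1)))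
    (-2 * Real.exp (potential γa γb w y.1))
    (-(Real.exp (potential γa γb w y.1) *
      (2 * kap γa γb * w y.1 + potentialRem γa γb w y.1) * (y.2 * (1 - y.2) *
        (2 * kap γa γb * y.2 + potentialRem γa γb w y.1)) +
      Real.exp (potential γa γb w y.1) * (y.2 * (1 - y.2) * potentialCurv γa γb w y.1)))
    (-(Real.exp (potential γa γb w y.1) * ((1 - 2 * y.2) *
      (2 * kap γa γb * y.2 + potentialRem γa γb w y.1) + 2 * kap γa γb * (y.2 * (1 - y.2)))))

theorem hasFDerivAt_charField {γa γb : ℝ} (ha : 0 < γa) (hb : 0 < γb) {w : ℝ → ℝ}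
    (hw : Continuous w) (y : ℝ × ℝ) :
    HasFDerivAt (charField γa γb w) (charFieldDeriv γa γb w y) y := by
  have hf : HasFDerivAt (fun y : ℝ × ℝ => y.1) (ContinuousLinearMap.fst ℝ ℝ ℝ) y := hasFDerivAt_fst
  have hs : HasFDerivAt (fun y : ℝ × ℝ => y.2) (ContinuousLinearMap.snd ℝ ℝ ℝ) y := hasFDerivAt_snd
  have hE := (hasDerivAt_potential ha hb hw y.1).exp.comp_hasFDerivAt y hf
  have hR := (hasDerivAt_potentialRem (γa := γa) (γb := γb) hw y.1).comp_hasFDerivAt y hf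
  have h1 := ((hs.const_mul 2).const_sub 1).mul hE
  have h2 := (hE.mul ((hs.mul (hs.const_sub 1)).mul ((hs.const_mul (2 * kap γa γb)).add hR))).neg
  refine (h1.prodMk h2).congr_fderiv ?_
  refine ContinuousLinearMap.ext fun h => ?_
  rw [charFieldDeriv, planeMap_apply]
  simp
  constructor <;> ring

theorem continuous_charFieldDeriv {γa γb : ℝ} {a : ℝ → ℝ → ℝ} (h : IsDensity a) :
    Continuous (Function.uncurry fun t y => charFieldDeriv γa γb (a t) y) := by
  have q : Continuous fun p : ℝ × (ℝ × ℝ) => (p.1, p.2.1) := by fun_prop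
  have c1 := (continuous_potential (γa := γa) (γb := γb) h.continuous).comp q
  have c2 := (continuous_potentialRem (γa := γa) (γb := γb) h.continuous).comp q
  have c3 := (continuous_potentialCurv (γa := γa) (γb := γb) h.continuous).comp q
  have c4 := h.continuous.comp q
  simp only [Function.comp_def, Function.uncurry] at c1 c2 c3 c4
  change Continuous fun p : ℝ × (ℝ × ℝ) => charFieldDeriv γa γb (a p.1) p.2
  unfold charFieldDeriv planeMap
  obtain ⟨W, hW⟩ : ∃ W : ℝ × (ℝ × ℝ) → ℝ, ∀ p, a p.1 p.2.1 = W p := ⟨_, fun _ => rfl⟩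
  simp only [hW] at c4 ⊢
  refine ((Continuous.add (Continuous.add ?_ ?_) ?_).add ?_)
  all_goals refine Continuous.fun_smul ?_ continuous_const
  all_goals fun_prop

/-- The rate of change along a characteristic of the slope `d`, where `E` is the exponential of
the potential, `m` and `s` are the first derivative of the potential and the derivative of its
nonlocal part, and `v` is the density. -/
noncomputable def slopeRate (κ E m s v d : ℝ) : ℝ :=
  E * (2 * d ^ 2 - (2 * (1 - 2 * v) * m + 2 * κ * (v * (1 - v))) * d - v * (1 - v) * (m ^ 2 + s))

namespace SelfFlow

variable {γa γb δ Λ M : ℝ} {u₀ : ℝ → ℝ} {a : ℝ → ℝ → ℝ} {y : ℝ → ℝ → ℝ × ℝ}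

theorem zero_mem (S : SelfFlow γa γb δ Λ M u₀ a y) : (0 : ℝ) ∈ Icc 0 δ := ⟨le_rfl, S.pos.le⟩

theorem eq_carried (S : SelfFlow γa γb δ Λ M u₀ a y) {t : ℝ} (ht : t ∈ Icc 0 δ) :
    a t = carried (y t) := by
  funext x
  obtain ⟨ξ, hξ⟩ := (S.near t ht).surjective x
  simp only at hξ
  rw [← hξ, S.consistent t ht, carried_apply (S.near t ht)]

theorem abs_sub_le (S : SelfFlow γa γb δ Λ M u₀ a y) {t : ℝ} (ht : t ∈ Icc 0 δ) (x x' : ℝ) :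
    |a t x - a t x'| ≤ 2 * Λ * |x - x'| := by
  rw [S.eq_carried ht]
  exact abs_carried_sub_le (S.near t ht) S.lip_nonneg (S.lip t ht) x x'

theorem initial (S : SelfFlow γa γb δ Λ M u₀ a y) : a 0 = u₀ := by
  funext x
  have := S.consistent 0 S.zero_mem x
  simpa [S.flow.initial] using this

theorem norm_charFieldDeriv_le (S : SelfFlow γa γb δ Λ M u₀ a y) {K : NNReal}
    (B : CharBounds γa γb M K) {t : ℝ} (ht : t ∈ Icc 0 δ) (ξ : ℝ) :
    ‖charFieldDeriv γa γb (a t) (y t ξ)‖ ≤ K := by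
  refine HasFDerivAt.le_of_lipschitzOn (f := charField γa γb (a t)) (hasFDerivAt_charField
    S.posA S.posB (S.density.continuous_apply t) (y t ξ)) ?_
    (B.lipschitz _ (S.density.continuous_apply t) (S.density.mem t))
  have hopen : IsOpen {q : ℝ × ℝ | |q.2| < 2} :=
    isOpen_lt (by fun_prop) continuous_const
  refine mem_of_superset (hopen.mem_nhds ?_) (fun q (hq : |q.2| < 2) => hq.le)
  have := S.flow.mem ξ t ht
  change |(y t ξ).2| < 2
  exact abs_lt.2 ⟨by linarith, by linarith⟩

theorem hasDerivAt_flow (S : SelfFlow γa γb δ Λ M u₀ a y) (hu₀ : Differentiable ℝ u₀) {ξ : ℝ}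
    {z : ℝ → ℝ × ℝ} (hz0 : z 0 = (1, deriv u₀ ξ)) (hz : ∀ t ∈ Icc 0 δ,
      HasDerivWithinAt z (charFieldDeriv γa γb (a t) (y t ξ) (z t)) (Icc 0 δ) t) {t : ℝ}
    (ht : t ∈ Icc 0 δ) : HasDerivAt (y t) (z t) ξ := by
  have h0 : HasDerivAt (y 0) (z 0) ξ := by
    rw [hz0, show y 0 = fun ξ => (ξ, u₀ ξ) from funext S.flow.initial]
    exact (hasDerivAt_id' ξ).prodMk (hu₀ ξ).hasDerivAt
  exact hasDerivAt_parameter (G := fun t => charField γa γb (a t))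
      (G' := fun t => charFieldDeriv γa γb (a t)) S.pos.le
      (fun t q => hasFDerivAt_charField S.posA S.posB (S.density.continuous_apply t) q)
      (continuous_charFieldDeriv S.density) S.lip_nonneg (fun η s hs => S.flow.deriv η s hs)
      (fun s hs η => S.lip s hs η ξ) hz h0 ht

theorem exists_tangent (S : SelfFlow γa γb δ Λ M u₀ a y) {K : NNReal}
    (B : CharBounds γa γb M K) (hK : 2 * K * δ ≤ 1) (hu₀ : Differentiable ℝ u₀) :
    ∃ z : ℝ → ℝ → ℝ × ℝ, (∀ ξ, z ξ 0 = (1, deriv u₀ ξ)) ∧ ∀ t ∈ Icc 0 δ, ∀ ξ,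
      HasDerivAt (y t) (z ξ t) ξ ∧
      HasDerivWithinAt (z ξ) (charFieldDeriv γa γb (a t) (y t ξ) (z ξ t)) (Icc 0 δ) t := by
  have hcp : ∀ ξ, ContinuousOn (fun t => (t, y t ξ)) (Icc 0 δ) := fun ξ =>
    continuousOn_id.prodMk fun s hs => (S.flow.deriv ξ s hs).continuousWithinAt
  have hz : ∀ ξ, ∃ z : ℝ → ℝ × ℝ, z 0 = (1, deriv u₀ ξ) ∧ ∀ t ∈ Icc 0 δ,
      HasDerivWithinAt z (charFieldDeriv γa γb (a t) (y t ξ) (z t)) (Icc 0 δ) t := fun ξ => by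
    have hc : ContinuousOn (fun t => charFieldDeriv γa γb (a t) (y t ξ)) (Icc 0 δ) :=
      Continuous.comp_continuousOn (g := fun p : ℝ × (ℝ × ℝ) => charFieldDeriv γa γb (a p.1) p.2)
        (f := fun t => (t, y t ξ)) (continuous_charFieldDeriv S.density) (hcp ξ)
    have hb : ∀ t ∈ Icc 0 δ, ‖charFieldDeriv γa γb (a t) (y t ξ)‖ ≤ K :=
      fun t ht => S.norm_charFieldDeriv_le B ht ξ
    exact exists_linear_solution (A := fun t => charFieldDeriv γa γb (a t) (y t ξ))
      S.pos.le K.coe_nonneg hK hc hb (1, deriv u₀ ξ)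
  choose z hz0 hz using hz
  exact ⟨z, hz0, fun t ht ξ => ⟨S.hasDerivAt_flow hu₀ (hz0 ξ) (hz ξ) ht, hz ξ t ht⟩⟩

theorem abs_deriv_sub_one_le (S : SelfFlow γa γb δ Λ M u₀ a y) {t ξ p : ℝ} (ht : t ∈ Icc 0 δ)
    (hp : HasDerivAt (fun η => (y t η).1) p ξ) : |p - 1| ≤ 1 / 2 := by
  have h1 : HasDerivAt (fun η => (y t η).1 - η) (p - 1) ξ := hp.sub (hasDerivAt_id ξ)
  have h2 : LipschitzWith (1 / 2) (fun η => (y t η).1 - η) :=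
    LipschitzWith.of_dist_le_mul fun η η' => by
      rw [Real.dist_eq, Real.dist_eq]
      have := S.near t ht η η'
      simp only [NNReal.coe_div, NNReal.coe_one, NNReal.coe_ofNat]
      rwa [show (y t η).1 - η - ((y t η').1 - η') = (y t η).1 - (y t η').1 - (η - η') by ring]
  have h3 := norm_deriv_le_of_lipschitz (x₀ := ξ) h2
  rw [h1.deriv] at h3
  simpa using h3

theorem hasDerivAt_density (S : SelfFlow γa γb δ Λ M u₀ a y) {t ξ p q : ℝ} (ht : t ∈ Icc 0 δ)
    (hp : HasDerivAt (fun η => (y t η).1) p ξ) (hq : HasDerivAt (fun η => (y t η).2) q ξ) :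
    HasDerivAt (a t) (q / p) (y t ξ).1 := by
  have hp0 : p ≠ 0 := by
    rintro rfl
    have := S.abs_deriv_sub_one_le ht hp
    norm_num at this
  have hinv := (S.near t ht).hasDerivAt_invFun (x := (y t ξ).1) (p := p)
    (by rw [(S.near t ht).invFun_apply ξ]; exact hp) hp0
  have hV' : HasDerivAt (fun η => (y t η).2) q
      (Function.invFun (fun η => (y t η).1) (y t ξ).1) := by
    rw [(S.near t ht).invFun_apply ξ]
    exact hq
  rw [S.eq_carried ht, div_eq_mul_inv]
  exact hV'.comp _ hinv

theorem abs_le_of_hasDerivAt (S : SelfFlow γa γb δ Λ M u₀ a y) {t x d : ℝ} (ht : t ∈ Icc 0 δ)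
    (hd : HasDerivAt (a t) d x) : |d| ≤ 2 * Λ := by
  have h2 : LipschitzWith ⟨2 * Λ, mul_nonneg zero_le_two S.lip_nonneg⟩ (a t) :=
    LipschitzWith.of_dist_le_mul fun x x' => S.abs_sub_le ht x x'
  have h3 := norm_deriv_le_of_lipschitz (x₀ := x) h2
  rwa [hd.deriv] at h3

end SelfFlow

theorem hasDerivWithinAt_slope {p q : ℝ → ℝ} {κ E m s v t : ℝ} {I : Set ℝ}
    (hp : HasDerivWithinAt p ((1 - 2 * v) * (E * m) * p t + -2 * E * q t) I t)
    (hq : HasDerivWithinAt q (-(E * m * (v * (1 - v) * m) + E * (v * (1 - v) * s)) * p t +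
      -(E * ((1 - 2 * v) * m + 2 * κ * (v * (1 - v)))) * q t) I t) (h0 : p t ≠ 0) :
    HasDerivWithinAt p (E * ((1 - 2 * v) * m - 2 * (q t / p t)) * p t) I t ∧
    HasDerivWithinAt (fun t => q t / p t) (slopeRate κ E m s v (q t / p t)) I t := by
  constructor
  · refine hp.congr_deriv ?_
    field_simp
    ring
  · refine (hq.div hp h0).congr_deriv ?_
    unfold slopeRate
    field_simp
    ring

/-- The stretching `p` of a characteristic flow and the slope `D` of the density along it. -/
structure SlopeFlow (γa γb δ Λ : ℝ) (u₀ : ℝ → ℝ) (a : ℝ → ℝ → ℝ) (y : ℝ → ℝ → ℝ × ℝ)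
    (p D : ℝ → ℝ → ℝ) : Prop where
  initial : ∀ ξ, D 0 ξ = deriv u₀ ξ
  hasDerivAt_pos : ∀ t ∈ Icc 0 δ, ∀ ξ, HasDerivAt (fun η => (y t η).1) (p t ξ) ξ
  half_le : ∀ t ∈ Icc 0 δ, ∀ ξ, 1 / 2 ≤ p t ξ
  le : ∀ t ∈ Icc 0 δ, ∀ ξ, p t ξ ≤ 3 / 2
  hasDerivAt_density : ∀ t ∈ Icc 0 δ, ∀ ξ, HasDerivAt (a t) (D t ξ) (y t ξ).1
  abs_le : ∀ t ∈ Icc 0 δ, ∀ ξ, |D t ξ| ≤ 2 * Λ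
  deriv_stretch : ∀ t ∈ Icc 0 δ, ∀ ξ, HasDerivWithinAt (fun s => p s ξ)
    (Real.exp (potential γa γb (a t) (y t ξ).1) * ((1 - 2 * (y t ξ).2) *
      (2 * kap γa γb * (y t ξ).2 + potentialRem γa γb (a t) (y t ξ).1) - 2 * D t ξ) * p t ξ)
    (Icc 0 δ) t
  deriv_slope : ∀ t ∈ Icc 0 δ, ∀ ξ, HasDerivWithinAt (fun s => D s ξ)
    (slopeRate (kap γa γb) (Real.exp (potential γa γb (a t) (y t ξ).1))
      (2 * kap γa γb * (y t ξ).2 + potentialRem γa γb (a t) (y t ξ).1)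
      (potentialCurv γa γb (a t) (y t ξ).1) (y t ξ).2 (D t ξ)) (Icc 0 δ) t

theorem SelfFlow.exists_slopeFlow {γa γb δ Λ M : ℝ} {u₀ : ℝ → ℝ} {a : ℝ → ℝ → ℝ}
    {y : ℝ → ℝ → ℝ × ℝ} (S : SelfFlow γa γb δ Λ M u₀ a y) {K : NNReal}
    (B : CharBounds γa γb M K) (hK : 2 * K * δ ≤ 1) (hu₀ : Differentiable ℝ u₀) :
    ∃ p D, SlopeFlow γa γb δ Λ u₀ a y p D := by
  obtain ⟨z, hz0, hz⟩ := S.exists_tangent B hK hu₀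
  have hX : ∀ t ∈ Icc 0 δ, ∀ ξ, HasDerivAt (fun η => (y t η).1) (z ξ t).1 ξ := fun t ht ξ =>
    (hz t ht ξ).1.fst
  have hV : ∀ t ∈ Icc 0 δ, ∀ ξ, HasDerivAt (fun η => (y t η).2) (z ξ t).2 ξ := fun t ht ξ =>
    (hz t ht ξ).1.snd
  have hp : ∀ t ∈ Icc 0 δ, ∀ ξ, |(z ξ t).1 - 1| ≤ 1 / 2 := fun t ht ξ =>
    S.abs_deriv_sub_one_le ht (hX t ht ξ)
  have hpl : ∀ t ∈ Icc 0 δ, ∀ ξ, 1 / 2 ≤ (z ξ t).1 := fun t ht ξ => by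
    linarith [(abs_le.1 (hp t ht ξ)).1]
  have hD := fun t (ht : t ∈ Icc 0 δ) ξ => S.hasDerivAt_density ht (hX t ht ξ) (hV t ht ξ)
  have key := fun t (ht : t ∈ Icc 0 δ) ξ => by
    have h1 := (hz t ht ξ).2.fst
    have h2 := (hz t ht ξ).2.snd
    have h3 : (z ξ t).1 ≠ 0 := by
      have := hpl t ht ξ
      intro h
      linarith
    rw [charFieldDeriv, planeMap_apply, S.consistent t ht] at h1 h2
    exact hasDerivWithinAt_slope (p := fun t => (z ξ t).1) (q := fun t => (z ξ t).2) h1 h2 h3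
  exact ⟨fun t ξ => (z ξ t).1, fun t ξ => (z ξ t).2 / (z ξ t).1, fun ξ => by simp [hz0],
    hX, hpl, fun t ht ξ => by linarith [(abs_le.1 (hp t ht ξ)).2], hD,
    fun t ht ξ => S.abs_le_of_hasDerivAt ht (hD t ht ξ), fun t ht ξ => (key t ht ξ).1,
    fun t ht ξ => (key t ht ξ).2⟩

theorem continuousOn_l2Class {I : Set ℝ} {H : ℝ → ℝ → ℝ} (hH : ∀ t ∈ I, MemLp (H t) 2 volume)
    (h : ∀ t₀ ∈ I, ∀ ε : ℝ, 0 < ε → ∀ᶠ t in 𝓝[I] t₀,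
      eLpNorm (H t - H t₀) 2 volume ≤ ENNReal.ofReal ε) :
    ContinuousOn (fun t => l2Class (H t)) I := by
  intro t₀ ht₀
  refine Metric.tendsto_nhds.2 fun ε hε => ?_
  filter_upwards [h t₀ ht₀ (ε / 2) (by positivity), self_mem_nhdsWithin] with t h1 ht
  rw [l2Class, dif_pos (hH t ht), l2Class, dif_pos (hH t₀ ht₀)]
  have h2 := Lp.edist_toLp_toLp (H t) (H t₀) (hH t ht) (hH t₀ ht₀)
  rw [← h2, edist_dist, ENNReal.ofReal_le_ofReal_iff (by positivity)] at h1
  linarith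

namespace NearId

variable {X : ℝ → ℝ}

theorem continuous_invFun (h : NearId X) : Continuous (Function.invFun X) :=
  (LipschitzWith.of_dist_le_mul (K := 2) fun x y => by
    simpa [Real.dist_eq] using h.abs_invFun_sub_le x y).continuous

theorem map_invFun_le (h : NearId X) :
    Measure.map (Function.invFun X) volume ≤ (2 : ENNReal) • (volume : Measure ℝ) := by
  have hl : LipschitzWith 2 X := LipschitzWith.of_dist_le_mul fun x y => by
    have := h.abs_sub_le x y
    have := abs_nonneg (x - y)
    simp only [Real.dist_eq, NNReal.coe_ofNat]
    linarith
  refine Measure.le_iff.2 fun s hs => ?_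
  rw [Measure.map_apply h.continuous_invFun.measurable hs, Measure.smul_apply]
  have h1 : Function.invFun X ⁻¹' s ⊆ X '' s := fun x hx => ⟨_, hx, h.apply_invFun x⟩
  have h2 := hl.hausdorffMeasure_image_le zero_le_one s
  rw [hausdorffMeasure_real] at h2
  simpa using (measure_mono h1).trans h2

theorem eLpNorm_comp_invFun_le (h : NearId X) {f : ℝ → ℝ} (hf : AEStronglyMeasurable f volume) :
    eLpNorm (fun x => f (Function.invFun X x)) 2 volume ≤ 2 * eLpNorm f 2 volume := by
  have hac : Measure.map (Function.invFun X) volume ≪ volume :=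
    (Measure.absolutelyContinuous_of_le h.map_invFun_le).trans
      (Measure.smul_absolutelyContinuous)
  have h1 := eLpNorm_map_measure (p := 2) (hf.mono_ac hac)
    h.continuous_invFun.measurable.aemeasurable
  have h2 := eLpNorm_mono_measure (p := 2) f h.map_invFun_le
  rw [h1, eLpNorm_smul_measure_of_ne_top (by norm_num)] at h2
  refine h2.trans ?_
  rw [smul_eq_mul]
  gcongr
  calc (2 : ENNReal) ^ (1 / 2 : ENNReal).toReal ≤ 2 ^ (1 : ℝ) :=
        ENNReal.rpow_le_rpow_of_exponent_le (by norm_num) (by norm_num)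
    _ = 2 := ENNReal.rpow_one 2

theorem memLp_comp_invFun (h : NearId X) {f : ℝ → ℝ} (hf : MemLp f 2 volume) :
    MemLp (fun x => f (Function.invFun X x)) 2 volume := by
  have hac : Measure.map (Function.invFun X) volume ≪ volume :=
    (Measure.absolutelyContinuous_of_le h.map_invFun_le).trans
      (Measure.smul_absolutelyContinuous)
  refine ⟨(hf.1.mono_ac hac).comp_measurable h.continuous_invFun.measurable, ?_⟩
  exact (h.eLpNorm_comp_invFun_le hf.1).trans_lt (ENNReal.mul_lt_top (by norm_num) hf.2)

theorem abs_invFun_sub_invFun_le {Z : ℝ → ℝ} (h : NearId X) (h' : NearId Z) {ε : ℝ}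
    (hε : ∀ ξ, |X ξ - Z ξ| ≤ ε) (x : ℝ) :
    |Function.invFun X x - Function.invFun Z x| ≤ 2 * ε := by
  have h1 := h'.le_abs_sub (Function.invFun X x) (Function.invFun Z x)
  have h2 := hε (Function.invFun X x)
  rw [h.apply_invFun] at h2
  rw [h'.apply_invFun, abs_sub_comm (Z _)] at h1
  linarith

end NearId

theorem eventually_eLpNorm_comp_invFun_sub_le {I : Set ℝ} {X : ℝ → ℝ → ℝ} {M : ℝ}
    (hX : ∀ t ∈ I, NearId (X t)) (hM : 0 ≤ M)
    (hXt : ∀ s ∈ I, ∀ t ∈ I, ∀ ξ, |X t ξ - X s ξ| ≤ M * |t - s|) {φ : ℝ → ℝ}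
    (hφ : Continuous φ) (hφc : HasCompactSupport φ) {t₀ : ℝ} (ht₀ : t₀ ∈ I) {ε : ℝ} (hε : 0 < ε) :
    ∀ᶠ t in 𝓝[I] t₀, eLpNorm (fun x => φ (Function.invFun (X t) x) -
      φ (Function.invFun (X t₀) x)) 2 volume ≤ ENNReal.ofReal ε := by
  obtain ⟨R, hR⟩ := hφc.isCompact.isBounded.subset_closedBall 0
  have hu := hφc.uniformContinuous_of_continuous hφ
  set B : Set ℝ := Metric.closedBall 0 (|X t₀ 0| + 3 / 2 * |R| + M)
  set V : ℝ := (volume B ^ (1 / (2 : ENNReal).toReal)).toReal with hV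
  have hVtop : volume B ^ (1 / (2 : ENNReal).toReal) ≠ ⊤ :=
    (ENNReal.rpow_lt_top_of_nonneg (by norm_num) measure_closedBall_lt_top.ne).ne
  have hV0 : 0 ≤ V := ENNReal.toReal_nonneg
  obtain ⟨ρ, hρ, hρφ⟩ := Metric.uniformContinuous_iff.1 hu (ε / (V + 1)) (by positivity)
  have e1 : ∀ᶠ t in 𝓝[I] t₀, |t - t₀| < min 1 (ρ / (2 * M + 1)) := by
    have : ∀ᶠ t in 𝓝 t₀, dist t t₀ < min 1 (ρ / (2 * M + 1)) :=
      Metric.ball_mem_nhds t₀ (lt_min one_pos (by positivity))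
    exact this.filter_mono nhdsWithin_le_nhds
  filter_upwards [e1, self_mem_nhdsWithin] with t h1 ht
  have h1a := h1.trans_le (min_le_left _ _)
  have h1b := h1.trans_le (min_le_right _ _)
  rw [lt_div_iff₀ (by positivity)] at h1b
  have hd : ∀ ξ, |X t ξ - X t₀ ξ| ≤ M := fun ξ =>
    (hXt t₀ ht₀ t ht ξ).trans (mul_le_of_le_one_right hM h1a.le)
  have hsupp : ∀ s ∈ I, (∀ ξ, |X s ξ - X t₀ ξ| ≤ M) → ∀ x, x ∉ B →
      φ (Function.invFun (X s) x) = 0 := fun s hs hsM x hx => by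
    by_contra hne
    apply hx
    have h2 := hR (subset_tsupport φ hne)
    rw [mem_closedBall_zero_iff, Real.norm_eq_abs] at h2 ⊢
    have h3 := hsM (Function.invFun (X s) x)
    rw [(hX s hs).apply_invFun] at h3
    have h4 := (hX t₀ ht₀).abs_sub_le (Function.invFun (X s) x) 0
    rw [sub_zero] at h4
    have h5 := le_abs_self R
    have h6 := abs_sub_abs_le_abs_sub x (X t₀ (Function.invFun (X s) x))
    have h7 := abs_sub_abs_le_abs_sub (X t₀ (Function.invFun (X s) x)) (X t₀ 0)
    linarith
  have key : ∀ x, ‖φ (Function.invFun (X t) x) - φ (Function.invFun (X t₀) x)‖ ≤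
      ‖B.indicator (fun _ => ε / (V + 1)) x‖ := fun x => by
    by_cases hx : x ∈ B
    · rw [indicator_of_mem hx, Real.norm_of_nonneg (by positivity : 0 ≤ ε / (V + 1)),
        ← dist_eq_norm]
      refine (hρφ ?_).le
      rw [Real.dist_eq]
      have := (hX t ht).abs_invFun_sub_invFun_le (hX t₀ ht₀) (hXt t₀ ht₀ t ht) x
      have := abs_nonneg (t - t₀)
      nlinarith
    · rw [hsupp t ht hd x hx, hsupp t₀ ht₀ (fun ξ => by simpa using hM) x hx]
      simp
  refine (eLpNorm_mono key).trans ((eLpNorm_indicator_const_le _ _).trans ?_)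
  rw [← ENNReal.ofReal_toReal hVtop, ← hV, Real.enorm_of_nonneg (by positivity),
    ← ENNReal.ofReal_mul (by positivity)]
  refine ENNReal.ofReal_le_ofReal ?_
  rw [div_mul_eq_mul_div, div_le_iff₀ (by positivity)]
  nlinarith

/-- Transport of a square integrable function depending Lipschitz continuously on time by maps
depending Lipschitz continuously on time is continuous in mean square. -/
theorem continuousOn_l2Class_comp_invFun {I : Set ℝ} {X G : ℝ → ℝ → ℝ} {k : ℝ → ℝ} {M : ℝ}
    (hX : ∀ t ∈ I, NearId (X t)) (hM : 0 ≤ M)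
    (hXt : ∀ s ∈ I, ∀ t ∈ I, ∀ ξ, |X t ξ - X s ξ| ≤ M * |t - s|)
    (hG : ∀ t ∈ I, MemLp (G t) 2 volume) (hk : MemLp k 2 volume)
    (hGt : ∀ s ∈ I, ∀ t ∈ I, ∀ᵐ ξ, |G t ξ - G s ξ| ≤ |t - s| * k ξ) :
    ContinuousOn (fun t => l2Class fun x => G t (Function.invFun (X t) x)) I := by
  refine continuousOn_l2Class (fun t ht => (hX t ht).memLp_comp_invFun (hG t ht)) ?_
  intro t₀ ht₀ ε hε
  obtain ⟨φ, hφc, hφ, hφcont, hφm⟩ := (hG t₀ ht₀).exists_hasCompactSupport_eLpNorm_sub_le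
    (by norm_num) (ε := ENNReal.ofReal (ε / 12)) (by simpa using hε)
  set K := (eLpNorm k 2 volume).toReal with hK
  have hK0 : 0 ≤ K := ENNReal.toReal_nonneg
  have e1 : ∀ᶠ t in 𝓝[I] t₀, |t - t₀| < ε / (6 * K + 1) := by
    have : ∀ᶠ t in 𝓝 t₀, dist t t₀ < ε / (6 * K + 1) :=
      Metric.ball_mem_nhds t₀ (by positivity)
    exact this.filter_mono nhdsWithin_le_nhds
  filter_upwards [e1, self_mem_nhdsWithin, eventually_eLpNorm_comp_invFun_sub_le hX hM hXt hφcont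
    hφc ht₀ (ε := ε / 3) (by positivity)] with t h1 ht h2
  have d1 : MemLp (G t - G t₀) 2 volume := (hG t ht).sub (hG t₀ ht₀)
  have d2 : MemLp (G t₀ - φ) 2 volume := (hG t₀ ht₀).sub hφm
  have s1 : eLpNorm (fun x => (G t - G t₀) (Function.invFun (X t) x)) 2 volume ≤
      ENNReal.ofReal (ε / 3) := by
    refine ((hX t ht).eLpNorm_comp_invFun_le d1.1).trans ?_
    have h3 : eLpNorm (G t - G t₀) 2 volume ≤ ENNReal.ofReal (|t - t₀|) * eLpNorm k 2 volume := by
      refine eLpNorm_le_mul_eLpNorm_of_ae_le_mul ?_ 2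
      filter_upwards [hGt t₀ ht₀ t ht] with ξ hξ
      exact hξ.trans (mul_le_mul_of_nonneg_left (le_abs_self _) (abs_nonneg _))
    rw [← ENNReal.ofReal_toReal hk.2.ne, ← hK, ← ENNReal.ofReal_mul (abs_nonneg _)] at h3
    rw [lt_div_iff₀ (by positivity)] at h1
    have h4 : |t - t₀| * K ≤ ε / 6 := by
      have := abs_nonneg (t - t₀)
      linarith
    calc 2 * eLpNorm (G t - G t₀) 2 volume ≤ 2 * ENNReal.ofReal (ε / 6) := by
          gcongr
          exact h3.trans (ENNReal.ofReal_le_ofReal h4)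
      _ = ENNReal.ofReal (ε / 3) := by
          rw [← ENNReal.ofReal_ofNat 2, ← ENNReal.ofReal_mul (by norm_num)]
          congr 1
          ring
  have s2 : ∀ s ∈ I, eLpNorm (fun x => (G t₀ - φ) (Function.invFun (X s) x)) 2 volume ≤
      ENNReal.ofReal (ε / 6) := fun s hs => by
    refine ((hX s hs).eLpNorm_comp_invFun_le d2.1).trans ?_
    calc 2 * eLpNorm (G t₀ - φ) 2 volume ≤ 2 * ENNReal.ofReal (ε / 12) := by gcongr
      _ = ENNReal.ofReal (ε / 6) := by
          rw [← ENNReal.ofReal_ofNat 2, ← ENNReal.ofReal_mul (by norm_num)]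
          congr 1
          ring
  have m1 := ((hX t ht).memLp_comp_invFun d1).1
  have m2 := fun s hs => ((hX s hs).memLp_comp_invFun d2).1
  have m3 := ((hX t ht).memLp_comp_invFun hφm).sub ((hX t₀ ht₀).memLp_comp_invFun hφm)
  have e : ((fun x => G t (Function.invFun (X t) x)) - fun x => G t₀ (Function.invFun (X t₀) x)) =
      ((fun x => (G t - G t₀) (Function.invFun (X t) x)) +
        fun x => (G t₀ - φ) (Function.invFun (X t) x)) +
      ((fun x => φ (Function.invFun (X t) x) - φ (Function.invFun (X t₀) x)) -
        fun x => (G t₀ - φ) (Function.invFun (X t₀) x)) := by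
    funext x
    simp only [Pi.sub_apply, Pi.add_apply]
    ring
  rw [e]
  calc _ ≤ (ENNReal.ofReal (ε / 3) + ENNReal.ofReal (ε / 6)) +
        (ENNReal.ofReal (ε / 3) + ENNReal.ofReal (ε / 6)) := by
        refine (eLpNorm_add_le (m1.add (m2 t ht)) (m3.1.sub (m2 t₀ ht₀)) (by norm_num)).trans ?_
        refine add_le_add ((eLpNorm_add_le m1 (m2 t ht) (by norm_num)).trans
          (add_le_add s1 (s2 t ht))) ((eLpNorm_sub_le m3.1 (m2 t₀ ht₀) (by norm_num)).trans
          (add_le_add h2 (s2 t₀ ht₀)))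
    _ = ENNReal.ofReal ε := by
        rw [← ENNReal.ofReal_add (by positivity) (by positivity),
          ← ENNReal.ofReal_add (by positivity) (by positivity)]
        congr 1
        ring

/-- Bounds for a family `Z t ξ`, `0 ≤ t ≤ δ`, by its initial values. -/
structure ProfileBounds {E : Type*} [NormedAddCommGroup E] (δ : ℝ) (Z : ℝ → ℝ → E) (C : ℝ) :
    Prop where
  nonneg : 0 ≤ C
  norm_le : ∀ t ∈ Icc 0 δ, ∀ ξ, ‖Z t ξ‖ ≤ C * ‖Z 0 ξ‖
  norm_sub_time_le : ∀ s ∈ Icc 0 δ, ∀ t ∈ Icc 0 δ, ∀ ξ, ‖Z t ξ - Z s ξ‖ ≤ C * ‖Z 0 ξ‖ * |t - s|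
  norm_sub_le : ∀ t ∈ Icc 0 δ, ∀ ξ η,
    ‖Z t ξ - Z t η‖ ≤ C * (‖Z 0 ξ - Z 0 η‖ + |ξ - η| * ‖Z 0 η‖)
  norm_sub_sub_le : ∀ s ∈ Icc 0 δ, ∀ t ∈ Icc 0 δ, ∀ ξ η, ‖Z t ξ - Z t η - (Z s ξ - Z s η)‖ ≤
    C * (‖Z 0 ξ - Z 0 η‖ + |ξ - η| * ‖Z 0 η‖) * |t - s|

theorem exists_profileBounds {E P : Type*} [NormedAddCommGroup E] [NormedSpace ℝ E]
    [NormedAddCommGroup P] {A : P × E → E →L[ℝ] E} {δ K R L : ℝ}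
    (hδ : 0 ≤ δ) (hδ1 : δ ≤ 1) (hK : 0 ≤ K) (hL : 0 ≤ L) {c : ℝ → ℝ → P} {Z : ℝ → ℝ → E}
    (hA : ∀ q, ‖q‖ ≤ R → ‖A q‖ ≤ K)
    (hA' : ∀ q q', ‖q‖ ≤ R → ‖q'‖ ≤ R → ‖A q - A q'‖ ≤ K * ‖q - q'‖)
    (hq : ∀ t ∈ Icc 0 δ, ∀ ξ, ‖(c t ξ, Z t ξ)‖ ≤ R)
    (hc : ∀ t ∈ Icc 0 δ, ∀ ξ η, ‖c t ξ - c t η‖ ≤ L * |ξ - η|)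
    (hZ : ∀ t ∈ Icc 0 δ, ∀ ξ,
      HasDerivWithinAt (fun s => Z s ξ) (A (c t ξ, Z t ξ) (Z t ξ)) (Icc 0 δ) t) :
    ∃ C, ProfileBounds δ Z C := by
  have hR : 0 ≤ R := (norm_nonneg _).trans (hq 0 ⟨le_rfl, hδ⟩ 0)
  have hexp : ∀ {k t : ℝ}, 0 ≤ k → t ∈ Icc 0 δ → Real.exp (k * t) ≤ Real.exp k :=
    fun hk ht => Real.exp_le_exp.2 (mul_le_of_le_one_right hk (ht.2.trans hδ1))
  have h1 : ∀ t ∈ Icc 0 δ, ∀ ξ, ‖Z t ξ‖ ≤ Real.exp K * ‖Z 0 ξ‖ := fun t ht ξ => by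
    have := norm_le_of_norm_deriv_le (f := fun s => Z s ξ)
      (f' := fun s => A (c s ξ, Z s ξ) (Z s ξ)) (ε := 0) hK le_rfl (fun s hs => hZ s hs ξ) le_rfl
      (fun s hs => by
        rw [add_zero]
        exact (A _).le_of_opNorm_le (hA _ (hq s hs ξ)) _) ht
    rw [zero_mul, add_zero] at this
    have h2 := mul_le_mul_of_nonneg_left (hexp hK ht) (norm_nonneg (Z 0 ξ))
    linarith
  set K₁ := K * (1 + R) with hK₁
  have hK₁0 : 0 ≤ K₁ := by positivity
  set m := K * L * Real.exp K with hm
  have hm0 : 0 ≤ m := by positivity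
  have hdiff : ∀ t ∈ Icc 0 δ, ∀ ξ η, ‖A (c t ξ, Z t ξ) (Z t ξ) - A (c t η, Z t η) (Z t η)‖ ≤
      K₁ * ‖Z t ξ - Z t η‖ + m * (|ξ - η| * ‖Z 0 η‖) := fun t ht ξ η => by
    have e : A (c t ξ, Z t ξ) (Z t ξ) - A (c t η, Z t η) (Z t η) =
        A (c t ξ, Z t ξ) (Z t ξ - Z t η) + (A (c t ξ, Z t ξ) - A (c t η, Z t η)) (Z t η) := by
      simp
    have i1 : ‖A (c t ξ, Z t ξ) (Z t ξ - Z t η)‖ ≤ K * ‖Z t ξ - Z t η‖ :=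
      (A _).le_of_opNorm_le (hA _ (hq t ht ξ)) _
    have i2 : ‖(A (c t ξ, Z t ξ) - A (c t η, Z t η)) (Z t η)‖ ≤
        K * (L * |ξ - η| + ‖Z t ξ - Z t η‖) * ‖Z t η‖ := by
      refine ContinuousLinearMap.le_of_opNorm_le _
        ((hA' _ _ (hq t ht ξ) (hq t ht η)).trans (mul_le_mul_of_nonneg_left ?_ hK)) _
      rw [Prod.norm_def]
      have := hc t ht ξ η
      have := norm_nonneg (Z t ξ - Z t η)
      have : 0 ≤ L * |ξ - η| := by positivity
      refine max_le ?_ ?_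
      · change ‖c t ξ - c t η‖ ≤ _
        linarith
      · change ‖Z t ξ - Z t η‖ ≤ _
        linarith
    have i3 : ‖Z t η‖ ≤ R := (norm_snd_le (c t η, Z t η)).trans (hq t ht η)
    rw [e]
    refine (norm_add_le _ _).trans ((add_le_add i1 i2).trans ?_)
    have i4 : K * L * |ξ - η| * ‖Z t η‖ ≤ K * L * |ξ - η| * (Real.exp K * ‖Z 0 η‖) :=
      mul_le_mul_of_nonneg_left (h1 t ht η) (by positivity)
    have i5 : K * ‖Z t ξ - Z t η‖ * ‖Z t η‖ ≤ K * ‖Z t ξ - Z t η‖ * R :=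
      mul_le_mul_of_nonneg_left i3 (by positivity)
    rw [hK₁, hm]
    linarith
  set C₃ := (1 + m) * Real.exp K₁ with hC₃
  have hC₃0 : 0 ≤ C₃ := by positivity
  have h3 : ∀ t ∈ Icc 0 δ, ∀ ξ η,
      ‖Z t ξ - Z t η‖ ≤ C₃ * (‖Z 0 ξ - Z 0 η‖ + |ξ - η| * ‖Z 0 η‖) := fun t ht ξ η => by
    have hω : 0 ≤ |ξ - η| * ‖Z 0 η‖ := by positivity
    have h0 := norm_nonneg (Z 0 ξ - Z 0 η)
    have := norm_le_of_norm_deriv_le (f := fun s => Z s ξ - Z s η)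
      (f' := fun s => A (c s ξ, Z s ξ) (Z s ξ) - A (c s η, Z s η) (Z s η))
      (ε := m * (|ξ - η| * ‖Z 0 η‖)) hK₁0 (by positivity)
      (fun s hs => (hZ s hs ξ).sub (hZ s hs η)) le_rfl (fun s hs => hdiff s hs ξ η) ht
    refine this.trans ?_
    calc (‖Z 0 ξ - Z 0 η‖ + m * (|ξ - η| * ‖Z 0 η‖) * t) * Real.exp (K₁ * t)
        ≤ (‖Z 0 ξ - Z 0 η‖ + m * (|ξ - η| * ‖Z 0 η‖) * 1) * Real.exp K₁ := by
          have := ht.2.trans hδ1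
          have := hexp hK₁0 ht
          have := ht.1
          gcongr
      _ ≤ _ := by
          rw [hC₃]
          have : 0 ≤ m * ‖Z 0 ξ - Z 0 η‖ * Real.exp K₁ := by positivity
          have : 0 ≤ |ξ - η| * ‖Z 0 η‖ * Real.exp K₁ := by positivity
          linarith
  set C := Real.exp K + K * Real.exp K + C₃ + (K₁ * C₃ + m) with hC
  have n1 : 0 ≤ Real.exp K := (Real.exp_pos _).le
  have n2 : 0 ≤ K * Real.exp K := by positivity
  have n3 : 0 ≤ K₁ * C₃ + m := by positivity
  refine ⟨C, by positivity, fun t ht ξ => (h1 t ht ξ).trans ?_, fun s hs t ht ξ => ?_,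
    fun t ht ξ η => (h3 t ht ξ η).trans ?_, fun s hs t ht ξ η => ?_⟩
  · gcongr
    linarith
  · have := (convex_Icc (0 : ℝ) δ).norm_image_sub_le_of_norm_hasDerivWithin_le
      (C := K * Real.exp K * ‖Z 0 ξ‖) (fun r hr => hZ r hr ξ) (fun r hr => by
        refine ((A _).le_of_opNorm_le (hA _ (hq r hr ξ)) _).trans ?_
        rw [mul_assoc]
        exact mul_le_mul_of_nonneg_left (h1 r hr ξ) hK) hs ht
    refine this.trans ?_
    rw [Real.norm_eq_abs]
    gcongr
    linarith
  · gcongr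
    linarith
  · have hω : 0 ≤ |ξ - η| * ‖Z 0 η‖ := by positivity
    have h0 := norm_nonneg (Z 0 ξ - Z 0 η)
    have := (convex_Icc (0 : ℝ) δ).norm_image_sub_le_of_norm_hasDerivWithin_le
      (f := fun r => Z r ξ - Z r η)
      (C := (K₁ * C₃ + m) * (‖Z 0 ξ - Z 0 η‖ + |ξ - η| * ‖Z 0 η‖))
      (fun r hr => (hZ r hr ξ).sub (hZ r hr η)) (fun r hr => by
        refine (hdiff r hr ξ η).trans ?_
        have := mul_le_mul_of_nonneg_left (h3 r hr ξ η) hK₁0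
        have : 0 ≤ m * ‖Z 0 ξ - Z 0 η‖ := by positivity
        linarith) hs ht
    refine this.trans ?_
    rw [Real.norm_eq_abs]
    gcongr
    linarith

theorem norm_deriv_le_of_norm_sub_le {E F : Type*} [NormedAddCommGroup E] [NormedSpace ℝ E]
    [NormedAddCommGroup F] [NormedSpace ℝ F] {f : ℝ → E} {g : ℝ → F} {f' : E} {g' : F} {η C k : ℝ}
    (hf : HasDerivAt f f' η) (hg : HasDerivAt g g' η)
    (h : ∀ ξ, ‖f ξ - f η‖ ≤ C * (‖g ξ - g η‖ + |ξ - η| * k)) : ‖f'‖ ≤ C * (‖g'‖ + k) := by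
  have h1 := (hasDerivAt_iff_tendsto_slope.1 hf).norm
  have h2 := ((hasDerivAt_iff_tendsto_slope.1 hg).norm.add_const k).const_mul C
  refine le_of_tendsto_of_tendsto h1 h2 ?_
  filter_upwards [self_mem_nhdsWithin] with ξ hξ
  have hpos : 0 < |ξ - η| := abs_pos.2 (sub_ne_zero.2 hξ)
  rw [slope_def_module, slope_def_module, norm_smul, norm_smul, norm_inv, Real.norm_eq_abs]
  calc |ξ - η|⁻¹ * ‖f ξ - f η‖ ≤ |ξ - η|⁻¹ * (C * (‖g ξ - g η‖ + |ξ - η| * k)) := by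
        gcongr
        exact h ξ
    _ = _ := by
        field_simp

/-- The coefficient matrix of the system for density and slope along a characteristic, as a
function of the potential, the nonlocal part of its slope and the derivative of the latter, and of
density and slope. -/
noncomputable def profileMap (κ : ℝ) (q : (ℝ × ℝ × ℝ) × (ℝ × ℝ)) : ℝ × ℝ →L[ℝ] ℝ × ℝ :=
  planeMap (-(Real.exp q.1.1 * ((1 - q.2.1) * (2 * κ * q.2.1 + q.1.2.1)))) 0
    (-(Real.exp q.1.1 * ((1 - q.2.1) * ((2 * κ * q.2.1 + q.1.2.1) ^ 2 + q.1.2.2))))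
    (Real.exp q.1.1 * (2 * q.2.2 - (2 * (1 - 2 * q.2.1) * (2 * κ * q.2.1 + q.1.2.1) +
      2 * κ * (q.2.1 * (1 - q.2.1)))))

theorem contDiff_profileMap (κ : ℝ) : ContDiff ℝ 1 (profileMap κ) := by
  unfold profileMap planeMap
  fun_prop

theorem abs_potentialCurv_sub_le {γa γb ℓ : ℝ} {w : ℝ → ℝ}
    (h : ∀ x x', |w x - w x'| ≤ ℓ * |x - x'|) (x x' : ℝ) :
    |potentialCurv γa γb w x - potentialCurv γa γb w x'| ≤
      (2 / γa ^ 2 + 2 / γb ^ 2) * (2 * ℓ) * |x - x'| := by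
  unfold potentialCurv
  have h1 := h (x + γa) (x' + γa)
  have h2 := h x x'
  have h3 := h (x - γb) (x' - γb)
  rw [add_sub_add_right_eq_sub] at h1
  rw [sub_sub_sub_cancel_right] at h3
  have e1 : |w (x + γa) - w x - (w (x' + γa) - w x')| ≤ 2 * ℓ * |x - x'| := by
    rw [show w (x + γa) - w x - (w (x' + γa) - w x') =
      w (x + γa) - w (x' + γa) - (w x - w x') by ring]
    exact (abs_sub _ _).trans (by linarith)
  have e2 : |w x - w (x - γb) - (w x' - w (x' - γb))| ≤ 2 * ℓ * |x - x'| := by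
    rw [show w x - w (x - γb) - (w x' - w (x' - γb)) =
      w x - w x' - (w (x - γb) - w (x' - γb)) by ring]
    exact (abs_sub _ _).trans (by linarith)
  have p1 : 0 ≤ 2 / γa ^ 2 := by positivity
  have p2 : 0 ≤ 2 / γb ^ 2 := by positivity
  calc _ = |-(2 / γa ^ 2) * (w (x + γa) - w x - (w (x' + γa) - w x')) -
        2 / γb ^ 2 * (w x - w (x - γb) - (w x' - w (x' - γb)))| := by
        congr 1
        ring
    _ ≤ 2 / γa ^ 2 * (2 * ℓ * |x - x'|) + 2 / γb ^ 2 * (2 * ℓ * |x - x'|) := by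
        refine (abs_sub _ _).trans (add_le_add ?_ ?_)
        · rw [abs_mul, abs_neg, abs_of_nonneg p1]
          exact mul_le_mul_of_nonneg_left e1 p1
        · rw [abs_mul, abs_of_nonneg p2]
          exact mul_le_mul_of_nonneg_left e2 p2
    _ = _ := by ring

theorem SelfFlow.exists_profileBounds {γa γb δ Λ M : ℝ} {u₀ : ℝ → ℝ} {a : ℝ → ℝ → ℝ}
    {y : ℝ → ℝ → ℝ × ℝ} {p D : ℝ → ℝ → ℝ} (S : SelfFlow γa γb δ Λ M u₀ a y)
    (F : SlopeFlow γa γb δ Λ u₀ a y p D) :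
    ∃ C, ProfileBounds δ (fun t ξ => ((y t ξ).2, D t ξ)) C := by
  have hκ := kap_pos S.posA S.posB
  set κ := kap γa γb with hκdef
  have hΛ := S.lip_nonneg
  set r : ℝ := 2 / γa ^ 2 + 2 / γb ^ 2 with hr
  have hr0 : 0 ≤ r := by positivity
  set R : ℝ := 4 + 2 * κ + r + 2 * Λ with hR
  have hR0 : 0 ≤ R := by positivity
  obtain ⟨K₀, hK₀⟩ := (contDiff_profileMap κ).exists_lipschitzOnWith_closedBall R
  obtain ⟨M₀, hM₀⟩ := (isCompact_closedBall (0 : (ℝ × ℝ × ℝ) × (ℝ × ℝ)) R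
    ).exists_bound_of_continuousOn
    (contDiff_profileMap κ).continuous.continuousOn
  set K : ℝ := max M₀ K₀
  have hK : 0 ≤ K := K₀.2.trans (le_max_right _ _)
  set c : ℝ → ℝ → ℝ × ℝ × ℝ := fun t ξ => (potential γa γb (a t) (y t ξ).1,
    potentialRem γa γb (a t) (y t ξ).1, potentialCurv γa γb (a t) (y t ξ).1) with hc
  have hX : ∀ t ∈ Icc 0 δ, ∀ ξ η, |(y t ξ).1 - (y t η).1| ≤ Λ * |ξ - η| := fun t ht ξ η =>
    (norm_fst_le (y t ξ - y t η)).trans (S.lip t ht ξ η)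
  set ℓ : ℝ := 2 * κ + r + r * (2 * (2 * Λ)) with hℓ
  have hℓ0 : 0 ≤ ℓ := by positivity
  have hℓ1 : 2 * κ ≤ ℓ := by
    have : 0 ≤ r * (2 * (2 * Λ)) := by positivity
    linarith
  have hℓ2 : r ≤ ℓ := by
    have : 0 ≤ r * (2 * (2 * Λ)) := by positivity
    linarith
  have hℓ3 : r * (2 * (2 * Λ)) ≤ ℓ := by linarith
  refine _root_.exists_profileBounds (A := profileMap κ) (c := c) (K := K) (R := R)
    (L := ℓ * Λ) S.pos.le S.le_one hK (by positivity) (fun q hq =>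
      (hM₀ q (by simpa using hq)).trans (le_max_left _ _)) (fun q q' hq hq' => ?_)
    (fun t ht ξ => ?_) (fun t ht ξ η => ?_) (fun t ht ξ => ?_)
  · have := hK₀.dist_le_mul q (by simpa using hq) q' (by simpa using hq')
    rw [dist_eq_norm, dist_eq_norm] at this
    exact this.trans (mul_le_mul_of_nonneg_right (le_max_right _ _) (norm_nonneg _))
  · have hm := S.density.mem t
    have h1 : ∀ x, |a t x| ≤ 1 := fun x => abs_le.2 ⟨by linarith [(hm x).1], (hm x).2⟩
    have h2 := abs_potential_le S.posA S.posB h1 (y t ξ).1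
    have h3 := abs_potentialRem_le S.posA S.posB h1 (y t ξ).1
    have h4 := abs_potentialCurv_le (γa := γa) (γb := γb) hm (y t ξ).1
    have h5 := S.flow.mem ξ t ht
    have h6 : |(y t ξ).2| ≤ 1 := abs_le.2 ⟨by linarith, by linarith⟩
    have h7 := F.abs_le t ht ξ
    simp only [hc, Prod.norm_def, Real.norm_eq_abs]
    exact max_le (max_le (by linarith) (max_le (by linarith) (by linarith)))
      (max_le (by linarith) (by linarith))
  · have hm := S.density.mem t
    have hw := S.density.continuous_apply t
    have e1 := abs_sub_le_of_hasDerivAt (hasDerivAt_potential S.posA S.posB hw)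
      (abs_slope_le S.posA S.posB hm) (y t ξ).1 (y t η).1
    have e2 := abs_sub_le_of_hasDerivAt (hasDerivAt_potentialRem (γa := γa) (γb := γb) hw)
      (abs_potentialCurv_le hm) (y t ξ).1 (y t η).1
    have e3 := abs_potentialCurv_sub_le (γa := γa) (γb := γb) (S.abs_sub_le ht) (y t ξ).1 (y t η).1
    have e4 : ∀ b, 0 ≤ b → b ≤ ℓ → b * |(y t ξ).1 - (y t η).1| ≤ ℓ * Λ * |ξ - η| :=
      fun b hb hbℓ => by
      rw [mul_assoc]
      exact mul_le_mul hbℓ (hX t ht ξ η) (abs_nonneg _) hℓ0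
    simp only [hc, Prod.norm_def, Prod.fst_sub, Prod.snd_sub, Real.norm_eq_abs]
    exact max_le (e1.trans (e4 _ (by positivity) hℓ1)) (max_le (e2.trans (e4 _ (by positivity) hℓ2))
      (e3.trans (e4 _ (by positivity) hℓ3)))
  · refine ((S.flow.deriv ξ t ht).snd.prodMk (F.deriv_slope t ht ξ)).congr_deriv ?_
    rw [profileMap, planeMap_apply, Prod.mk.injEq]
    unfold slopeRate charField charRate
    constructor
    · simp only [hc]
      ring
    · simp only [hc]
      ring

section

variable {γa γb δ Λ M C : ℝ} {u₀ : ℝ → ℝ} {a : ℝ → ℝ → ℝ} {y : ℝ → ℝ → ℝ × ℝ} {p D : ℝ → ℝ → ℝ}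

theorem SlopeFlow.profile_zero (S : SelfFlow γa γb δ Λ M u₀ a y)
    (F : SlopeFlow γa γb δ Λ u₀ a y p D) (ξ : ℝ) : ((y 0 ξ).2, D 0 ξ) = (u₀ ξ, deriv u₀ ξ) := by
  rw [S.flow.initial, F.initial]

theorem SlopeFlow.abs_slope_sub_le (S : SelfFlow γa γb δ Λ M u₀ a y)
    (F : SlopeFlow γa γb δ Λ u₀ a y p D) (B : ProfileBounds δ (fun t ξ => ((y t ξ).2, D t ξ)) C)
    (hu : IsH2 u₀) : ∃ C', ∀ t ∈ Icc 0 δ, ∀ ξ η,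
      |D t η - D t ξ| ≤ C' * (|η - ξ| + |deriv u₀ η - deriv u₀ ξ|) := by
  obtain ⟨b, hb⟩ := hu.exists_abs_le
  have hb0 : 0 ≤ b := (abs_nonneg _).trans (hb 0).1
  have hC := B.nonneg
  refine ⟨C * (2 * b + 1), fun t ht ξ η => ?_⟩
  have h1 := (norm_snd_le _).trans (B.norm_sub_le t ht η ξ)
  simp only [F.profile_zero S, Prod.norm_def, Prod.fst_sub, Prod.snd_sub, Real.norm_eq_abs] at h1
  have h2 : |u₀ η - u₀ ξ| ≤ b * |η - ξ| :=
    abs_sub_le_of_hasDerivAt (fun x => (hu.differentiable x).hasDerivAt) (fun x => (hb x).2) η ξ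
  have n1 := abs_nonneg (η - ξ)
  have n2 := abs_nonneg (deriv u₀ η - deriv u₀ ξ)
  have h3 : max |u₀ η - u₀ ξ| |deriv u₀ η - deriv u₀ ξ| ≤
      b * |η - ξ| + |deriv u₀ η - deriv u₀ ξ| :=
    max_le (by linarith) (by nlinarith)
  have h4 : |η - ξ| * max |u₀ ξ| |deriv u₀ ξ| ≤ |η - ξ| * b :=
    mul_le_mul_of_nonneg_left (max_le (hb ξ).1 (hb ξ).2) n1
  refine h1.trans ?_
  rw [mul_assoc]
  refine mul_le_mul_of_nonneg_left ?_ hC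
  nlinarith

theorem SlopeFlow.isLocAC (S : SelfFlow γa γb δ Λ M u₀ a y)
    (F : SlopeFlow γa γb δ Λ u₀ a y p D) (B : ProfileBounds δ (fun t ξ => ((y t ξ).2, D t ξ)) C)
    (hu : IsH2 u₀) {t : ℝ} (ht : t ∈ Icc 0 δ) : IsLocAC (D t) := by
  obtain ⟨C', hC'⟩ := F.abs_slope_sub_le S B hu
  exact IsLocAC.of_abs_sub_le hu.deriv_ac fun ξ η => hC' t ht ξ η

/-- The dominating function for the second derivatives. -/
noncomputable def h2Bound (u₀ : ℝ → ℝ) (ξ : ℝ) : ℝ :=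
  |u₀ ξ| + 2 * |deriv u₀ ξ| + |deriv (deriv u₀) ξ|

theorem IsH2.memLp_h2Bound (hu : IsH2 u₀) : MemLp (h2Bound u₀) 2 volume :=
  (hu.memLp.abs.add (hu.memLp_deriv.abs.const_mul 2)).add hu.memLp_deriv2.abs

theorem norm_le_h2Bound (u₀ : ℝ → ℝ) (ξ : ℝ) : ‖(u₀ ξ, deriv u₀ ξ)‖ ≤ h2Bound u₀ ξ := by
  unfold h2Bound
  have h1 := abs_nonneg (u₀ ξ)
  have h2 := abs_nonneg (deriv u₀ ξ)
  have h3 := abs_nonneg (deriv (deriv u₀) ξ)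
  rw [Prod.norm_def, Real.norm_eq_abs, Real.norm_eq_abs]
  exact max_le (by linarith) (by linarith)

theorem norm_add_norm_le_h2Bound (u₀ : ℝ → ℝ) (ξ : ℝ) :
    ‖(deriv u₀ ξ, deriv (deriv u₀) ξ)‖ + ‖(u₀ ξ, deriv u₀ ξ)‖ ≤ h2Bound u₀ ξ := by
  unfold h2Bound
  have h1 := abs_nonneg (u₀ ξ)
  have h2 := abs_nonneg (deriv u₀ ξ)
  have h3 := abs_nonneg (deriv (deriv u₀) ξ)
  simp only [Prod.norm_def, Real.norm_eq_abs]
  have e1 : max |deriv u₀ ξ| |deriv (deriv u₀) ξ| ≤ |deriv u₀ ξ| + |deriv (deriv u₀) ξ| :=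
    max_le (by linarith) (by linarith)
  have e2 : max |u₀ ξ| |deriv u₀ ξ| ≤ |u₀ ξ| + |deriv u₀ ξ| := max_le (by linarith) (by linarith)
  linarith

theorem SlopeFlow.ae_abs_deriv_slope_le (S : SelfFlow γa γb δ Λ M u₀ a y)
    (F : SlopeFlow γa γb δ Λ u₀ a y p D) (B : ProfileBounds δ (fun t ξ => ((y t ξ).2, D t ξ)) C)
    (hu : IsH2 u₀) {s t : ℝ} (hs : s ∈ Icc 0 δ) (ht : t ∈ Icc 0 δ) :
    ∀ᵐ ξ, |deriv (D t) ξ| ≤ C * h2Bound u₀ ξ ∧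
      |deriv (D t) ξ - deriv (D s) ξ| ≤ |t - s| * (C * h2Bound u₀ ξ) := by
  filter_upwards [hu.deriv_ac.ae_differentiableAt, (F.isLocAC S B hu ht).ae_differentiableAt,
    (F.isLocAC S B hu hs).ae_differentiableAt] with ξ h0 h1 h2
  have hg : HasDerivAt (fun ξ => (u₀ ξ, deriv u₀ ξ)) (deriv u₀ ξ, deriv (deriv u₀) ξ) ξ :=
    (hu.differentiable ξ).hasDerivAt.prodMk h0.hasDerivAt
  have hC := B.nonneg
  have hk := norm_add_norm_le_h2Bound u₀ ξ
  constructor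
  · have := norm_deriv_le_of_norm_sub_le (C := C) (k := ‖(u₀ ξ, deriv u₀ ξ)‖) h1.hasDerivAt hg
      (fun η => by
        have := (norm_snd_le _).trans (B.norm_sub_le t ht η ξ)
        simp only [F.profile_zero S, Prod.snd_sub] at this
        exact this)
    exact this.trans (mul_le_mul_of_nonneg_left hk hC)
  · have := norm_deriv_le_of_norm_sub_le (f := fun η => D t η - D s η) (C := C * |t - s|)
      (k := ‖(u₀ ξ, deriv u₀ ξ)‖) (h1.hasDerivAt.sub h2.hasDerivAt) hg (fun η => by
        have := (norm_snd_le _).trans (B.norm_sub_sub_le s hs t ht η ξ)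
        simp only [F.profile_zero S, Prod.snd_sub] at this
        calc _ = ‖D t η - D t ξ - (D s η - D s ξ)‖ := by congr 1; ring
          _ ≤ _ := this
          _ = _ := by ring)
    refine this.trans ?_
    calc _ ≤ C * |t - s| * h2Bound u₀ ξ := mul_le_mul_of_nonneg_left hk (by positivity)
      _ = _ := by ring

theorem SlopeFlow.exists_abs_stretch_sub_le (S : SelfFlow γa γb δ Λ M u₀ a y)
    (F : SlopeFlow γa γb δ Λ u₀ a y p D) : ∃ P, 0 ≤ P ∧ ∀ s ∈ Icc 0 δ, ∀ t ∈ Icc 0 δ, ∀ ξ,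
      |p t ξ - p s ξ| ≤ P * |t - s| := by
  have hκ := kap_pos S.posA S.posB
  have hΛ := S.lip_nonneg
  refine ⟨Real.exp 4 * (2 * kap γa γb + 4 * Λ) * (3 / 2), by positivity, fun s hs t ht ξ => ?_⟩
  have := (convex_Icc (0 : ℝ) δ).norm_image_sub_le_of_norm_hasDerivWithin_le
    (fun r hr => F.deriv_stretch r hr ξ) (C := Real.exp 4 * (2 * kap γa γb + 4 * Λ) * (3 / 2))
    (fun r hr => ?_) hs ht
  · exact this
  have hm := S.density.mem r
  have h1 : ∀ x, |a r x| ≤ 1 := fun x => _root_.abs_le.2 ⟨by linarith [(hm x).1], (hm x).2⟩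
  have h2 := (_root_.abs_le.1 (abs_potential_le S.posA S.posB h1 (y r ξ).1)).2
  have h3 := abs_slope_le S.posA S.posB hm (y r ξ).1
  rw [S.consistent r hr] at h3
  have h4 := S.flow.mem ξ r hr
  have h5 : |1 - 2 * (y r ξ).2| ≤ 1 := _root_.abs_le.2 ⟨by linarith, by linarith⟩
  have h6 := F.abs_le r hr ξ
  have h7 : |p r ξ| ≤ 3 / 2 := _root_.abs_le.2 ⟨by linarith [F.half_le r hr ξ], F.le r hr ξ⟩
  have h8 : |(1 - 2 * (y r ξ).2) * (2 * kap γa γb * (y r ξ).2 +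
      potentialRem γa γb (a r) (y r ξ).1)| ≤ 2 * kap γa γb := by
    rw [abs_mul]
    calc _ ≤ 1 * (2 * kap γa γb) := mul_le_mul h5 h3 (abs_nonneg _) zero_le_one
      _ = _ := one_mul _
  rw [Real.norm_eq_abs, abs_mul, abs_mul, Real.abs_exp]
  refine mul_le_mul (mul_le_mul (Real.exp_le_exp.2 (by linarith)) ?_ (abs_nonneg _)
    (Real.exp_pos _).le) h7 (abs_nonneg _) (by positivity)
  refine (abs_sub _ _).trans ?_
  rw [abs_mul 2, abs_two]
  linarith

theorem SlopeFlow.deriv_eq (S : SelfFlow γa γb δ Λ M u₀ a y)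
    (F : SlopeFlow γa γb δ Λ u₀ a y p D) {t : ℝ} (ht : t ∈ Icc 0 δ) :
    Differentiable ℝ (a t) ∧
      deriv (a t) = fun x => D t (Function.invFun (fun ξ => (y t ξ).1) x) := by
  have h : ∀ x, HasDerivAt (a t) (D t (Function.invFun (fun ξ => (y t ξ).1) x)) x := fun x => by
    have := F.hasDerivAt_density t ht (Function.invFun (fun ξ => (y t ξ).1) x)
    rwa [(S.near t ht).apply_invFun x] at this
  exact ⟨fun x => (h x).differentiableAt, funext fun x => (h x).deriv⟩

theorem SlopeFlow.deriv_deriv_eq (S : SelfFlow γa γb δ Λ M u₀ a y)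
    (F : SlopeFlow γa γb δ Λ u₀ a y p D) {t : ℝ} (ht : t ∈ Icc 0 δ) :
    deriv (deriv (a t)) = fun x => deriv (D t) (Function.invFun (fun ξ => (y t ξ).1) x) /
      p t (Function.invFun (fun ξ => (y t ξ).1) x) := by
  funext x
  rw [(F.deriv_eq S ht).2]
  set ξ := Function.invFun (fun ξ => (y t ξ).1) x
  have hX := F.hasDerivAt_pos t ht ξ
  have hp : p t ξ ≠ 0 := fun h => by
    have := F.half_le t ht ξ
    rw [h] at this
    norm_num at this
  have hY := (S.near t ht).hasDerivAt_invFun hX hp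
  by_cases hD : DifferentiableAt ℝ (D t) ξ
  · exact (hD.hasDerivAt.comp x hY).deriv
  · rw [deriv_zero_of_not_differentiableAt hD, zero_div]
    refine deriv_zero_of_not_differentiableAt fun h => hD ?_
    have h2 : DifferentiableAt ℝ (fun x => D t (Function.invFun (fun ξ => (y t ξ).1) x))
        ((fun ξ => (y t ξ).1) ξ) := by
      rw [show (fun ξ => (y t ξ).1) ξ = x from (S.near t ht).apply_invFun x]
      exact h
    have h3 := h2.comp ξ hX.differentiableAt
    have e : (fun x => D t (Function.invFun (fun ξ => (y t ξ).1) x)) ∘ (fun ξ => (y t ξ).1) =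
        D t := funext fun η => congrArg (D t) ((S.near t ht).invFun_apply η)
    rwa [e] at h3

theorem SelfFlow.continuousInH2 (S : SelfFlow γa γb δ Λ M u₀ a y)
    (F : SlopeFlow γa γb δ Λ u₀ a y p D) (hu : IsH2 u₀) : ContinuousInH2 (Icc 0 δ) a := by
  obtain ⟨C, B⟩ := S.exists_profileBounds F
  obtain ⟨P, hP, hp⟩ := F.exists_abs_stretch_sub_le S
  have hC := B.nonneg
  have hk := hu.memLp_h2Bound
  have hk0 : ∀ ξ, 0 ≤ h2Bound u₀ ξ := fun ξ => (norm_nonneg _).trans (norm_le_h2Bound u₀ ξ)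
  have hXt : ∀ s ∈ Icc 0 δ, ∀ t ∈ Icc 0 δ, ∀ ξ, |(y t ξ).1 - (y s ξ).1| ≤ M * |t - s| :=
    fun s hs t ht ξ => (norm_fst_le (y t ξ - y s ξ)).trans (S.speed s hs t ht ξ)
  have bZ : ∀ t ∈ Icc 0 δ, ∀ ξ, ‖((y t ξ).2, D t ξ)‖ ≤ C * h2Bound u₀ ξ := fun t ht ξ => by
    refine (B.norm_le t ht ξ).trans ?_
    rw [F.profile_zero S]
    exact mul_le_mul_of_nonneg_left (norm_le_h2Bound u₀ ξ) hC
  have dZ : ∀ s ∈ Icc 0 δ, ∀ t ∈ Icc 0 δ, ∀ ξ,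
      ‖((y t ξ).2, D t ξ) - ((y s ξ).2, D s ξ)‖ ≤ |t - s| * (C * h2Bound u₀ ξ) :=
    fun s hs t ht ξ => by
    refine (B.norm_sub_time_le s hs t ht ξ).trans ?_
    rw [F.profile_zero S, mul_comm |t - s|]
    have := norm_le_h2Bound u₀ ξ
    gcongr
  have mem : ∀ {G : ℝ → ℝ}, AEStronglyMeasurable G volume → ∀ c : ℝ,
      (∀ᵐ ξ, |G ξ| ≤ c * h2Bound u₀ ξ) → MemLp G 2 volume := fun hG c h =>
    hk.of_le_mul hG (c := c) (h.mono fun ξ hξ => by rwa [Real.norm_of_nonneg (hk0 ξ)])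
  have m0 : ∀ t ∈ Icc 0 δ, MemLp (fun ξ => (y t ξ).2) 2 volume := fun t ht => by
    have hcont : Continuous fun ξ => (y t ξ).2 :=
      (LipschitzWith.of_dist_le_mul (K := ⟨Λ, S.lip_nonneg⟩) fun ξ η => by
        rw [dist_eq_norm]
        exact (norm_snd_le (y t ξ - y t η)).trans (S.lip t ht ξ η)).continuous
    exact mem hcont.aestronglyMeasurable C
      (Eventually.of_forall fun ξ => (norm_fst_le _).trans (bZ t ht ξ))
  have m1 : ∀ t ∈ Icc 0 δ, MemLp (D t) 2 volume := fun t ht =>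
    mem (F.isLocAC S B hu ht).continuous.aestronglyMeasurable C
      (Eventually.of_forall fun ξ => (norm_snd_le _).trans (bZ t ht ξ))
  have m2 : ∀ t ∈ Icc 0 δ, MemLp (fun ξ => deriv (D t) ξ / p t ξ) 2 volume := fun t ht => by
    have e : p t = deriv fun ξ => (y t ξ).1 := funext fun ξ => (F.hasDerivAt_pos t ht ξ).deriv.symm
    have hmeas : Measurable fun ξ => deriv (D t) ξ / p t ξ := by
      rw [e]
      exact (measurable_deriv _).div (measurable_deriv _)
    refine mem hmeas.aestronglyMeasurable (2 * C) ?_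
    filter_upwards [F.ae_abs_deriv_slope_le S B hu ht ht] with ξ hξ
    have h1 := F.half_le t ht ξ
    rw [abs_div, abs_of_pos (by linarith : 0 < p t ξ), div_le_iff₀ (by linarith)]
    have h2 : 0 ≤ C * h2Bound u₀ ξ := mul_nonneg hC (hk0 ξ)
    nlinarith [hξ.1]
  have hc0 := continuousOn_l2Class_comp_invFun S.near S.speed_nonneg hXt m0 (hk.const_mul C)
    (fun s hs t ht => Eventually.of_forall fun ξ => (norm_fst_le _).trans (dZ s hs t ht ξ))
  have hc1 := continuousOn_l2Class_comp_invFun S.near S.speed_nonneg hXt m1 (hk.const_mul C)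
    (fun s hs t ht => Eventually.of_forall fun ξ => (norm_snd_le _).trans (dZ s hs t ht ξ))
  have hc2 := continuousOn_l2Class_comp_invFun S.near S.speed_nonneg hXt m2
    (hk.const_mul (2 * C + 4 * (P * C))) (fun s hs t ht => by
      filter_upwards [F.ae_abs_deriv_slope_le S B hu hs ht,
        F.ae_abs_deriv_slope_le S B hu ht hs] with ξ h1 h2
      have q1 := F.half_le t ht ξ
      have q2 := F.half_le s hs ξ
      have q3 := hp s hs t ht ξ
      have hpt : 0 < p t ξ := by linarith
      have hps : 0 < p s ξ := by linarith
      have hn : 0 ≤ C * h2Bound u₀ ξ := mul_nonneg hC (hk0 ξ)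
      have ha := abs_nonneg (t - s)
      have e : deriv (D t) ξ / p t ξ - deriv (D s) ξ / p s ξ =
          (deriv (D t) ξ - deriv (D s) ξ) * (p t ξ)⁻¹ -
            deriv (D s) ξ * (p t ξ - p s ξ) * ((p t ξ)⁻¹ * (p s ξ)⁻¹) := by
        field_simp
        ring
      have i1 : (p t ξ)⁻¹ ≤ 2 := by
        rw [inv_le_comm₀ hpt (by norm_num)]
        linarith
      have i2 : (p s ξ)⁻¹ ≤ 2 := by
        rw [inv_le_comm₀ hps (by norm_num)]
        linarith
      have j1 : 0 ≤ (p t ξ)⁻¹ := by positivity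
      have j2 : 0 ≤ (p s ξ)⁻¹ := by positivity
      rw [e]
      refine (abs_sub _ _).trans ?_
      rw [abs_mul, abs_mul, abs_mul, abs_mul, abs_of_nonneg j1, abs_of_nonneg j2]
      have k1 : |deriv (D t) ξ - deriv (D s) ξ| * (p t ξ)⁻¹ ≤
          |t - s| * (C * h2Bound u₀ ξ) * 2 :=
        mul_le_mul h1.2 i1 j1 (by positivity)
      have k2 : |deriv (D s) ξ| * |p t ξ - p s ξ| * ((p t ξ)⁻¹ * (p s ξ)⁻¹) ≤
          C * h2Bound u₀ ξ * (P * |t - s|) * (2 * 2) :=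
        mul_le_mul (mul_le_mul h2.1 q3 (abs_nonneg _) hn) (mul_le_mul i1 i2 j2 (by norm_num))
          (by positivity) (by positivity)
      refine (add_le_add k1 k2).trans (le_of_eq ?_)
      ring)
  have e0 : ∀ t ∈ Icc 0 δ, a t = fun x => (y t (Function.invFun (fun ξ => (y t ξ).1) x)).2 :=
    fun t ht => S.eq_carried ht
  have e1 := fun t ht => (F.deriv_eq S (t := t) ht).2
  have e2 := fun t ht => F.deriv_deriv_eq S (t := t) ht
  refine (continuousInH2_iff fun t _ => S.density.continuous_apply t).2
    ⟨fun t ht => ⟨(F.deriv_eq S ht).1, ?_, ?_, ?_, ?_⟩, hc0.congr fun t ht => ?_,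
      hc1.congr fun t ht => ?_, hc2.congr fun t ht => ?_⟩
  · rw [e1 t ht]
    exact (F.isLocAC S B hu ht).comp_monotone_lipschitz (S.near t ht).monotone_invFun
      fun x x' => (S.near t ht).abs_invFun_sub_le x' x
  · rw [e0 t ht]
    exact (S.near t ht).memLp_comp_invFun (m0 t ht)
  · rw [e1 t ht]
    exact (S.near t ht).memLp_comp_invFun (m1 t ht)
  · rw [e2 t ht]
    exact (S.near t ht).memLp_comp_invFun (m2 t ht)
  · rw [e0 t ht]
  · rw [e1 t ht]
  · rw [e2 t ht]

end

section

variable {γa γb δ Λ M C : ℝ} {u₀ : ℝ → ℝ} {a : ℝ → ℝ → ℝ} {y : ℝ → ℝ → ℝ × ℝ} {p D : ℝ → ℝ → ℝ}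

theorem SlopeFlow.eventually_abs_deriv_sub_le (S : SelfFlow γa γb δ Λ M u₀ a y)
    (F : SlopeFlow γa γb δ Λ u₀ a y p D) (hu : IsH2 u₀) {t : ℝ} (ht : t ∈ Icc 0 δ) (ξ : ℝ) {ε : ℝ}
    (hε : 0 < ε) : ∀ᶠ s in 𝓝[Icc 0 δ] t, ∀ x, |x - (y t ξ).1| ≤ M * |s - t| →
      |deriv (a s) x - D t ξ| ≤ ε := by
  obtain ⟨C, B⟩ := S.exists_profileBounds F
  obtain ⟨b, hb⟩ := hu.exists_abs_le
  have hb0 : 0 ≤ b := (abs_nonneg _).trans (hb 0).1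
  have hC := B.nonneg
  have hM := S.speed_nonneg
  have hcont : Continuous (D t) := (F.isLocAC S B hu ht).continuous
  obtain ⟨ρ, hρ, hDρ⟩ := Metric.continuous_iff.1 hcont ξ (ε / 2) (by positivity)
  have e1 : ∀ᶠ s in 𝓝[Icc 0 δ] t, |s - t| < min (ρ / (4 * M + 1)) (ε / (2 * (C * b) + 1)) := by
    have : ∀ᶠ s in 𝓝 t, dist s t < min (ρ / (4 * M + 1)) (ε / (2 * (C * b) + 1)) :=
      Metric.ball_mem_nhds t (lt_min (by positivity) (by positivity))
    exact this.filter_mono nhdsWithin_le_nhds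
  filter_upwards [e1, self_mem_nhdsWithin] with s h1 hs x hx
  have h1a := h1.trans_le (min_le_left _ _)
  have h1b := h1.trans_le (min_le_right _ _)
  rw [lt_div_iff₀ (by positivity)] at h1a h1b
  have hst := abs_nonneg (s - t)
  rw [(F.deriv_eq S hs).2]
  set η := Function.invFun (fun ξ => (y s ξ).1) x with hη
  have h2 : |η - ξ| < ρ := by
    have i1 := (S.near s hs).le_abs_sub η ξ
    have i2 : (y s η).1 = x := (S.near s hs).apply_invFun x
    have i3 := (norm_fst_le (y s ξ - y t ξ)).trans (S.speed t ht s hs ξ)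
    rw [Real.norm_eq_abs, Prod.fst_sub] at i3
    simp only [i2] at i1
    have i4 := abs_sub_le x (y t ξ).1 (y s ξ).1
    rw [abs_sub_comm (y t ξ).1] at i4
    nlinarith
  have h3 := (hDρ η h2).le
  rw [Real.dist_eq] at h3
  have h4 := (norm_snd_le _).trans (B.norm_sub_time_le t ht s hs η)
  have h5 : ‖(u₀ η, deriv u₀ η)‖ ≤ b := by
    rw [Prod.norm_def]
    exact max_le (hb η).1 (hb η).2
  rw [F.profile_zero S, Prod.snd_sub, Real.norm_eq_abs] at h4
  have h6 : C * ‖(u₀ η, deriv u₀ η)‖ * |s - t| ≤ C * b * |s - t| := by gcongr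
  have h7 := abs_sub_le (D s η) (D t η) (D t ξ)
  change |D s η - D t ξ| ≤ ε
  simp only at h4
  nlinarith

theorem SlopeFlow.hasDerivWithinAt_density (S : SelfFlow γa γb δ Λ M u₀ a y)
    (F : SlopeFlow γa γb δ Λ u₀ a y p D) (hu : IsH2 u₀) {t : ℝ} (ht : t ∈ Icc 0 δ) (ξ : ℝ) :
    HasDerivWithinAt (fun s => a s (y t ξ).1)
      (-(Real.exp (potential γa γb (a t) (y t ξ).1) * ((1 - 2 * (y t ξ).2) * D t ξ +
        (y t ξ).2 * (1 - (y t ξ).2) * (2 * kap γa γb * (y t ξ).2 +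
          potentialRem γa γb (a t) (y t ξ).1)))) (Icc 0 δ) t := by
  have hM := S.speed_nonneg
  have h1 := (S.flow.deriv ξ t ht).snd.fun_sub
    (((S.flow.deriv ξ t ht).fst.sub_const (y t ξ).1).const_mul (D t ξ))
  have h2 : HasDerivWithinAt
      (fun s => a s (y t ξ).1 - ((y s ξ).2 - D t ξ * ((y s ξ).1 - (y t ξ).1)))
      0 (Icc 0 δ) t := by
    rw [hasDerivWithinAt_iff_isLittleO, Asymptotics.isLittleO_iff]
    intro c hc
    filter_upwards [F.eventually_abs_deriv_sub_le S hu ht ξ (ε := c / (M + 1)) (by positivity),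
      self_mem_nhdsWithin] with s hs hsI
    rw [S.consistent t ht, sub_self, mul_zero, sub_zero, sub_self, sub_zero, smul_zero, sub_zero,
      ← S.consistent s hsI]
    have hX := (norm_fst_le (y s ξ - y t ξ)).trans (S.speed t ht s hsI ξ)
    rw [Real.norm_eq_abs, Prod.fst_sub] at hX
    have hd : ∀ x, HasDerivAt (fun x => a s x - D t ξ * x) (deriv (a s) x - D t ξ) x := fun x => by
      simpa using ((F.deriv_eq S hsI).1 x).hasDerivAt.fun_sub ((hasDerivAt_id x).const_mul (D t ξ))
    have hmv := (convex_closedBall (y t ξ).1 (M * |s - t|)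
      ).norm_image_sub_le_of_norm_hasDerivWithin_le
      (f := fun x => a s x - D t ξ * x) (C := c / (M + 1))
      (fun x _ => (hd x).hasDerivWithinAt) (fun x hx => by
        rw [Metric.mem_closedBall, Real.dist_eq] at hx
        exact hs x hx) (x := (y s ξ).1) (y := (y t ξ).1)
      (by rwa [Metric.mem_closedBall, Real.dist_eq])
      (Metric.mem_closedBall_self (by positivity))
    rw [Real.norm_eq_abs, Real.norm_eq_abs] at hmv ⊢
    rw [abs_sub_comm (y t ξ).1] at hmv
    calc |a s (y t ξ).1 - (a s (y s ξ).1 - D t ξ * ((y s ξ).1 - (y t ξ).1))|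
        = |a s (y t ξ).1 - D t ξ * (y t ξ).1 - (a s (y s ξ).1 - D t ξ * (y s ξ).1)| := by
          congr 1
          ring
      _ ≤ c / (M + 1) * |(y s ξ).1 - (y t ξ).1| := hmv
      _ ≤ c / (M + 1) * (M * |s - t|) := by gcongr
      _ ≤ c * |s - t| := by
          rw [div_mul_eq_mul_div, div_le_iff₀ (by positivity)]
          have : 0 ≤ c * |s - t| := by positivity
          linarith
  have h3 := h2.fun_add h1
  simp only [sub_add_cancel] at h3
  refine h3.congr_deriv ?_
  simp only [charField, charRate]
  ring

theorem SlopeFlow.isTrafficSolution (S : SelfFlow γa γb δ Λ M u₀ a y)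
    (F : SlopeFlow γa γb δ Λ u₀ a y p D) (hu : IsH2 u₀) : IsTrafficSolution γa γb u₀ δ a := by
  have hcont := S.density.continuous_apply
  refine ⟨S.initial, fun t _ => hcont t, ?_, fun t ht x => ?_⟩
  · obtain ⟨U, U₁, U₂, h, h₁, h₂, hU⟩ := S.continuousInH2 F hu
    exact ⟨U, U₁, U₂, h.mono Ico_subset_Icc_self, h₁.mono Ico_subset_Icc_self,
      h₂.mono Ico_subset_Icc_self, fun t ht => hU t (Ico_subset_Icc_self ht)⟩
  · have ht' := Ico_subset_Icc_self ht
    obtain ⟨ξ, rfl⟩ := (S.near t ht').surjective x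
    refine ⟨_, hasDerivAt_trafficFlux S.posA S.posB (hcont t) (F.hasDerivAt_density t ht' ξ), ?_⟩
    rw [S.consistent t ht']
    exact (F.hasDerivWithinAt_density S hu ht' ξ).mono_of_mem_nhdsWithin
      (mem_of_superset (inter_mem_nhdsWithin (Ici 0) (Iio_mem_nhds ht.2))
        fun s hs => ⟨hs.1, hs.2.le⟩)

end

theorem potentialCurv_le {γa γb : ℝ} (hb : 0 < γb) (hab : γb ≤ γa) {w : ℝ → ℝ}
    (h : ∀ x, 0 ≤ w x ∧ w x ≤ 1) (x : ℝ) : potentialCurv γa γb w x ≤ 2 / γb ^ 2 := by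
  unfold potentialCurv
  have h1 : 2 / γa ^ 2 ≤ 2 / γb ^ 2 := by gcongr
  have h2 : 0 ≤ 2 / γa ^ 2 := by positivity
  have p1 := h (x + γa)
  have p2 := h x
  have p3 := h (x - γb)
  have i1 : -(2 / γa ^ 2) * (w (x + γa) - w x) ≤ 2 / γa ^ 2 * w x := by
    have := mul_nonneg h2 p1.1
    linarith
  have i2 : 2 / γa ^ 2 * w x ≤ 2 / γb ^ 2 * w x := mul_le_mul_of_nonneg_right h1 p2.1
  have i3 : 0 ≤ 2 / γb ^ 2 * (1 - w (x - γb)) := mul_nonneg (h2.trans h1) (by linarith)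
  linarith

/-- The threshold for the slope above which it grows. -/
noncomputable def slopeThreshold (γa γb : ℝ) : ℝ :=
  (γa + γb) / (γa * γb) * (1 + Real.sqrt (3 / 2 + (γa / (2 * (γa + γb))) ^ 2))

theorem slopeThreshold_eq {γa γb : ℝ} (ha : 0 < γa) (hb : 0 < γb) : ∃ r, 0 ≤ r ∧
    slopeThreshold γa γb = kap γa γb + r ∧
      r ^ 2 = 3 / 2 * kap γa γb ^ 2 + 1 / 4 * (1 / γb) ^ 2 := by
  refine ⟨kap γa γb * Real.sqrt (3 / 2 + (γa / (2 * (γa + γb))) ^ 2),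
    mul_nonneg (kap_pos ha hb).le (Real.sqrt_nonneg _), ?_, ?_⟩
  · have : (γa + γb) / (γa * γb) = kap γa γb := by
      unfold kap
      field_simp
      ring
    rw [slopeThreshold, this]
    ring
  · rw [mul_pow, Real.sq_sqrt (by positivity)]
    unfold kap
    field_simp
    ring

theorem half_sq_le_slopeRate {γa γb : ℝ} (ha : 0 < γa) (hb : 0 < γb) {E R s v d : ℝ} (hE : 0 ≤ E)
    (hv0 : 0 ≤ v) (hv1 : v ≤ 1) (hR0 : R ≤ 0) (hR : -(2 * kap γa γb) ≤ R) (hs : s ≤ 2 / γb ^ 2)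
    (hd : slopeThreshold γa γb ≤ d) :
    E * (d ^ 2 / 2) ≤ slopeRate (kap γa γb) E (2 * kap γa γb * v + R) s v d := by
  obtain ⟨r, hr0, hr, hr2⟩ := slopeThreshold_eq ha hb
  have hκ := kap_pos ha hb
  have hβ : 1 / γb ≤ kap γa γb := by
    unfold kap
    have : 0 < 1 / γa := by positivity
    linarith
  have hβ0 : 0 < 1 / γb := by positivity
  have hs' : s ≤ 2 * (1 / γb) ^ 2 := hs.trans (le_of_eq (by ring))
  rw [hr] at hd
  generalize kap γa γb = κ at *
  generalize 1 / γb = β at *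
  unfold slopeRate
  refine mul_le_mul_of_nonneg_left ?_ hE
  have hb1 : 2 * (1 - 2 * v) * (2 * κ * v + R) + 2 * κ * (v * (1 - v)) ≤ κ := by
    rcases le_total v (1 / 2) with h | h
    · have h1 : (1 - 2 * v) * R ≤ 0 := mul_nonpos_of_nonneg_of_nonpos (by linarith) hR0
      have h2 : 0 ≤ κ * (10 * (v - 3 / 10) ^ 2 + 1 / 10) := by positivity
      nlinarith
    · have h1 : (2 * v - 1) * (-(2 * κ)) ≤ (2 * v - 1) * R :=
        mul_le_mul_of_nonneg_left hR (by linarith)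
      have h2 : 0 ≤ κ * (10 * (v - 7 / 10) ^ 2 + 1 / 10) := by positivity
      nlinarith
  have hm2 : (2 * κ * v + R) ^ 2 ≤ 4 * κ ^ 2 := by
    have h1 : 2 * κ * v ≤ 2 * κ := by nlinarith
    have h0 : 0 ≤ 2 * κ * v := by positivity
    have : |2 * κ * v + R| ≤ |2 * κ| := by
      rw [abs_of_pos (by positivity : 0 < 2 * κ)]
      exact abs_le.2 ⟨by linarith, by linarith⟩
    have := sq_le_sq.2 this
    linarith
  have hv : v * (1 - v) ≤ 1 / 4 := by nlinarith [sq_nonneg (v - 1 / 2)]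
  have hv' : 0 ≤ v * (1 - v) := mul_nonneg hv0 (by linarith)
  have hq : v * (1 - v) * ((2 * κ * v + R) ^ 2 + s) ≤ κ ^ 2 + β ^ 2 / 2 := by
    have h1 : v * (1 - v) * ((2 * κ * v + R) ^ 2 + s) ≤ v * (1 - v) * (4 * κ ^ 2 + 2 * β ^ 2) :=
      mul_le_mul_of_nonneg_left (by linarith) hv'
    have h2 : v * (1 - v) * (4 * κ ^ 2 + 2 * β ^ 2) ≤ 1 / 4 * (4 * κ ^ 2 + 2 * β ^ 2) :=
      mul_le_mul_of_nonneg_right hv (by positivity)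
    linarith
  have hd0 : 0 < d := by linarith
  have hbd := mul_le_mul_of_nonneg_right hb1 hd0.le
  have hβκ : β ^ 2 ≤ κ ^ 2 := by gcongr
  have hdr : κ ^ 2 + β ^ 2 / 2 + κ * d ≤ 3 / 2 * d ^ 2 := by
    obtain ⟨e, he, rfl⟩ : ∃ e, 0 ≤ e ∧ d = κ + r + e := ⟨d - (κ + r), by linarith, by ring⟩
    have : 0 ≤ κ * r := by positivity
    have : 0 ≤ κ * e := by positivity
    have : 0 ≤ r * e := by positivity
    nlinarith [sq_nonneg e]
  linarith

/-- A bound below which slopes increase. -/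
noncomputable def slopeFloor (γa γb : ℝ) : ℝ := 6 * kap γa γb + (2 / γa ^ 2 + 2 / γb ^ 2) + 1

theorem slopeRate_pos_of_le {γa γb : ℝ} (ha : 0 < γa) (hb : 0 < γb) {E m s v B : ℝ} (hE : 0 < E)
    (hv0 : 0 ≤ v) (hv1 : v ≤ 1) (hm : |m| ≤ 2 * kap γa γb)
    (hs : |s| ≤ 2 / γa ^ 2 + 2 / γb ^ 2) (hB : slopeFloor γa γb ≤ B) :
    0 < slopeRate (kap γa γb) E m s v (-B) := by
  have hκ := kap_pos ha hb
  unfold slopeFloor at hB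
  have hr : 0 ≤ 2 / γa ^ 2 + 2 / γb ^ 2 := by positivity
  generalize 2 / γa ^ 2 + 2 / γb ^ 2 = r at *
  generalize kap γa γb = κ at *
  refine mul_pos hE ?_
  have hB0 : 0 < B := by linarith
  have hv' : 0 ≤ v * (1 - v) := mul_nonneg hv0 (by linarith)
  have hv : v * (1 - v) ≤ 1 := by nlinarith
  have hm2 : m ^ 2 ≤ 4 * κ ^ 2 := by
    have : |m| ≤ |2 * κ| := by rwa [abs_of_pos (by positivity : 0 < 2 * κ)]
    have := sq_le_sq.2 this
    linarith
  have h1 : -(4 * κ) ≤ 2 * (1 - 2 * v) * m := by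
    have h2 : |1 - 2 * v| ≤ 1 := abs_le.2 ⟨by linarith, by linarith⟩
    have h3 : |(1 - 2 * v) * m| ≤ 1 * (2 * κ) := by
      rw [abs_mul]
      exact mul_le_mul h2 hm (abs_nonneg _) zero_le_one
    linarith [(abs_le.1 h3).1]
  have h4 : v * (1 - v) * (m ^ 2 + s) ≤ 4 * κ ^ 2 + r := by
    have h5 : v * (1 - v) * (m ^ 2 + s) ≤ v * (1 - v) * (4 * κ ^ 2 + r) :=
      mul_le_mul_of_nonneg_left (by linarith [(abs_le.1 hs).2]) hv'
    have h6 : v * (1 - v) * (4 * κ ^ 2 + r) ≤ 1 * (4 * κ ^ 2 + r) :=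
      mul_le_mul_of_nonneg_right hv (by positivity)
    linarith
  have h7 : 0 ≤ 2 * κ * (v * (1 - v)) := by positivity
  have h8 : -(4 * κ) * B ≤ (2 * (1 - 2 * v) * m + 2 * κ * (v * (1 - v))) * B :=
    mul_le_mul_of_nonneg_right (by linarith) hB0.le
  have h9 : (6 * κ + r + 1) * B ≤ B * B := mul_le_mul_of_nonneg_right hB hB0.le
  have h10 : 1 * (6 * κ + r + 1) ≤ B * B := by nlinarith
  have h11 : (6 * κ + r + 1) * (6 * κ + r + 1) ≤ B * B := mul_le_mul hB hB (by positivity) hB0.le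
  nlinarith [mul_pos hκ hκ, mul_nonneg hκ.le hr]

/-- Control of the values and slopes of the state `w'` reached from the state `w` after time `τ`. -/
structure SlopeControl (γa γb : ℝ) (w w' : ℝ → ℝ) (τ : ℝ) : Prop where
  mem : ∀ x, 0 ≤ w' x ∧ w' x ≤ 1
  lower : ∀ B, slopeFloor γa γb ≤ B → (∀ x, -B ≤ deriv w x) → ∀ x, -B ≤ deriv w' x
  upper : ∀ ξ, slopeThreshold γa γb < deriv w ξ → ∃ x, slopeThreshold γa γb < deriv w' x ∧
    (deriv w' x)⁻¹ ≤ (deriv w ξ)⁻¹ - Real.exp (-4) / 2 * τ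

theorem SlopeControl.trans {γa γb : ℝ} {w w' w'' : ℝ → ℝ} {τ τ' : ℝ}
    (h : SlopeControl γa γb w w' τ) (h' : SlopeControl γa γb w' w'' τ') :
    SlopeControl γa γb w w'' (τ + τ') := by
  refine ⟨h'.mem, fun B hB hw => h'.lower B hB (h.lower B hB hw), fun ξ hξ => ?_⟩
  obtain ⟨x, hx, hx'⟩ := h.upper ξ hξ
  obtain ⟨z, hz, hz'⟩ := h'.upper x hx
  exact ⟨z, hz, by linarith⟩

theorem le_of_deriv_pos {f f' : ℝ → ℝ} {δ d t : ℝ}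
    (hf : ∀ s ∈ Icc 0 δ, HasDerivWithinAt f (f' s) (Icc 0 δ) s) (h0 : d ≤ f 0)
    (hpos : ∀ s ∈ Icc 0 δ, f s = d → 0 < f' s) (ht : t ∈ Icc 0 δ) : d ≤ f t := by
  have := image_le_of_deriv_right_lt_deriv_boundary (f := fun s => -f s) (f' := fun s => -f' s)
    (a := 0) (b := δ) (B := fun _ => -d) (B' := fun _ => 0)
    (fun s hs => (hf s hs).continuousWithinAt.neg)
    (fun s hs => ((hf s (Ico_subset_Icc_self hs)).mono_of_mem_nhdsWithin
      (Icc_mem_nhdsGE_of_mem hs)).neg) (neg_le_neg h0) (fun s => hasDerivAt_const _ _)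
    (fun s hs h => neg_neg_of_pos (hpos s (Ico_subset_Icc_self hs) (neg_inj.1 h))) ht
  exact neg_le_neg_iff.1 this

theorem inv_le_of_deriv_ge {f f' : ℝ → ℝ} {δ d c t : ℝ} (hd : 0 < d)
    (hf : ∀ s ∈ Icc 0 δ, HasDerivWithinAt f (f' s) (Icc 0 δ) s) (hdf : ∀ s ∈ Icc 0 δ, d ≤ f s)
    (hc : ∀ s ∈ Icc 0 δ, c * f s ^ 2 ≤ f' s) (ht : t ∈ Icc 0 δ) :
    (f t)⁻¹ ≤ (f 0)⁻¹ - c * t := by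
  have hpos : ∀ s ∈ Icc 0 δ, 0 < f s := fun s hs => hd.trans_le (hdf s hs)
  have h1 : ∀ s ∈ Icc 0 δ, HasDerivWithinAt (fun s => (f s)⁻¹) (-f' s / f s ^ 2) (Icc 0 δ) s :=
    fun s hs => (hf s hs).fun_inv (hpos s hs).ne'
  refine image_le_of_deriv_right_le_deriv_boundary (f := fun s => (f s)⁻¹)
    (f' := fun s => -f' s / f s ^ 2) (B := fun s => (f 0)⁻¹ - c * s) (B' := fun _ => -c)
    (a := 0) (b := δ) (fun s hs => (h1 s hs).continuousWithinAt)
    (fun s hs => (h1 s (Ico_subset_Icc_self hs)).mono_of_mem_nhdsWithin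
      (Icc_mem_nhdsGE_of_mem hs)) (by simp) (by fun_prop) (fun s hs => ?_) (fun s hs => ?_) ht
  · have := ((hasDerivAt_id s).const_mul c).const_sub (f 0)⁻¹
    rw [mul_one] at this
    exact this.hasDerivWithinAt
  · have := pow_pos (hpos s (Ico_subset_Icc_self hs)) 2
    rw [div_le_iff₀ this]
    linarith [hc s (Ico_subset_Icc_self hs)]

theorem SlopeFlow.slopeControl {γa γb δ Λ M : ℝ} {u₀ : ℝ → ℝ} {a : ℝ → ℝ → ℝ}
    {y : ℝ → ℝ → ℝ × ℝ} {p D : ℝ → ℝ → ℝ} (S : SelfFlow γa γb δ Λ M u₀ a y)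
    (F : SlopeFlow γa γb δ Λ u₀ a y p D) (hab : γb ≤ γa) {t : ℝ} (ht : t ∈ Icc 0 δ) :
    SlopeControl γa γb u₀ (a t) t := by
  have hm : ∀ s ∈ Icc 0 δ, ∀ ξ, |2 * kap γa γb * (y s ξ).2 +
      potentialRem γa γb (a s) (y s ξ).1| ≤ 2 * kap γa γb := fun s hs ξ => by
    have := abs_slope_le S.posA S.posB (S.density.mem s) (y s ξ).1
    rwa [S.consistent s hs] at this
  refine ⟨S.density.mem t, fun B hB hw x => ?_, fun ξ hξ => ?_⟩
  · obtain ⟨ξ, rfl⟩ := (S.near t ht).surjective x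
    rw [(F.hasDerivAt_density t ht ξ).deriv]
    refine le_of_deriv_pos (f := fun s => D s ξ) (fun s hs => F.deriv_slope s hs ξ)
      (by rw [F.initial]; exact hw ξ) (fun s hs h => ?_) ht
    rw [h]
    exact slopeRate_pos_of_le S.posA S.posB (Real.exp_pos _) (S.flow.mem ξ s hs).1
      (S.flow.mem ξ s hs).2 (hm s hs ξ) (abs_potentialCurv_le (S.density.mem s) _) hB
  · have hθ : 0 < slopeThreshold γa γb := by
      obtain ⟨r, hr, h, -⟩ := slopeThreshold_eq S.posA S.posB
      have := kap_pos S.posA S.posB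
      linarith
    have hrate : ∀ s ∈ Icc 0 δ, slopeThreshold γa γb ≤ D s ξ →
        Real.exp (-4) / 2 * D s ξ ^ 2 ≤ slopeRate (kap γa γb)
          (Real.exp (potential γa γb (a s) (y s ξ).1))
          (2 * kap γa γb * (y s ξ).2 + potentialRem γa γb (a s) (y s ξ).1)
          (potentialCurv γa γb (a s) (y s ξ).1) (y s ξ).2 (D s ξ) := fun s hs h => by
      have hd := S.density.mem s
      have h1 : ∀ x, |a s x| ≤ 1 := fun x => _root_.abs_le.2 ⟨by linarith [(hd x).1], (hd x).2⟩
      have h2 := (_root_.abs_le.1 (abs_potential_le S.posA S.posB h1 (y s ξ).1)).1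
      refine le_trans ?_ (half_sq_le_slopeRate S.posA S.posB (Real.exp_pos _).le
        (S.flow.mem ξ s hs).1 (S.flow.mem ξ s hs).2
        (potentialRem_nonpos S.posA S.posB (fun x => (hd x).1) _)
        (neg_le_potentialRem S.posA S.posB hd _) (potentialCurv_le S.posB hab hd _) h)
      have h3 : Real.exp (-4) ≤ Real.exp (potential γa γb (a s) (y s ξ).1) :=
        Real.exp_le_exp.2 (by linarith)
      have h4 := mul_le_mul_of_nonneg_right h3 (by positivity : 0 ≤ D s ξ ^ 2 / 2)
      linarith
    have hge : ∀ s ∈ Icc 0 δ, deriv u₀ ξ ≤ D s ξ := fun s hs =>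
      le_of_deriv_pos (f := fun s => D s ξ) (fun s hs => F.deriv_slope s hs ξ)
        (by rw [F.initial]) (fun s hs h => by
          refine lt_of_lt_of_le ?_ (hrate s hs (by rw [h]; exact hξ.le))
          have : 0 < D s ξ := by
            rw [h]
            linarith
          positivity) hs
    refine ⟨(y t ξ).1, ?_, ?_⟩
    · rw [(F.hasDerivAt_density t ht ξ).deriv]
      exact hξ.trans_le (hge t ht)
    · rw [(F.hasDerivAt_density t ht ξ).deriv, ← F.initial ξ]
      exact inv_le_of_deriv_ge (f := fun s => D s ξ) (hθ.trans hξ)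
        (fun s hs => F.deriv_slope s hs ξ) hge
        (fun s hs => hrate s hs (hξ.le.trans (hge s hs))) ht

theorem exists_local_solution {γa γb : ℝ} (hb : 0 < γb) (hab : γb ≤ γa) {L : ℝ} (hL : 0 ≤ L) :
    ∃ δ : ℝ, 0 < δ ∧ ∀ u₀ : ℝ → ℝ, IsH2 u₀ → (∀ x, 0 ≤ u₀ x ∧ u₀ x ≤ 1) →
      (∀ x, |deriv u₀ x| ≤ L) → ∃ a, IsTrafficSolution γa γb u₀ δ a ∧
        ∀ t ∈ Ico 0 δ, SlopeControl γa γb u₀ (a t) t := by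
  have ha := hb.trans_le hab
  obtain ⟨M, K, B⟩ := exists_charBounds ha hb
  obtain ⟨δ, Λ, hδ, hK, h⟩ := exists_selfFlow ha hb B hL
  refine ⟨δ, hδ, fun u₀ hu h01 hd => ?_⟩
  obtain ⟨a, y, S⟩ := h u₀ h01 (abs_sub_le_of_hasDerivAt
    (fun x => (hu.differentiable x).hasDerivAt) hd)
  obtain ⟨p, D, F⟩ := S.exists_slopeFlow B hK hu.differentiable
  exact ⟨a, F.isTrafficSolution S hu, fun t ht => F.slopeControl S hab (Ico_subset_Icc_self ht)⟩

theorem hasDerivWithinAt_comp_const_sub {f : ℝ → ℝ} {q c t : ℝ}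
    (h : HasDerivWithinAt f q (Ici 0) (t - c)) :
    HasDerivWithinAt (fun s => f (s - c)) q (Ici c) t := by
  have h1 : HasDerivWithinAt (fun s => s - c) 1 (Ici c) t :=
    (hasDerivAt_id t).hasDerivWithinAt.sub_const c
  exact (h.scomp t h1 fun s (hs : c ≤ s) => sub_nonneg.2 hs).congr_deriv (one_smul ℝ q)

namespace IsTrafficSolution

variable {γa γb S T : ℝ} {u₀ : ℝ → ℝ} {u : ℝ → ℝ → ℝ}

theorem shift (h : IsTrafficSolution γa γb u₀ S u) {c : ℝ} (hc : c ∈ Ico 0 S) :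
    IsTrafficSolution γa γb (u c) (S - c) fun t => u (t + c) := by
  have hmaps : MapsTo (fun t => t + c) (Ico 0 (S - c)) (Ico 0 S) := fun t ht =>
    ⟨add_nonneg ht.1 hc.1, by linarith [ht.2]⟩
  refine ⟨by simp, fun t ht => h.continuous _ (hmaps ht), ?_, fun t ht x => ?_⟩
  · obtain ⟨U, U₁, U₂, h0, h1, h2, hU⟩ := h.memH2
    have hcont : ContinuousOn (fun t : ℝ => t + c) (Ico 0 (S - c)) := by fun_prop
    exact ⟨fun t => U (t + c), fun t => U₁ (t + c), fun t => U₂ (t + c), h0.comp hcont hmaps,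
      h1.comp hcont hmaps, h2.comp hcont hmaps, fun t ht => hU _ (hmaps ht)⟩
  · obtain ⟨q, hq, hq'⟩ := h.equation _ (hmaps ht) x
    refine ⟨q, hq, ?_⟩
    have h1 : HasDerivWithinAt (fun s => s + c) 1 (Ici 0) t :=
      (hasDerivAt_id t).hasDerivWithinAt.add_const c
    exact (hq'.scomp t h1 fun s (hs : 0 ≤ s) => add_nonneg hs hc.1).congr_deriv (one_smul ℝ (-q))

/-- A function that is locally in time a translated solution is a solution. -/
theorem of_local (h0 : u 0 = u₀) (h : ∀ t ∈ Ico 0 T, ∃ c S v, 0 ≤ c ∧ c ≤ t ∧ (c = 0 ∨ c < t) ∧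
      t < c + S ∧ IsTrafficSolution γa γb (u c) S v ∧ ∀ s ∈ Ico c (c + S), u s = v (s - c)) :
    IsTrafficSolution γa γb u₀ T u := by
  have hnhds : ∀ {c S t : ℝ}, (c = 0 ∨ c < t) → t < c + S → Ico c (c + S) ∈ 𝓝[Ici 0] t := by
    rintro c S t (rfl | hct) htS
    · exact inter_mem_nhdsWithin (Ici 0) (Iio_mem_nhds htS)
    · exact mem_nhdsWithin_of_mem_nhds (Ico_mem_nhds hct htS)
  have hcont : ∀ t ∈ Ico 0 T, Continuous (u t) := fun t ht => by
    obtain ⟨c, S, v, hc, hct, -, htS, hv, huv⟩ := h t ht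
    rw [huv t ⟨hct, htS⟩]
    exact hv.continuous _ ⟨by linarith, by linarith⟩
  have hl2 : ∀ Φ : (ℝ → ℝ) → Lp ℝ 2 (volume : Measure ℝ),
      (∀ c S v, IsTrafficSolution γa γb (u c) S v → ContinuousOn (fun t => Φ (v t)) (Ico 0 S)) →
      ContinuousOn (fun t => Φ (u t)) (Ico 0 T) := fun Φ hΦ t ht => by
    obtain ⟨c, S, v, hc, hct, hc', htS, hv, huv⟩ := h t ht
    have hmaps : MapsTo (fun s => s - c) (Ico c (c + S)) (Ico 0 S) := fun s hs =>
      ⟨sub_nonneg.2 hs.1, by linarith [hs.2]⟩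
    have h1 : ContinuousOn (fun s => Φ (v (s - c))) (Ico c (c + S)) :=
      (hΦ c S v hv).comp (by fun_prop : ContinuousOn (fun s => s - c) (Ico c (c + S))) hmaps
    have h2 : ContinuousOn (fun s => Φ (u s)) (Ico c (c + S)) :=
      h1.congr fun s hs => by simp only [huv s hs]
    exact (h2 t ⟨hct, htS⟩).mono_of_mem_nhdsWithin
      (nhdsWithin_mono t Ico_subset_Ici_self (hnhds hc' htS))
  refine ⟨h0, hcont, (continuousInH2_iff hcont).2 ⟨fun t ht => ?_, ?_, ?_, ?_⟩, fun t ht x => ?_⟩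
  · obtain ⟨c, S, v, hc, hct, -, htS, hv, huv⟩ := h t ht
    rw [huv t ⟨hct, htS⟩]
    exact hv.isH2 ⟨by linarith, by linarith⟩
  · exact hl2 (fun f => l2Class f) fun c S v hv =>
      ((continuousInH2_iff hv.continuous).1 hv.memH2).2.1
  · exact hl2 (fun f => l2Class (deriv f)) fun c S v hv =>
      ((continuousInH2_iff hv.continuous).1 hv.memH2).2.2.1
  · exact hl2 (fun f => l2Class (deriv (deriv f))) fun c S v hv =>
      ((continuousInH2_iff hv.continuous).1 hv.memH2).2.2.2
  · obtain ⟨c, S, v, hc, hct, hc', htS, hv, huv⟩ := h t ht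
    obtain ⟨q, hq, hq'⟩ := hv.equation (t - c) ⟨by linarith, by linarith⟩ x
    refine ⟨q, by rwa [huv t ⟨hct, htS⟩], ?_⟩
    have h1 := (hasDerivWithinAt_comp_const_sub hq').mono
      (Ico_subset_Ici_self : Ico c (c + S) ⊆ Ici c)
    have h2 : HasDerivWithinAt (fun s => u s x) (-q) (Ico c (c + S)) t :=
      h1.congr (fun s hs => by rw [huv s hs]) (by rw [huv t ⟨hct, htS⟩])
    exact h2.mono_of_mem_nhdsWithin (hnhds hc' htS)

/-- Every solution with density in `[0, 1]` initially keeps its slopes under control. -/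
theorem slopeControl (h : IsTrafficSolution γa γb u₀ S u) (hb : 0 < γb) (hab : γb ≤ γa)
    (h01 : ∀ x, 0 ≤ u₀ x ∧ u₀ x ≤ 1) {t : ℝ} (ht : t ∈ Ico 0 S) :
    SlopeControl γa γb u₀ (u t) t := by
  have ha := hb.trans_le hab
  have hI : Icc 0 t ⊆ Ico 0 S := fun s hs => ⟨hs.1, hs.2.trans_lt ht.2⟩
  obtain ⟨L, hL, hd⟩ := h.memH2.exists_abs_le h.continuous isCompact_Icc hI
  obtain ⟨δ, hδ, hloc⟩ := exists_local_solution hb hab hL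
  have key : ∀ n : ℕ, ∀ s ∈ Icc 0 t, s ≤ n * (δ / 2) → SlopeControl γa γb u₀ (u s) s := by
    intro n
    induction n with
    | zero =>
      intro s hs hsn
      have : s = 0 := le_antisymm (by simpa using hsn) hs.1
      rw [this, h.initial]
      exact ⟨h01, fun B _ hw => hw, fun ξ hξ => ⟨ξ, hξ, by simp⟩⟩
    | succ n ih =>
      intro s hs hsn
      push_cast at hsn
      set c := max 0 (s - δ / 2) with hc
      have hc0 : 0 ≤ c := le_max_left _ _
      have hcs : c ≤ s := max_le hs.1 (by linarith)
      have hct : c ∈ Icc 0 t := ⟨hc0, hcs.trans hs.2⟩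
      have hcδ : s - c < δ := by
        have := le_max_right 0 (s - δ / 2)
        linarith
      have h1 := ih c hct (max_le (by positivity) (by linarith))
      obtain ⟨a, hsol, hctrl⟩ := hloc (u c) (h.isH2 (hI hct)) h1.mem fun x => (hd c hct x).2
      have h2 := hctrl (s - c) ⟨by linarith, hcδ⟩
      have hsS := (hI hs).2
      have h3 := (h.shift (hI hct)).eq ha hb hsol (t₁ := s - c) (by linarith) (by linarith) hcδ
      simp only [sub_add_cancel] at h3
      rw [← h3] at h2
      simpa using h1.trans h2
  obtain ⟨n, hn⟩ := exists_nat_ge (t / (δ / 2))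
  exact key n t ⟨ht.1, le_rfl⟩ (by rwa [div_le_iff₀ (by positivity)] at hn)

/-- A solution followed by a solution starting from one of its states. -/
theorem exists_extension (h : IsTrafficSolution γa γb u₀ S u) (ha : 0 < γa) (hb : 0 < γb) {c δ : ℝ}
    (hc : c ∈ Ico 0 S) {v : ℝ → ℝ → ℝ} (hv : IsTrafficSolution γa γb (u c) δ v) :
    ∃ w, IsTrafficSolution γa γb u₀ (c + δ) w := by
  have hS : 0 < S := hc.1.trans_lt hc.2
  classical
  set w : ℝ → ℝ → ℝ := fun s => if s < S then u s else v (s - c) with hw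
  have w1 : ∀ s, s < S → w s = u s := fun s hs => if_pos hs
  refine ⟨w, of_local (by rw [w1 0 hS, h.initial]) fun t ht => ?_⟩
  rcases lt_or_ge t S with htS | htS
  · refine ⟨0, S, u, le_rfl, ht.1, Or.inl rfl, by simpa using htS, ?_, fun s hs => ?_⟩
    · rw [w1 0 hS, h.initial]
      exact h
    · rw [zero_add] at hs
      rw [w1 s hs.2, sub_zero]
  · refine ⟨c, δ, v, hc.1, by linarith [hc.2], Or.inr (hc.2.trans_le htS), ht.2, ?_,
      fun s hs => ?_⟩
    · rw [w1 c hc.2]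
      exact hv
    · rcases lt_or_ge s S with hsS | hsS
      · rw [w1 s hsS]
        have := (h.shift hc).eq ha hb hv (t₁ := s - c) (by linarith [hs.1]) (by linarith)
          (by linarith [hs.2])
        simpa using this
      · exact if_neg (not_lt.2 hsS)

end IsTrafficSolution

/-- For a supercritical initial slope there is a finite time `T` and a unique `H²` solution on
`[0, T)`; it is maximal, and `sup_x u_x(t, x) → +∞` as `t → T`. -/
theorem theorem1p2 (γa γb : ℝ) (hb : 0 < γb) (hab : γb ≤ γa)
    (u₀ : ℝ → ℝ) (hcont : Continuous u₀) (hH2 : MemH2 u₀)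
    (h01 : ∀ x, 0 ≤ u₀ x ∧ u₀ x ≤ 1)
    (hslope : ∃ x, (γa + γb) / (γa * γb) *
      (1 + Real.sqrt (3 / 2 + (γa / (2 * (γa + γb))) ^ 2)) < deriv u₀ x) :
    ∃ T : ℝ, 0 < T ∧ ∃ u : ℝ → ℝ → ℝ,
      IsTrafficSolution γa γb u₀ T u ∧
      (∀ (S : ℝ) (v : ℝ → ℝ → ℝ), 0 < S → IsTrafficSolution γa γb u₀ S v →
        S ≤ T ∧ ∀ t ∈ Ico 0 S, v t = u t) ∧
      ∀ M : ℝ, ∀ᶠ t in 𝓝[<] T, ∃ x : ℝ, M < deriv (u t) x := by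
  have ha := hb.trans_le hab
  have hu := hH2.isH2 hcont
  obtain ⟨ξ, hξ⟩ := hslope
  change slopeThreshold γa γb < deriv u₀ ξ at hξ
  have hθ : 0 < slopeThreshold γa γb := by
    obtain ⟨r, hr, h, -⟩ := slopeThreshold_eq ha hb
    have := kap_pos ha hb
    linarith
  obtain ⟨b, hbd⟩ := hu.exists_abs_le
  have hb0 : 0 ≤ b := (abs_nonneg _).trans (hbd 0).1
  set 𝒮 : Set ℝ := {S | 0 < S ∧ ∃ v, IsTrafficSolution γa γb u₀ S v} with h𝒮
  obtain ⟨δ₀, hδ₀, hloc₀⟩ := exists_local_solution hb hab hb0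
  obtain ⟨a₀, ha₀, -⟩ := hloc₀ u₀ hu h01 fun x => (hbd x).2
  have hbdd : BddAbove 𝒮 := by
    refine ⟨(deriv u₀ ξ)⁻¹ / (Real.exp (-4) / 2), fun S hS => ?_⟩
    obtain ⟨hS0, v, hv⟩ := hS
    refine le_of_forall_lt_imp_le_of_dense fun t ht => ?_
    rcases lt_or_ge t 0 with h | h
    · exact h.le.trans (div_nonneg (inv_nonneg.2 (hθ.trans hξ).le) (by positivity))
    · obtain ⟨x, hx, hx'⟩ := (hv.slopeControl hb hab h01 ⟨h, ht⟩).upper ξ hξ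
      have := inv_pos.2 (hθ.trans hx)
      rw [le_div_iff₀ (by positivity)]
      linarith
  set T := sSup 𝒮 with hT
  have hmem₀ : δ₀ ∈ 𝒮 := ⟨hδ₀, a₀, ha₀⟩
  have hTpos : 0 < T := hδ₀.trans_le (le_csSup hbdd hmem₀)
  have hex : ∀ t, t < T → ∃ S v, t < S ∧ 0 < S ∧ IsTrafficSolution γa γb u₀ S v := fun t ht => by
    obtain ⟨S, ⟨hS0, v, hv⟩, hS⟩ := exists_lt_of_lt_csSup ⟨δ₀, hmem₀⟩ ht
    exact ⟨S, v, hS, hS0, hv⟩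
  choose! σ V hσ hσ0 hV using hex
  set u : ℝ → ℝ → ℝ := fun t => V t t with hudef
  have huniq : ∀ (S : ℝ) (v : ℝ → ℝ → ℝ), 0 < S → IsTrafficSolution γa γb u₀ S v →
      S ≤ T ∧ ∀ t ∈ Ico 0 S, v t = u t := fun S v hS hv => by
    have hST : S ≤ T := le_csSup hbdd ⟨hS, v, hv⟩
    refine ⟨hST, fun t ht => ?_⟩
    have htT := ht.2.trans_le hST
    exact hv.eq ha hb (hV t htT) ht.1 ht.2 (hσ t htT)
  have hu0 : u 0 = u₀ := (hV 0 hTpos).initial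
  have husol : IsTrafficSolution γa γb u₀ T u := by
    refine IsTrafficSolution.of_local hu0 fun t ht => ⟨0, σ t, V t, le_rfl, ht.1, Or.inl rfl,
      by simpa using hσ t ht.2, ?_, fun s hs => ?_⟩
    · rw [hu0]
      exact hV t ht.2
    · rw [zero_add] at hs
      rw [sub_zero]
      exact ((huniq _ _ (hσ0 t ht.2) (hV t ht.2)).2 s hs).symm
  refine ⟨T, hTpos, u, husol, huniq, fun M => ?_⟩
  by_contra hM
  have hfreq : ∃ᶠ t in 𝓝[<] T, ∀ x, deriv (u t) x ≤ M := by
    simpa only [Filter.not_eventually, not_exists, not_lt] using hM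
  set B := max (slopeFloor γa γb) b with hB
  set L := max |M| B with hL
  obtain ⟨δ, hδ, hloc⟩ := exists_local_solution hb hab (L := L)
    ((abs_nonneg M).trans (le_max_left _ _))
  have hnear : ∀ᶠ t in 𝓝[<] T, t ∈ Ioo (max 0 (T - δ)) T :=
    Ioo_mem_nhdsLT (max_lt hTpos (by linarith))
  obtain ⟨t, htM, ht⟩ := (hfreq.and_eventually hnear).exists
  have ht0 : t ∈ Ico 0 T := ⟨(le_max_left _ _).trans ht.1.le, ht.2⟩
  have hctrl := husol.slopeControl hb hab h01 ht0
  have hlow := hctrl.lower B (le_max_left _ _) fun x => by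
    have := (abs_le.1 (hbd x).2).1
    have := le_max_right (slopeFloor γa γb) b
    linarith
  obtain ⟨v, hv, -⟩ := hloc (u t) (husol.isH2 ht0) hctrl.mem fun x => by
    have h1 : B ≤ L := le_max_right _ _
    have h2 : |M| ≤ L := le_max_left _ _
    exact abs_le.2 ⟨by linarith [hlow x], by linarith [htM x, le_abs_self M]⟩
  obtain ⟨w, hw⟩ := husol.exists_extension ha hb ht0 hv
  have h1 : T - δ < t := (le_max_right _ _).trans_lt ht.1
  have h2 := (huniq (t + δ) w (by linarith [ht0.1]) hw).1
  linarith
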